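/- **Setting.** Let $(\mathcal M,g)$ be a smooth time-oriented spacetime of dimension $m+2$ and signature $(-,+,\dots,+)$ satisfying Einstein's equations $\mathrm{Ric}-\tfrac12 Rg+\Lambda g=8\pi G\,T$ with $G>0$. Let $\hat{\mathcal B}$ be a compact connected smooth $m$-manifold. A *non-expanding horizon* is a null hypersurface $\mathcal H\subset\mathcal M$ that is the image of an embedding of $\hat{\mathcal B}\times\mathcal I$, $\mathcal I$ an open interval, whose null curves are the images of the curves $\{\hat x\}\times\mathcal I$, and such that, for the induced degenerate metric $q_{ab}$, $q^{AB}\mathcal L_\ell q_{AB}=0$ for every null $\ell$ tangent to $\mathcal H$ (here $q_{AB}$ is the metric induced on $T\mathcal H$ modulo the null directions). We assume that for every future-oriented null vector $\ell$ tangent to $\mathcal H$ the vector $-T^\mu{}_\nu\ell^\nu$ is causal and future oriented (or zero), and that the pull-back $T_{ab}$ of $T$ to $\mathcal H$ satisfies $\mathcal L_\ell T_{ab}=0$ for every null vector field $\ell$ tangent to $\mathcal H$. The Levi-Civita connection of $g$ then induces a connection $D$ on $\mathcal H$, and $q$ is the pull-back, by the projection $p:\mathcal H\to\hat{\mathcal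 B}$, of a Riemannian metric $\hat q$ on $\hat{\mathcal B}$. An *infinitesimal symmetry* of $\mathcal H$ is a nontrivial smooth vector field $X$ on $\mathcal H$ with $\mathcal L_Xq=0$ and $[\mathcal L_X,D]=0$. Let $(\bar{\mathcal H},\bar q,\bar D)$ be the maximal analytic extension of $(\mathcal H,q,D)$: $\bar{\mathcal H}=\hat{\mathcal B}\times\mathbb R$ with a smooth geometry $(\bar q,\bar D)$ that is analytic along the null curves $\{\hat x\}\times\mathbb R$ in the coordinate $v\in\mathbb R$, which is an affine parameter on each of them, and $\mathcal H\hookrightarrow\bar{\mathcal H}$ is an open embedding compatible with the projections to $\hat{\mathcal B}$ and with the geometries. For a null vector field $\bar\ell$ on $\bar{\mathcal H}$, define $\kappa$, the 1-form $\omega$ and the tensor $N_{ac}$, where $\bar\ell\neq0$, by $\bar D_{\bar\ell}\bar\ell=\kappa\bar\ell$, $\bar D_a\bar\ell^b=\omega_a\bar\ell^b$ and $[\mathcal L_{\bar\ell},\bar D_a]Z^b=\bar\ell^bN_{ac}Z^c$ for all vector fields $Z$. Call $\bar\ell$ *natural* if it is smooth, nonzero on an open dense set, and $\kappa=1$ and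 $\bar q^{AB}N_{AB}=0$. The horizon is *invariant-generic* if $\bar{\mathcal H}$ has exactly one natural vector field $\bar\ell$; its restriction $\ell$ to $\mathcal H$ is the *invariant vector field*. A *good cut* is a smooth section $\sigma:\hat{\mathcal B}\to\bar{\mathcal H}$ avoiding the zeros of $\bar\ell$ such that $\sigma^*\omega$ is divergence free for $\hat q$. The good cuts foliate $\{\bar\ell\ne0\}$; the *invariant foliation* is the restriction of this foliation to $\mathcal H$, and the *invariant covector field* $n$ is the 1-form on $\{\ell\neq0\}\subset\mathcal H$ that annihilates its leaves and satisfies $n(\ell)=-1$. **Theorem.** Let $X$ be an infinitesimal symmetry of an invariant-generic non-expanding horizon $\mathcal H$, with invariant vector field $\ell$ and invariant covector field $n$. Then: a) $[X,\ell]=0$ on $\mathcal H$, and $\mathcal L_Xn=0$ where $\ell\neq0$; b) there are a constant $a\in\mathbb R$, a smooth vector field $\tilde X$ on $\mathcal H$ and a Killing vector field $\hat X$ of $(\hat{\mathcal B},\hat q)$ such that $X=a\ell+\tilde X$ on $\mathcal H$, $\tilde X$ is tangent to the leaves of the invariant foliation, and $p_*\tilde X=\hat X$. -/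

import Mathlib

open scoped Manifold ContDiff Topology

noncomputable section

namespace Horizon

/-! ### Tensor calculus on a smooth manifold -/

section Calculus

variable {E : Type*} [NormedAddCommGroup E] [NormedSpace ℝ E] {H : Type*} [TopologicalSpace H]
  (I : ModelWithCorners ℝ E H) (M : Type*) [TopologicalSpace M] [ChartedSpace H M]

/-- (Not necessarily smooth) vector fields. -/
abbrev VField := ∀ x : M, TangentSpace I x

/-- (Not necessarily smooth) covector fields. -/
abbrev CovField := ∀ x : M, TangentSpace I x →L[ℝ] ℝ

/-- (Not necessarily smooth) covariant 2-tensor fields. -/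
abbrev BilinField := ∀ x : M, TangentSpace I x →L[ℝ] TangentSpace I x →L[ℝ] ℝ

variable {M} [IsManifold I ∞ M]

/-- The vector field `X` is smooth. -/
def SmoothField (X : VField I M) : Prop :=
  ContMDiff I I.tangent ∞ (fun x ↦ (⟨x, X x⟩ : TangentBundle I M))

/-- The 2-tensor field `S` is smooth, as a section of the bundle of bilinear forms. -/
def SmoothBilin (S : BilinField I M) : Prop :=
  ContMDiff I (I.prod 𝓘(ℝ, E →L[ℝ] E →L[ℝ] ℝ)) ∞
    (fun x ↦ Bundle.TotalSpace.mk' (E →L[ℝ] E →L[ℝ] ℝ)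
      (E := fun x : M ↦ TangentSpace I x →L[ℝ] TangentSpace I x →L[ℝ] ℝ) x (S x))

/-- The Lie bracket `[X, Y]`. -/
abbrev bracket (X Y : VField I M) : VField I M := VectorField.mlieBracket I X Y

/-- The derivative `X(f)` of a function along a vector field. -/
def along (X : VField I M) (f : M → ℝ) (x : M) : ℝ := mvfderiv I f x (X x)

/-- The Lie derivative of a 2-tensor: `(𝓛_X S)(Y, Z) = X(S(Y, Z)) - S([X, Y], Z) - S(Y, [X, Z])`. -/
def lieBilin (X : VField I M) (S : BilinField I M) (Y Z : VField I M) (x : M) : ℝ :=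
  along I X (fun y ↦ S y (Y y) (Z y)) x
    - S x (bracket I X Y x) (Z x) - S x (Y x) (bracket I X Z x)

/-- The Lie derivative of a covector: `(𝓛_X n)(Y) = X(n(Y)) - n([X, Y])`. -/
def lieCov (X : VField I M) (n : CovField I M) (Y : VField I M) (x : M) : ℝ :=
  along I X (fun y ↦ n y (Y y)) x - n x (bracket I X Y x)

/-- `𝓛_X S = 0`. -/
def LieDragged (X : VField I M) (S : BilinField I M) : Prop :=
  ∀ Y Z : VField I M, SmoothField I Y → SmoothField I Z → ∀ x, lieBilin I X S Y Z x = 0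

variable (M) in
/-- Affine connections on `M`.  Mathlib's argument order: `D Z x u` is `(D_u Z)(x)`. -/
abbrev Connection := CovariantDerivative I E (TangentSpace I : M → Type _)

variable {I}

/-- The vector field `D_Y Z`. -/
def nabla (D : Connection I M) (Y Z : VField I M) : VField I M := fun x ↦ D Z x (Y x)

/-- The commutator `[𝓛_X, D]`, contracted with vector fields:
`Y^a [𝓛_X, D_a] Z = [X, D_Y Z] - D_{[X, Y]} Z - D_Y [X, Z]`. -/
def lieConn (X : VField I M) (D : Connection I M) (Y Z : VField I M) : VField I M := fun x ↦
  bracket I X (nabla D Y Z) x - nabla D (bracket I X Y) Z x - nabla D Y (bracket I X Z) x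

/-- The curvature `R(X, Y) Z = D_X D_Y Z - D_Y D_X Z - D_{[X, Y]} Z`. -/
def curvature (D : Connection I M) (X Y Z : VField I M) : VField I M := fun x ↦
  nabla D X (nabla D Y Z) x - nabla D Y (nabla D X Z) x - nabla D (bracket I X Y) Z x

/-- `D` is a smooth connection. -/
def SmoothConnection (D : Connection I M) : Prop :=
  CovariantDerivative.ContMDiffCovariantDerivative D ∞

/-- `D` is the Levi-Civita connection of the (possibly indefinite) metric `g`: smooth,
torsion free and metric. -/
def IsLeviCivita (g : BilinField I M) (D : Connection I M) : Prop :=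
  SmoothConnection D ∧
  (∀ Y Z : VField I M, SmoothField I Y → SmoothField I Z → ∀ x,
    nabla D Y Z x - nabla D Z Y x = bracket I Y Z x) ∧
  (∀ X Y Z : VField I M, SmoothField I X → SmoothField I Y → SmoothField I Z → ∀ x,
    along I X (fun y ↦ g y (Y y) (Z y)) x = g x (nabla D X Y x) (Z x) + g x (Y x) (nabla D X Z x))

/-- `Ric` is the Ricci tensor of `D`: `Ric(Y, Z)` is the trace of `W ↦ R(W, Y) Z`. -/
def IsRicciTensor (D : Connection I M) (Ric : BilinField I M) : Prop :=
  ∀ (k : ℕ) (W : Fin k → VField I M) (Y Z : VField I M),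
    (∀ i, SmoothField I (W i)) → SmoothField I Y → SmoothField I Z →
    ∀ (x : M) (b : Module.Basis (Fin k) ℝ (TangentSpace I x)), (∀ i, b i = W i x) →
      Ric x (Y x) (Z x) = ∑ i, b.coord i (curvature D (W i) Y Z x)

/-- The trace `g^{μν} S_{μν}` with respect to a nondegenerate metric, computed in a basis. -/
def metricTrace [FiniteDimensional ℝ E] (g S : BilinField I M) (x : M) : ℝ :=
  let b : Module.Basis (Fin (Module.finrank ℝ E)) ℝ (TangentSpace I x) := Module.finBasis ℝ E
  ∑ i, ∑ j, (Matrix.of fun k l ↦ g x (b k) (b l))⁻¹ i j * S x (b i) (b j)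

/-- The vector fields `e i` are `q`-orthonormal at the point `x`. -/
def OrthonormalAt {k : ℕ} (q : BilinField I M) (e : Fin k → VField I M) (x : M) : Prop :=
  ∀ i j, q x (e i x) (e j x) = if i = j then 1 else 0

variable {E' : Type*} [NormedAddCommGroup E'] [NormedSpace ℝ E'] {H' : Type*}
  [TopologicalSpace H'] {I' : ModelWithCorners ℝ E' H'} {N : Type*} [TopologicalSpace N]
  [ChartedSpace H' N] [IsManifold I' ∞ N]

/-- The pull-back of a bilinear form by a linear map. -/
def pullForm (S : E →L[ℝ] E →L[ℝ] ℝ) (L : E' →L[ℝ] E) : E' →L[ℝ] E' →L[ℝ] ℝ :=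
  S.bilinearComp L L

/-- The pull-back of a 2-tensor by a map. -/
def pullBilin (j : N → M) (S : BilinField I M) : BilinField I' N := fun p ↦
  pullForm (E := E) (E' := E') (S (j p)) (mfderiv I' I j p)

/-- `D` is induced on `N` by the connection `D'` of `M` through the immersion `j : N → M`:
`j_* (D_u Y) = D'_{j_* u} Y'` for all vector fields `Y` on `N` and `Y'` on `M` with
`Y' = j_* Y` along `N`, locally. -/
def IsInduced (j : N → M) (D' : Connection I M) (D : Connection I' N) : Prop :=
  ∀ (p : N) (Y : VField I' N) (Y' : VField I M), SmoothField I' Y → SmoothField I Y' →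
    (∀ᶠ r in 𝓝 p, Y' (j r) = mfderiv I' I j r (Y r)) →
    ∀ u : TangentSpace I' p, mfderiv I' I j p (D Y p u) = D' Y' (j p) (mfderiv I' I j p u)

/-- The vector field `X` is a Killing field of the metric `g`. -/
def IsKilling (g : BilinField I M) (X : VField I M) : Prop := SmoothField I X ∧ LieDragged I X g

/-- The 1-form `α` is divergence free, `g^{AB} ∇_A α_B = 0`, for the Levi-Civita connection `∇`
of the Riemannian metric `g` on a manifold of dimension `k`. -/
def DivergenceFree (k : ℕ) (g : BilinField I M) (α : CovField I M) : Prop :=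
  ∃ D : Connection I M, IsLeviCivita g D ∧
    ∀ (e : Fin k → VField I M), (∀ i, SmoothField I (e i)) → ∀ x, OrthonormalAt g e x →
      ∑ i, (along I (e i) (fun y ↦ α y (e i y)) x - α x (nabla D (e i) (e i) x)) = 0

end Calculus

/-! ### Spacetimes -/

/-- A time oriented spacetime of dimension `m + 2` which satisfies the Einstein equations
`Ric - R g / 2 + Λ g = 8 π G T`. -/
structure Spacetime (m : ℕ) (M : Type*) [TopologicalSpace M]
    [ChartedSpace (EuclideanSpace ℝ (Fin (m + 2))) M] [IsManifold (𝓡 (m + 2)) ∞ M] where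
  /-- the metric, of signature `(-, +, …, +)` -/
  g : BilinField (𝓡 (m + 2)) M
  smooth_g : SmoothBilin (𝓡 (m + 2)) g
  lorentzian : ∀ x, ∃ b : Module.Basis (Fin (m + 2)) ℝ (TangentSpace (𝓡 (m + 2)) x), ∀ i j,
    g x (b i) (b j) = if i = j then (if i = 0 then -1 else 1) else 0
  /-- a timelike vector field giving the time orientation -/
  time : VField (𝓡 (m + 2)) M
  smooth_time : SmoothField (𝓡 (m + 2)) time
  timelike : ∀ x, g x (time x) (time x) < 0
  /-- the Levi-Civita connection of `g` -/
  conn : Connection (𝓡 (m + 2)) M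
  leviCivita : IsLeviCivita g conn
  /-- the Ricci tensor of `g` -/
  ric : BilinField (𝓡 (m + 2)) M
  isRicci : IsRicciTensor conn ric
  /-- the gravitational constant -/
  G : ℝ
  G_pos : 0 < G
  /-- the cosmological constant (possibly `0`) -/
  Λ : ℝ
  /-- the energy-momentum tensor -/
  T : BilinField (𝓡 (m + 2)) M
  smooth_T : SmoothBilin (𝓡 (m + 2)) T
  symm_T : ∀ x u w, T x u w = T x w u
  einstein : ∀ x u w,
    ric x u w - metricTrace g ric x / 2 * g x u w + Λ * g x u w = 8 * Real.pi * G * T x u w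

/-! ### The product `B × ℝ` -/

section Product

variable {m : ℕ} {B : Type*} [TopologicalSpace B] [ChartedSpace (EuclideanSpace ℝ (Fin m)) B]
  [IsManifold (𝓡 m) ∞ B]

variable (m) in
/-- The model with corners of `B × ℝ`, where `B` is an `m`-manifold. -/
abbrev model := (𝓡 m).prod 𝓘(ℝ, ℝ)

/-- The tangent vector of `B × ℝ` with components `w` along `B` and `c` along `ℝ`. -/
def tvec (p : B × ℝ) (w : TangentSpace (𝓡 m) p.1) (c : ℝ) : TangentSpace (model m) p :=
  ((w, c) : EuclideanSpace ℝ (Fin m) × ℝ)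

/-- The component along `B` of a tangent vector of `B × ℝ` (its push-forward to `B`). -/
def hor {p : B × ℝ} (u : TangentSpace (model m) p) : TangentSpace (𝓡 m) p.1 :=
  (show EuclideanSpace ℝ (Fin m) × ℝ from u).1

/-- The component along `ℝ` of a tangent vector of `B × ℝ`. -/
def ver {p : B × ℝ} (u : TangentSpace (model m) p) : ℝ :=
  (show EuclideanSpace ℝ (Fin m) × ℝ from u).2

variable (m B) in
/-- The vector field along the factor `ℝ`. -/
def vertical : VField (model m) (B × ℝ) := fun p ↦ tvec p 0 1

/-- A smooth section of the bundle of null vectors of the degenerate metric `q`. -/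
def IsNullField (q : BilinField (model m) (B × ℝ)) (ℓ : VField (model m) (B × ℝ)) : Prop :=
  SmoothField (model m) ℓ ∧ ∀ p, q p (ℓ p) (ℓ p) = 0

end Product

/-! ### Non-expanding horizons -/

/-- A non-expanding horizon in the spacetime `S`, with base space `B`, together with its induced
covariant derivative, subject to the conditions on matter.  The horizon is identified with
`B × ℝ` by its product structure (every open interval is diffeomorphic to `ℝ`). -/
structure NonExpandingHorizon {m : ℕ} {M : Type*} [TopologicalSpace M]
    [ChartedSpace (EuclideanSpace ℝ (Fin (m + 2))) M] [IsManifold (𝓡 (m + 2)) ∞ M]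
    (S : Spacetime m M) (B : Type*) [TopologicalSpace B]
    [ChartedSpace (EuclideanSpace ℝ (Fin m)) B] [IsManifold (𝓡 m) ∞ B] where
  /-- the embedding of the horizon in spacetime -/
  emb : B × ℝ → M
  isEmbedding : Manifold.IsSmoothEmbedding (model m) (𝓡 (m + 2)) ∞ emb
  /-- The hypersurface is null, and its null curves are the curves `{x} × ℝ`. -/
  null_generators : ∀ p (u : TangentSpace (model m) p),
    pullBilin (I' := model m) emb S.g p (vertical m B p) u = 0
  /-- The expansion `q^{AB} 𝓛_ℓ q_{AB}` of every null field vanishes. -/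
  non_expanding : ∀ ℓ, IsNullField (pullBilin (I' := model m) emb S.g) ℓ →
    ∀ e : Fin m → VField (model m) (B × ℝ), (∀ i, SmoothField (model m) (e i)) →
    ∀ p, OrthonormalAt (pullBilin (I' := model m) emb S.g) e p →
      ∑ i, lieBilin (model m) ℓ (pullBilin emb S.g) (e i) (e i) p = 0
  /-- For every future oriented null vector `ℓ` tangent to the horizon, the vector
  `w^μ = -T^μ_ν ℓ^ν` is causal and future oriented (or zero). -/
  energy_condition : ∀ p (u : TangentSpace (model m) p), u ≠ 0 →
    pullBilin emb S.g p u u = 0 →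
    S.g (emb p) (mfderiv (model m) (𝓡 (m + 2)) emb p u) (S.time (emb p)) < 0 →
    ∀ w : TangentSpace (𝓡 (m + 2)) (emb p),
      (∀ y, S.g (emb p) w y = -S.T (emb p) (mfderiv (model m) (𝓡 (m + 2)) emb p u) y) →
      S.g (emb p) w w ≤ 0 ∧ S.g (emb p) w (S.time (emb p)) ≤ 0
  /-- The pull-back of `T` to the horizon is Lie dragged by every null field. -/
  matter_dragged : ∀ ℓ, IsNullField (pullBilin (I' := model m) emb S.g) ℓ →
    LieDragged (model m) ℓ (pullBilin emb S.T)
  /-- the covariant derivative induced on the horizon -/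
  D : Connection (model m) (B × ℝ)
  smooth_D : SmoothConnection D
  induced_D : IsInduced emb S.conn D

/-- The degenerate metric induced on a non-expanding horizon. -/
def NonExpandingHorizon.q {m : ℕ} {M : Type*} [TopologicalSpace M]
    [ChartedSpace (EuclideanSpace ℝ (Fin (m + 2))) M] [IsManifold (𝓡 (m + 2)) ∞ M]
    {S : Spacetime m M} {B : Type*} [TopologicalSpace B]
    [ChartedSpace (EuclideanSpace ℝ (Fin m)) B] [IsManifold (𝓡 m) ∞ B]
    (h : NonExpandingHorizon S B) : BilinField (model m) (B × ℝ) := pullBilin h.emb S.g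

/-! ### Horizon geometries `(q, D)` and their invariants -/

section Geometry

variable {m : ℕ} {B : Type*} [TopologicalSpace B] [ChartedSpace (EuclideanSpace ℝ (Fin m)) B]
  [IsManifold (𝓡 m) ∞ B]

/-- `X` is an infinitesimal symmetry of `(q, D)`: a nontrivial vector field with `𝓛_X q = 0` and
`[𝓛_X, D] = 0`. -/
def IsInfinitesimalSymmetry (q : BilinField (model m) (B × ℝ)) (D : Connection (model m) (B × ℝ))
    (X : VField (model m) (B × ℝ)) : Prop :=
  SmoothField (model m) X ∧ X ≠ 0 ∧ LieDragged (model m) X q ∧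
    ∀ Y Z, SmoothField (model m) Y → SmoothField (model m) Z → ∀ p, lieConn X D Y Z p = 0

/-- The metric on the base `B` of which `q` is the pull-back by the projection; it is the metric
induced by `q` on any section, here on `B × {0}`. -/
def baseMetric (q : BilinField (model m) (B × ℝ)) : BilinField (𝓡 m) B :=
  pullBilin (fun x : B ↦ (x, (0 : ℝ))) q

/-- The factor `c` in `u = c ℓ(p)`, for a null vector `u` at a point `p` with `ℓ(p) ≠ 0`. -/
def nullFactor (ℓ : VField (model m) (B × ℝ)) (p : B × ℝ) (u : TangentSpace (model m) p) : ℝ :=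
  ver u / ver (ℓ p)

/-- The rotation 1-form potential `ω` of the null field `ℓ`, defined by `D_u ℓ = ω(u) ℓ` where
`ℓ ≠ 0`. -/
def rotation (D : Connection (model m) (B × ℝ)) (ℓ : VField (model m) (B × ℝ)) (p : B × ℝ)
    (u : TangentSpace (model m) p) : ℝ := nullFactor ℓ p (D ℓ p u)

/-- The tensor `N` of the null field `ℓ`, defined by `[𝓛_ℓ, D_a] Z^b = ℓ^b N_{ac} Z^c` where
`ℓ ≠ 0`; here `N(Y, Z)` at `p`. -/
def tensorN (D : Connection (model m) (B × ℝ)) (ℓ Y Z : VField (model m) (B × ℝ)) (p : B × ℝ) :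
    ℝ := nullFactor ℓ p (lieConn ℓ D Y Z p)

/-- `ℓ` is a natural vector field of `(q, D)`: a null field, nonzero on a dense (open) set, of
surface gravity `1`, with `q^{AB} N_{AB} = 0`. -/
structure IsNatural (q : BilinField (model m) (B × ℝ)) (D : Connection (model m) (B × ℝ))
    (ℓ : VField (model m) (B × ℝ)) : Prop where
  null : IsNullField q ℓ
  dense : Dense {p | ℓ p ≠ 0}
  surface_gravity : ∀ p, nabla D ℓ ℓ p = ℓ p
  trace_zero : ∀ p, ℓ p ≠ 0 → ∀ e : Fin m → VField (model m) (B × ℝ),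
    (∀ i, SmoothField (model m) (e i)) → OrthonormalAt q e p →
      ∑ i, tensorN D ℓ (e i) (e i) p = 0

/-- The lift of `w ∈ T_x B` to the graph of `σ : B → ℝ`, as a tangent vector at `p = (x, v)`. -/
def graphLift (σ : B → ℝ) (p : B × ℝ) (w : TangentSpace (𝓡 m) p.1) : TangentSpace (model m) p :=
  tvec p w (mvfderiv (𝓡 m) σ p.1 w)

/-- The graph of `σ` is a good cut for `ℓ`: a smooth section of `B × ℝ → B` on which `ℓ` has no
zeros and the pull-back of the rotation 1-form potential of `ℓ` is divergence free. -/
def IsGoodCut (q : BilinField (model m) (B × ℝ))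
    (D : Connection (model m) (B × ℝ)) (ℓ : VField (model m) (B × ℝ)) (σ : B → ℝ) : Prop :=
  ContMDiff (𝓡 m) 𝓘(ℝ, ℝ) ∞ σ ∧ (∀ x, ℓ (x, σ x) ≠ 0) ∧
  ∃ α : CovField (𝓡 m) B,
    (∀ x w, α x w = rotation D ℓ (x, σ x) (graphLift σ (x, σ x) w)) ∧
    DivergenceFree m (baseMetric q) α

/-- `n` is the covector field of the good cut foliation of `ℓ`: where `ℓ ≠ 0`, it is a smooth
1-form with `n(ℓ) = -1` which annihilates the vectors tangent to the good cut through the point.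
(Where `ℓ = 0` it is not defined, and its value is irrelevant.) -/
structure IsFoliationCovector (q : BilinField (model m) (B × ℝ))
    (D : Connection (model m) (B × ℝ)) (ℓ : VField (model m) (B × ℝ))
    (n : CovField (model m) (B × ℝ)) : Prop where
  smooth : ∀ Y, SmoothField (model m) Y →
    ContMDiffOn (model m) 𝓘(ℝ, ℝ) ∞ (fun p ↦ n p (Y p)) {p | ℓ p ≠ 0}
  normalized : ∀ p, ℓ p ≠ 0 → n p (ℓ p) = -1
  orthogonal : ∀ p, ℓ p ≠ 0 → ∃ σ, IsGoodCut q D ℓ σ ∧ σ p.1 = p.2 ∧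
    ∀ w, n p (graphLift σ p w) = 0

/-- The maximal analytic extension of the horizon geometry `(q, D)` on `B × ℝ`: a geometry on
`B × ℝ`, analytic along the null curves `{x} × ℝ` in the coordinate `v` of the factor `ℝ`, which is
an affine parameter of each of them, ranging over the whole line; with an open embedding that
respects the projections to `B` and the geometries. -/
structure MaximalAnalyticExtension (q : BilinField (model m) (B × ℝ))
    (D : Connection (model m) (B × ℝ)) where
  /-- the embedding of the horizon in the extension -/
  incl : B × ℝ → B × ℝ
  incl_localDiffeo : IsLocalDiffeomorph (model m) (model m) ∞ incl
  incl_injective : Function.Injective incl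
  incl_fst : ∀ p, (incl p).1 = p.1
  /-- the extended degenerate metric -/
  qExt : BilinField (model m) (B × ℝ)
  smooth_qExt : SmoothBilin (model m) qExt
  /-- the extended connection -/
  DExt : Connection (model m) (B × ℝ)
  smooth_DExt : SmoothConnection DExt
  restrict_q : ∀ p, pullBilin (I' := model m) incl qExt p = q p
  restrict_D : IsInduced incl DExt D
  affine : ∀ p, nabla DExt (vertical m B) (vertical m B) p = 0
  analytic_q : ∀ (x : B) (u w : EuclideanSpace ℝ (Fin m) × ℝ),
    AnalyticOnNhd ℝ (fun v : ℝ ↦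
      qExt (x, v) (tvec (x, v) u.1 u.2) (tvec (x, v) w.1 w.2)) Set.univ
  /-- The components of `D_u Z` are analytic along the null curves if those of `u` and `Z` are
  constant along them. -/
  analytic_D : ∀ Z : VField (model m) (B × ℝ), SmoothField (model m) Z →
    (∀ (x : B) (v v' : ℝ), hor (Z (x, v)) = hor (Z (x, v')) ∧ ver (Z (x, v)) = ver (Z (x, v'))) →
    ∀ (x : B) (u : EuclideanSpace ℝ (Fin m) × ℝ),
      AnalyticOnNhd ℝ (fun v : ℝ ↦
        (show EuclideanSpace ℝ (Fin m) × ℝ from DExt Z (x, v) (tvec (x, v) u.1 u.2))) Set.univ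

namespace MaximalAnalyticExtension

variable {q : BilinField (model m) (B × ℝ)}
  {D : Connection (model m) (B × ℝ)} (A : MaximalAnalyticExtension q D)

/-- `ℓ` is the invariant vector field of the extension: its unique natural vector field. -/
def IsInvariantVector (ℓ : VField (model m) (B × ℝ)) : Prop :=
  IsNatural A.qExt A.DExt ℓ ∧ ∀ ℓ', IsNatural A.qExt A.DExt ℓ' → ℓ' = ℓ

/-- The geometry defines an invariant vector field. -/
def InvariantGeneric : Prop := ∃ ℓ, A.IsInvariantVector ℓ

/-- The restriction to the horizon of a vector field of the extension. -/
def restrictVector (ℓ : VField (model m) (B × ℝ)) : VField (model m) (B × ℝ) :=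
  VectorField.mpullback (model m) (model m) A.incl ℓ

/-- The restriction to the horizon of a covector field of the extension. -/
def restrictCovector (n : CovField (model m) (B × ℝ)) : CovField (model m) (B × ℝ) := fun p ↦
  (n (A.incl p)).comp (mfderiv (model m) (model m) A.incl p)

/-- The vector field `X` of the horizon is tangent to the leaves of the restriction to the horizon
of the foliation by good cuts of `ℓ`. -/
def TangentToGoodCuts (ℓ X : VField (model m) (B × ℝ)) : Prop :=
  ∀ σ, IsGoodCut A.qExt A.DExt ℓ σ → ∀ p, σ (A.incl p).1 = (A.incl p).2 →
    ∃ w, mfderiv (model m) (model m) A.incl p (X p) = graphLift σ (A.incl p) w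

end MaximalAnalyticExtension

end Geometry

end Horizon

end

open scoped Manifold ContDiff Topology

noncomputable section

set_option linter.unusedSectionVars false

namespace Horizon

section Toolkit

variable {E : Type*} [NormedAddCommGroup E] [NormedSpace ℝ E] {H : Type*} [TopologicalSpace H]
  {I : ModelWithCorners ℝ E H} {M : Type*} [TopologicalSpace M] [ChartedSpace H M]
  [IsManifold I ∞ M]

/-- Smooth real functions. -/
abbrev SmoothFn (I : ModelWithCorners ℝ E H) (f : M → ℝ) : Prop := ContMDiff I 𝓘(ℝ, ℝ) ∞ f

theorem SmoothFn.mdiff {f : M → ℝ} (hf : SmoothFn I f) (x : M) :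
    MDifferentiableAt I 𝓘(ℝ, ℝ) f x := (hf x).mdifferentiableAt (by simp)

theorem SmoothField.mdiff {X : VField I M} (hX : SmoothField I X) (x : M) :
    MDifferentiableAt I I.tangent (fun x ↦ (⟨x, X x⟩ : TangentBundle I M)) x :=
  ContMDiffAt.mdifferentiableAt (hX x) (by simp)

theorem SmoothField.zero : SmoothField I (0 : VField I M) :=
  Bundle.contMDiff_zeroSection ℝ (TangentSpace I : M → Type _)

theorem SmoothField.add {X Y : VField I M} (hX : SmoothField I X) (hY : SmoothField I Y) :
    SmoothField I (X + Y) := ContMDiff.add_section hX hY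

theorem SmoothField.sub {X Y : VField I M} (hX : SmoothField I X) (hY : SmoothField I Y) :
    SmoothField I (X - Y) := ContMDiff.sub_section hX hY

theorem SmoothField.neg {X : VField I M} (hX : SmoothField I X) :
    SmoothField I (-X) := ContMDiff.neg_section hX

theorem SmoothField.smul {f : M → ℝ} {X : VField I M} (hf : SmoothFn I f)
    (hX : SmoothField I X) : SmoothField I (f • X) := ContMDiff.smul_section hf hX

theorem SmoothField.const_smul {X : VField I M} (c : ℝ) (hX : SmoothField I X) :
    SmoothField I (c • X) := ContMDiff.const_smul_section hX

theorem SmoothField.sum {ι : Type*} (s : Finset ι) {X : ι → VField I M}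
    (hX : ∀ i, SmoothField I (X i)) : SmoothField I (∑ i ∈ s, X i) := by
  classical
  induction s using Finset.induction_on with
  | empty => simpa using SmoothField.zero
  | insert a s ha ih => rw [Finset.sum_insert ha]; exact (hX a).add ih

theorem SmoothField.nabla {D : Connection I M} (hD : SmoothConnection D) {X Y : VField I M}
    (hX : SmoothField I X) (hY : SmoothField I Y) : SmoothField I (nabla D X Y) := by
  have h1 := contMDiffOn_univ.1 (hD.contMDiff.contMDiff (σ := Y) (by simpa using! hY.contMDiffOn))
  exact ContMDiff.clm_bundle_apply h1 hX

theorem smoothFn_along {X : VField I M} {f : M → ℝ} (hX : SmoothField I X) (hf : SmoothFn I f) :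
    SmoothFn I (along I X f) := by
  have h1 : ContMDiff I.tangent 𝓘(ℝ, ℝ).tangent ∞ (tangentMap I 𝓘(ℝ, ℝ) f) :=
    ContMDiff.contMDiff_tangentMap hf (by simp)
  have h2 := (contMDiff_snd_tangentBundle_modelSpace (n := ∞) ℝ 𝓘(ℝ, ℝ)).comp (h1.comp hX)
  exact h2

theorem SmoothBilin.smoothFn {S : BilinField I M} (hS : SmoothBilin I S) {X Y : VField I M}
    (hX : SmoothField I X) (hY : SmoothField I Y) : SmoothFn I (fun x ↦ S x (X x) (Y x)) := by
  intro x
  have h := ContMDiffAt.clm_bundle_apply₂ (F₁ := E) (F₂ := E) (F₃ := ℝ) (E₁ := (TangentSpace I : M → Type _))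
    (E₂ := (TangentSpace I : M → Type _)) (E₃ := fun _ : M ↦ ℝ)
    (b := fun x : M ↦ x) (v := X) (w := Y) (ψ := S) (n := ∞) (IB := I) (IM := I) (x := x) (hS x) (hX x) (hY x)
  exact (Bundle.contMDiffAt_section _).1 h

variable [FiniteDimensional ℝ E]

variable (I M) in
theorem isManifold_minSmoothness_three : IsManifold I (minSmoothness ℝ 3) M :=
  IsManifold.of_le (n := ∞) (by
    simp only [minSmoothness_of_isRCLikeNormedField]; exact WithTop.coe_le_coe.2 le_top)

variable (I M) in
theorem isManifold_minSmoothness_two : IsManifold I (minSmoothness ℝ 2) M :=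
  IsManifold.of_le (n := ∞) (by
    simp only [minSmoothness_of_isRCLikeNormedField]; exact WithTop.coe_le_coe.2 le_top)

theorem SmoothField.bracket {X Y : VField I M} (hX : SmoothField I X) (hY : SmoothField I Y) :
    SmoothField I (bracket I X Y) := by
  have : IsManifold I (((⊤ : ℕ∞) : ℕ∞ω) + 1) M := by simpa using! (inferInstance : IsManifold I ∞ M)
  have : IsManifold I (minSmoothness ℝ 2) M := isManifold_minSmoothness_two I M
  exact ContDiff.mlieBracket_vectorField (m := ⊤) (n := ⊤) hX hY (by simp)

theorem bracket_smul_right {X Y : VField I M} {f : M → ℝ} (hf : SmoothFn I f)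
    (hY : SmoothField I Y) :
    bracket I X (f • Y) = along I X f • Y + f • bracket I X Y := by
  funext x
  exact VectorField.mlieBracket_smul_right (hf.mdiff x) (hY.mdiff x)

theorem bracket_smul_left {X Y : VField I M} {f : M → ℝ} (hf : SmoothFn I f)
    (hX : SmoothField I X) :
    bracket I (f • X) Y = f • bracket I X Y - along I Y f • X := by
  funext x
  refine (VectorField.mlieBracket_smul_left (hf.mdiff x) (hX.mdiff x)).trans ?_
  simp only [Pi.sub_apply, Pi.smul_apply', along, neg_smul]
  abel

theorem bracket_add_right {X Y Z : VField I M} (hY : SmoothField I Y) (hZ : SmoothField I Z) :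
    bracket I X (Y + Z) = bracket I X Y + bracket I X Z := by
  funext x
  exact VectorField.mlieBracket_add_right (hY.mdiff x) (hZ.mdiff x)

theorem bracket_add_left {X Y Z : VField I M} (hX : SmoothField I X) (hY : SmoothField I Y) :
    bracket I (X + Y) Z = bracket I X Z + bracket I Y Z := by
  funext x
  exact VectorField.mlieBracket_add_left (hX.mdiff x) (hY.mdiff x)

theorem bracket_const_smul_right {X Y : VField I M} (c : ℝ) (hY : SmoothField I Y) :
    bracket I X (c • Y) = c • bracket I X Y := by
  funext x
  exact VectorField.mlieBracket_const_smul_right (hY.mdiff x)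

theorem bracket_const_smul_left {X Y : VField I M} (c : ℝ) (hX : SmoothField I X) :
    bracket I (c • X) Y = c • bracket I X Y := by
  funext x
  exact VectorField.mlieBracket_const_smul_left (hX.mdiff x)

theorem bracket_swap (X Y : VField I M) : bracket I X Y = -bracket I Y X :=
  VectorField.mlieBracket_swap

theorem bracket_jacobi {X Y Z : VField I M} (hX : SmoothField I X) (hY : SmoothField I Y)
    (hZ : SmoothField I Z) :
    bracket I X (bracket I Y Z) = bracket I (bracket I X Y) Z + bracket I Y (bracket I X Z) := by
  have h : ∀ {W : VField I M}, SmoothField I W → ContMDiff I I.tangent (minSmoothness ℝ 2)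
      (fun x ↦ (⟨x, W x⟩ : TangentBundle I M)) := fun hW ↦ ContMDiff.of_le hW (by
        simp only [minSmoothness_of_isRCLikeNormedField]; exact WithTop.coe_le_coe.2 le_top)
  have : IsManifold I (minSmoothness ℝ 3) M := isManifold_minSmoothness_three I M
  exact VectorField.leibniz_identity_mlieBracket (h hX) (h hY) (h hZ)

section Along

variable {X Y : VField I M} {f g : M → ℝ}

theorem along_add (hf : SmoothFn I f) (hg : SmoothFn I g) :
    along I X (f + g) = along I X f + along I X g := by
  funext x; simp [along, mvfderiv_add (hf.mdiff x) (hg.mdiff x)]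

theorem along_sub (hf : SmoothFn I f) (hg : SmoothFn I g) :
    along I X (f - g) = along I X f - along I X g := by
  funext x; simp [along, mvfderiv_sub (hf.mdiff x) (hg.mdiff x)]

theorem along_neg : along I X (-f) = -along I X f := by
  funext x; simp [along, mvfderiv_neg]

theorem along_mul (hf : SmoothFn I f) (hg : SmoothFn I g) :
    along I X (f * g) = f * along I X g + g * along I X f := by
  funext x; simp [along, mvfderiv_mul (hf.mdiff x) (hg.mdiff x)]

theorem along_const (c : ℝ) : along I X (fun _ ↦ c) = 0 := by
  funext x; simp [along, mvfderiv_const]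

theorem along_add_left : along I (X + Y) f = along I X f + along I Y f := by
  funext x; simp [along]

theorem along_smul_left : along I (g • X) f = g * along I X f := by
  funext x; simp [along]

theorem along_congr {x : M} (h : f =ᶠ[𝓝 x] g) : along I X f x = along I X g x := by
  simp only [along, mvfderiv, h.mfderiv_eq]; rw [h.eq_of_nhds]

end Along

section Localization

variable [T2Space M]

theorem exists_bump {p : M} {u : Set M} (hu : u ∈ 𝓝 p) :
    ∃ χ : M → ℝ, SmoothFn I χ ∧ χ =ᶠ[𝓝 p] 1 ∧ tsupport χ ⊆ u := by
  obtain ⟨f, hf, -⟩ := (SmoothBumpFunction.nhds_basis_support (I := I) hu).mem_iff.1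
    (Filter.univ_mem)
  exact ⟨f, f.contMDiff, f.eventuallyEq_one, hf⟩

theorem exists_smoothField_eventuallyEq {p : M} {u : Set M} (hu : IsOpen u) (hp : p ∈ u)
    {V : VField I M} (hV : ContMDiffOn I I.tangent ∞ (fun x ↦ (⟨x, V x⟩ : TangentBundle I M)) u) :
    ∃ V' : VField I M, SmoothField I V' ∧ ∀ᶠ x in 𝓝 p, V' x = V x := by
  obtain ⟨χ, h1, h2, h3⟩ := exists_bump (I := I) (hu.mem_nhds hp)
  refine ⟨χ • V, ContMDiffOn.smul_section_of_tsupport h1.contMDiffOn hu h3 hV, ?_⟩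
  filter_upwards [h2] with x hx
  simp [hx]

theorem exists_smoothFn_eventuallyEq {p : M} {u : Set M} (hu : IsOpen u) (hp : p ∈ u)
    {f : M → ℝ} (hf : ContMDiffOn I 𝓘(ℝ, ℝ) ∞ f u) :
    ∃ f' : M → ℝ, SmoothFn I f' ∧ f' =ᶠ[𝓝 p] f := by
  obtain ⟨χ, h1, h2, h3⟩ := exists_bump (I := I) (hu.mem_nhds hp)
  refine ⟨fun x ↦ χ x * f x, contMDiff_of_tsupport fun x hx ↦ ?_, ?_⟩
  · have hx' : x ∈ u := h3 (tsupport_mul_subset_left hx)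
    exact (h1 x).mul (hf.contMDiffAt (hu.mem_nhds hx'))
  · filter_upwards [h2] with x hx
    simp [hx]

theorem exists_smoothField_apply (p : M) (w : TangentSpace I p) :
    ∃ V : VField I M, SmoothField I V ∧ V p = w := by
  obtain ⟨s, hs, hs'⟩ := FiberBundle.exists_contMDiffOn_extend (k := ∞) I E
    (V := (TangentSpace I : M → Type _)) w
  obtain ⟨u, hu, hu', hp⟩ := mem_nhds_iff.1 hs
  obtain ⟨V, hV, h⟩ := exists_smoothField_eventuallyEq hu' hp (hs'.mono hu)
  exact ⟨V, hV, by rw [h.self_of_nhds]; simp⟩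

/-- A smooth field which vanishes at `p` is, near `p`, a combination of smooth fields with smooth
coefficients which vanish at `p`. -/
theorem SmoothField.exists_decomposition {Y : VField I M} (hY : SmoothField I Y) {p : M}
    (h0 : Y p = 0) :
    ∃ (n : ℕ) (f : Fin n → M → ℝ) (V : Fin n → VField I M) (χ : M → ℝ),
      (∀ i, SmoothFn I (f i)) ∧ (∀ i, f i p = 0) ∧ (∀ i, SmoothField I (V i)) ∧ SmoothFn I χ ∧
      χ p = 1 ∧ χ • Y = ∑ i, f i • V i := by
  let e := trivializationAt E (TangentSpace I : M → Type _) p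
  let b := Module.finBasis ℝ E
  have hp : p ∈ e.baseSet := FiberBundle.mem_baseSet_trivializationAt' p
  obtain ⟨χ, h1, h2, h3⟩ := exists_bump (I := I) (e.open_baseSet.mem_nhds hp)
  refine ⟨_, fun i x ↦ χ x * e.localFrameCoeff I b i x (Y x), fun i ↦ χ • e.localFrame b i, χ * χ,
    fun i ↦ ?_, fun i ↦ ?_, fun i ↦ ?_, h1.mul h1, ?_, ?_⟩
  · refine contMDiff_of_tsupport fun x hx ↦ ?_
    have hx' : x ∈ e.baseSet := h3 (tsupport_mul_subset_left hx)
    exact (h1 x).mul (contMDiffAt_localFrameCoeff b hx' (hY x) i)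
  · simp [h0]
  · exact ContMDiffOn.smul_section_of_tsupport h1.contMDiffOn e.open_baseSet h3
      (e.contMDiffOn_localFrame_baseSet ∞ b i)
  · simp [h2.eq_of_nhds]
  · funext x
    by_cases hx : x ∈ e.baseSet
    · have := e.eq_sum_localFrameCoeff_smul (I := I) (b := b) (s := Y) hx
      simp only [Pi.smul_apply', Pi.mul_apply, Finset.sum_apply]
      conv_lhs => rw [this]
      rw [Finset.smul_sum]
      refine Finset.sum_congr rfl fun i _ ↦ ?_
      simp only [smul_smul]
      congr 1; ring
    · have : χ x = 0 := image_eq_zero_of_notMem_tsupport fun h ↦ hx (h3 h)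
      simp [this]

theorem eq_zero_of_tensorial {A : Type*} [AddCommGroup A] [Module ℝ A] {Φ : VField I M → A} {p : M}
    (hs : ∀ f Y, SmoothFn I f → SmoothField I Y → Φ (f • Y) = f p • Φ Y)
    (ha : ∀ Y Z, SmoothField I Y → SmoothField I Z → Φ (Y + Z) = Φ Y + Φ Z)
    {Y : VField I M} (hY : SmoothField I Y) (h0 : Y p = 0) : Φ Y = 0 := by
  obtain ⟨n, f, V, χ, hf, hf0, hV, hχ, hχ1, h⟩ := hY.exists_decomposition h0
  have hsum : ∀ s : Finset (Fin n), Φ (∑ i ∈ s, f i • V i) = 0 := by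
    classical
    intro s
    induction s using Finset.induction_on with
    | empty =>
      have := hs 0 0 contMDiff_const SmoothField.zero
      simpa using this
    | insert a s has ih =>
      rw [Finset.sum_insert has, ha _ _ ((hV a).smul (hf a))
        (SmoothField.sum s fun i ↦ (hV i).smul (hf i)), ih, hs _ _ (hf a) (hV a), hf0]
      simp
  have := hs χ Y hχ hY
  rw [h, hsum, hχ1, one_smul] at this
  exact this.symm

theorem congr_of_tensorial {A : Type*} [AddCommGroup A] [Module ℝ A] {Φ : VField I M → A} {p : M}
    (hs : ∀ f Y, SmoothFn I f → SmoothField I Y → Φ (f • Y) = f p • Φ Y)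
    (ha : ∀ Y Z, SmoothField I Y → SmoothField I Z → Φ (Y + Z) = Φ Y + Φ Z)
    {Y Z : VField I M} (hY : SmoothField I Y) (hZ : SmoothField I Z) (h : Y p = Z p) :
    Φ Y = Φ Z := by
  have h1 := eq_zero_of_tensorial hs ha (hY.sub hZ) (by simp [h])
  have h2 := ha _ _ (hY.sub hZ) hZ
  rwa [h1, sub_add_cancel, zero_add] at h2

/-- Smooth functions separate tangent vectors. -/
theorem tangent_eq_zero {p : M} {u : TangentSpace I p}
    (h : ∀ f : M → ℝ, SmoothFn I f → mvfderiv I f p u = 0) : u = 0 := by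
  have hinv := isInvertible_mfderiv_extChartAt (I := I) (mem_extChartAt_source (I := I) p)
  have hmd : MDifferentiableAt I 𝓘(ℝ, E) (extChartAt I p) p := mdifferentiableAt_extChartAt (mem_chart_source H p)
  refine hinv.injective ?_
  rw [map_zero]
  refine SeparatingDual.eq_zero_of_forall_dual_eq_zero (R := ℝ) (V := E) fun φ ↦ ?_
  obtain ⟨f, hf, hf'⟩ := exists_smoothFn_eventuallyEq (I := I) (p := p) (chartAt H p).open_source
    (mem_chart_source H p) (f := fun x ↦ φ (extChartAt I p x))
    (φ.contMDiff.comp_contMDiffOn contMDiffOn_extChartAt)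
  have h1 := h f hf
  rw [mvfderiv, hf'.mfderiv_eq] at h1
  have h2 : mfderiv I 𝓘(ℝ, ℝ) (fun x ↦ φ (extChartAt I p x)) p u
      = φ (mfderiv I 𝓘(ℝ, E) (extChartAt I p) p u) := by
    have := mfderiv_comp_apply p (φ.contMDiff (n := 1) |>.mdifferentiableAt (x := extChartAt I p p) one_ne_zero) hmd u
    refine this.trans ?_
    rw [mfderiv_eq_fderiv, φ.fderiv]; rfl
  exact h2.symm.trans h1

theorem tangent_ext {p : M} {u w : TangentSpace I p}
    (h : ∀ f : M → ℝ, SmoothFn I f → mvfderiv I f p u = mvfderiv I f p w) : u = w :=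
  sub_eq_zero.1 (tangent_eq_zero fun f hf ↦ by rw [map_sub, h f hf, sub_self])

theorem along_bracket {X Y : VField I M} {f : M → ℝ} (hX : SmoothField I X) (hY : SmoothField I Y)
    (hf : SmoothFn I f) :
    along I (bracket I X Y) f = along I X (along I Y f) - along I Y (along I X f) := by
  funext p
  by_cases hE : ∃ w : TangentSpace I p, w ≠ 0
  · obtain ⟨w, hw⟩ := hE
    obtain ⟨Z, hZ, rfl⟩ := exists_smoothField_apply p w
    have h := congrFun (bracket_jacobi hX hY (hZ.smul hf)) p
    rw [bracket_smul_right hf hZ, bracket_smul_right hf hZ, bracket_smul_right hf hZ,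
      bracket_add_right (hZ.smul (smoothFn_along hY hf)) ((hY.bracket hZ).smul hf),
      bracket_add_right (hZ.smul (smoothFn_along hX hf)) ((hX.bracket hZ).smul hf),
      bracket_smul_right (smoothFn_along hY hf) hZ, bracket_smul_right (smoothFn_along hX hf) hZ,
      bracket_smul_right hf (hY.bracket hZ), bracket_smul_right hf (hX.bracket hZ),
      bracket_jacobi hX hY hZ] at h
    simp only [Pi.add_apply, Pi.smul_apply', smul_add] at h
    have h' : (along I (bracket I X Y) f p - (along I X (along I Y f) p - along I Y (along I X f) p)) • Z p
        = 0 := by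
      rw [sub_smul, sub_smul]
      have h2 := sub_eq_zero.2 h
      rw [← neg_eq_zero, ← h2]
      module
    exact sub_eq_zero.1 ((smul_eq_zero.1 h').resolve_right hw)
  · push Not at hE
    have : ∀ (V : VField I M) (g : M → ℝ), along I V g p = 0 := fun V g ↦ by
      rw [along, hE (V p), map_zero]
    simp [this]

end Localization

end Toolkit

section Connections

variable {E : Type*} [NormedAddCommGroup E] [NormedSpace ℝ E] {H : Type*} [TopologicalSpace H]
  {I : ModelWithCorners ℝ E H} {M : Type*} [TopologicalSpace M] [ChartedSpace H M]
  [IsManifold I ∞ M]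

section Nabla

variable {D : Connection I M} {X Y Z : VField I M} {f : M → ℝ}

theorem nabla_add_left : nabla D (X + Y) Z = nabla D X Z + nabla D Y Z := by
  funext x; simp [nabla]

theorem nabla_sub_left : nabla D (X - Y) Z = nabla D X Z - nabla D Y Z := by
  funext x; simp [nabla]

theorem nabla_neg_left : nabla D (-X) Z = -nabla D X Z := by
  funext x; simp [nabla]

theorem nabla_smul_left : nabla D (f • X) Z = f • nabla D X Z := by
  funext x; simp [nabla]

theorem nabla_add_right (hY : SmoothField I Y) (hZ : SmoothField I Z) :
    nabla D X (Y + Z) = nabla D X Y + nabla D X Z := by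
  funext x
  simp [nabla, D.isCovariantDerivativeOnUniv.add (hY.mdiff x) (hZ.mdiff x)]

theorem nabla_smul_right (hf : SmoothFn I f) (hY : SmoothField I Y) :
    nabla D X (f • Y) = along I X f • Y + f • nabla D X Y := by
  funext x
  simp [nabla, D.isCovariantDerivativeOnUniv.leibniz (hY.mdiff x) (hf.mdiff x), along]
  abel

theorem nabla_const_smul_right (c : ℝ) (hY : SmoothField I Y) :
    nabla D X (c • Y) = c • nabla D X Y := by
  funext x
  simp [nabla, D.isCovariantDerivativeOnUniv.smul_const c (hY.mdiff x)]

theorem nabla_neg_right (hY : SmoothField I Y) : nabla D X (-Y) = -nabla D X Y := by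
  have := nabla_const_smul_right (D := D) (X := X) (-1) hY
  simpa using this

theorem nabla_sub_right (hY : SmoothField I Y) (hZ : SmoothField I Z) :
    nabla D X (Y - Z) = nabla D X Y - nabla D X Z := by
  rw [sub_eq_add_neg, nabla_add_right hY hZ.neg, nabla_neg_right hZ, sub_eq_add_neg]

end Nabla

variable [FiniteDimensional ℝ E]

theorem bracket_neg_right (X : VField I M) {Y : VField I M} (hY : SmoothField I Y) :
    bracket I X (-Y) = -bracket I X Y := by
  have := bracket_const_smul_right (X := X) (-1) hY
  simpa using this

theorem bracket_sub_right (X : VField I M) {Y Z : VField I M} (hY : SmoothField I Y)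
    (hZ : SmoothField I Z) : bracket I X (Y - Z) = bracket I X Y - bracket I X Z := by
  rw [sub_eq_add_neg, bracket_add_right hY hZ.neg, bracket_neg_right X hZ, sub_eq_add_neg]

section LieConn

variable {D : Connection I M} {X V Y Z W : VField I M} {f : M → ℝ}

theorem lieConn_eq : lieConn X D Y Z =
    bracket I X (nabla D Y Z) - nabla D (bracket I X Y) Z - nabla D Y (bracket I X Z) := rfl

theorem SmoothField.lieConn (hD : SmoothConnection D) (hX : SmoothField I X) (hY : SmoothField I Y)
    (hZ : SmoothField I Z) : SmoothField I (lieConn X D Y Z) := by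
  rw [lieConn_eq]
  exact ((hX.bracket (hY.nabla hD hZ)).sub ((hX.bracket hY).nabla hD hZ)).sub
    (hY.nabla hD (hX.bracket hZ))

theorem lieConn_add_left (hD : SmoothConnection D) (hY : SmoothField I Y) (hZ : SmoothField I Z)
    (hW : SmoothField I W) : lieConn X D (Y + Z) W = lieConn X D Y W + lieConn X D Z W := by
  simp only [lieConn_eq, nabla_add_left, bracket_add_right hY hZ,
    bracket_add_right (hY.nabla hD hW) (hZ.nabla hD hW)]
  abel

theorem lieConn_add_right (hD : SmoothConnection D) (hX : SmoothField I X) (hY : SmoothField I Y)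
    (hZ : SmoothField I Z) (hW : SmoothField I W) :
    lieConn X D W (Y + Z) = lieConn X D W Y + lieConn X D W Z := by
  simp only [lieConn_eq, nabla_add_right hY hZ, bracket_add_right hY hZ,
    bracket_add_right (hW.nabla hD hY) (hW.nabla hD hZ),
    nabla_add_right (hX.bracket hY) (hX.bracket hZ)]
  abel

theorem lieConn_smul_left (hD : SmoothConnection D) (hf : SmoothFn I f) (hY : SmoothField I Y)
    (hZ : SmoothField I Z) : lieConn X D (f • Y) Z = f • lieConn X D Y Z := by
  simp only [lieConn_eq, nabla_smul_left, bracket_smul_right hf hY,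
    bracket_smul_right hf (hY.nabla hD hZ), nabla_add_left]
  funext x
  simp only [Pi.add_apply, Pi.sub_apply, Pi.smul_apply']
  module

theorem lieConn_add_field (hX : SmoothField I X) (hV : SmoothField I V)
    (hZ : SmoothField I Z) :
    lieConn (X + V) D Y Z = lieConn X D Y Z + lieConn V D Y Z := by
  simp only [lieConn_eq, bracket_add_left hX hV, nabla_add_left,
    nabla_add_right (hX.bracket hZ) (hV.bracket hZ)]
  abel

variable [T2Space M]

theorem lieConn_smul_right (hD : SmoothConnection D) (hf : SmoothFn I f) (hX : SmoothField I X)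
    (hY : SmoothField I Y) (hZ : SmoothField I Z) :
    lieConn X D Y (f • Z) = f • lieConn X D Y Z := by
  have hXf := smoothFn_along hX hf
  have hYf := smoothFn_along hY hf
  have hXZ := hX.bracket hZ
  have hYZ := hY.nabla hD hZ
  simp only [lieConn_eq, nabla_smul_right hf hZ, bracket_smul_right hf hZ,
    bracket_add_right (hZ.smul hYf) (hYZ.smul hf), nabla_add_right (hZ.smul hXf) (hXZ.smul hf),
    nabla_smul_right hXf hZ, nabla_smul_right hf hXZ, bracket_smul_right hYf hZ,
    bracket_smul_right hf hYZ, along_bracket hX hY hf]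
  funext x
  simp only [Pi.add_apply, Pi.sub_apply, Pi.smul_apply']
  module

theorem lieConn_bracket {p : M} (hD : SmoothConnection D) (hX : SmoothField I X)
    (hV : SmoothField I V)
    (hsymm : ∀ Y Z, SmoothField I Y → SmoothField I Z → ∀ᶠ y in 𝓝 p, lieConn X D Y Z y = 0)
    (hY : SmoothField I Y) (hZ : SmoothField I Z) :
    lieConn (bracket I X V) D Y Z p = bracket I X (lieConn V D Y Z) p
      - lieConn V D (bracket I X Y) Z p - lieConn V D Y (bracket I X Z) p := by
  have key : ∀ {Y Z : VField I M}, SmoothField I Y → SmoothField I Z →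
      bracket I X (nabla D Y Z) =ᶠ[𝓝 p] nabla D (bracket I X Y) Z + nabla D Y (bracket I X Z) := by
    intro Y Z hY hZ
    filter_upwards [hsymm Y Z hY hZ] with y hy
    rw [lieConn, sub_sub] at hy
    exact sub_eq_zero.1 hy
  have hVY := hV.bracket hY
  have hVZ := hV.bracket hZ
  have hXY := hX.bracket hY
  have hXZ := hX.bracket hZ
  have j1 : bracket I (bracket I X V) Y = bracket I X (bracket I V Y) - bracket I V (bracket I X Y) :=
    eq_sub_of_add_eq (bracket_jacobi hX hV hY).symm
  have j2 : bracket I (bracket I X V) Z = bracket I X (bracket I V Z) - bracket I V (bracket I X Z) :=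
    eq_sub_of_add_eq (bracket_jacobi hX hV hZ).symm
  have j3 : bracket I (bracket I X V) (nabla D Y Z) = bracket I X (bracket I V (nabla D Y Z))
      - bracket I V (bracket I X (nabla D Y Z)) :=
    eq_sub_of_add_eq (bracket_jacobi hX hV (hY.nabla hD hZ)).symm
  have k1 : bracket I V (bracket I X (nabla D Y Z)) p = bracket I V (nabla D (bracket I X Y) Z) p
      + bracket I V (nabla D Y (bracket I X Z)) p := by
    rw [← Pi.add_apply, ← bracket_add_right (hXY.nabla hD hZ) (hY.nabla hD hXZ)]
    exact Filter.EventuallyEq.mlieBracket_vectorField_eq (Filter.EventuallyEq.refl _ _) (key hY hZ)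
  have k2 := (key hVY hZ).eq_of_nhds
  have k3 := (key hY hVZ).eq_of_nhds
  simp only [lieConn_eq, j1, j2, j3, nabla_sub_left,
    nabla_sub_right (hX.bracket hVZ) (hV.bracket hXZ)]
  rw [bracket_sub_right X ((hV.bracket (hY.nabla hD hZ)).sub (hVY.nabla hD hZ)) (hY.nabla hD hVZ),
    bracket_sub_right X (hV.bracket (hY.nabla hD hZ)) (hVY.nabla hD hZ)]
  simp only [Pi.sub_apply, Pi.add_apply] at k1 k2 k3 ⊢
  rw [k1, k2, k3]
  abel

end LieConn

section Metric

/-- The 2-tensor field `q` takes smooth fields to smooth functions. -/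
def SmoothOnFields (q : BilinField I M) : Prop :=
  ∀ Y Z : VField I M, SmoothField I Y → SmoothField I Z → SmoothFn I (fun x ↦ q x (Y x) (Z x))

theorem SmoothOnFields.smoothFn {q : BilinField I M} (hq : SmoothOnFields q) {Y Z : VField I M}
    (hY : SmoothField I Y) (hZ : SmoothField I Z) : SmoothFn I (fun x ↦ q x (Y x) (Z x)) :=
  hq Y Z hY hZ

theorem SmoothBilin.smoothOnFields {q : BilinField I M} (hq : SmoothBilin I q) :
    SmoothOnFields q := fun _ _ hY hZ ↦ hq.smoothFn hY hZ

variable {q : BilinField I M} {D : Connection I M} {X Y Z W : VField I M}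

theorem IsLeviCivita.torsion (h : IsLeviCivita q D) (hY : SmoothField I Y) (hZ : SmoothField I Z) :
    nabla D Y Z - nabla D Z Y = bracket I Y Z := funext fun x ↦ h.2.1 Y Z hY hZ x

theorem IsLeviCivita.metric (h : IsLeviCivita q D) (hX : SmoothField I X) (hY : SmoothField I Y)
    (hZ : SmoothField I Z) (x : M) : along I X (fun y ↦ q y (Y y) (Z y)) x =
      q x (nabla D X Y x) (Z x) + q x (Y x) (nabla D X Z x) := h.2.2 X Y Z hX hY hZ x

/-- A trilinear form which is symmetric in the first two and skew in the last two arguments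
vanishes. -/
theorem eq_zero_of_symm_of_skew {A : Type*} {S : A → Prop} {t : A → A → A → ℝ}
    (h1 : ∀ a b c, S a → S b → S c → t a b c = t b a c)
    (h2 : ∀ a b c, S a → S b → S c → t a b c = -t a c b) {a b c : A} (ha : S a) (hb : S b)
    (hc : S c) : t a b c = 0 := by
  have e1 := h1 a b c ha hb hc
  have e2 := h2 b a c hb ha hc
  have e3 := h1 b c a hb hc ha
  have e4 := h2 c b a hc hb ha
  have e5 := h1 c a b hc ha hb
  have e6 := h2 a c b ha hc hb
  linarith

variable [T2Space M]

theorem IsLeviCivita.lieConn_symm (h : IsLeviCivita q D) (hX : SmoothField I X)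
    (hY : SmoothField I Y) (hZ : SmoothField I Z) : lieConn X D Y Z = lieConn X D Z Y := by
  have j := bracket_jacobi hX hY hZ
  rw [← h.torsion hY hZ, ← h.torsion (hX.bracket hY) hZ, ← h.torsion hY (hX.bracket hZ),
    bracket_sub_right X (hY.nabla h.1 hZ) (hZ.nabla h.1 hY)] at j
  simp only [lieConn_eq]
  rw [← sub_eq_zero] at j ⊢
  rw [← j]
  abel

/-- A field which drags a (possibly degenerate) metric drags its torsion free connections, up to
degenerate directions. -/
theorem IsLeviCivita.lieConn_orthogonal (h : IsLeviCivita q D) (hq : SmoothOnFields q)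
    (hsymm : ∀ x u w, q x u w = q x w u) (hX : SmoothField I X) (hXq : LieDragged I X q)
    (hY : SmoothField I Y) (hZ : SmoothField I Z) (hW : SmoothField I W) (x : M) :
    q x (lieConn X D Y Z x) (W x) = 0 := by
  have hD := h.1
  refine eq_zero_of_symm_of_skew (S := SmoothField I)
    (t := fun Y Z W ↦ q x (lieConn X D Y Z x) (W x)) (fun Y Z W hY hZ hW ↦ ?_)
    (fun Y Z W hY hZ hW ↦ ?_) hY hZ hW
  · simp only [h.lieConn_symm hX hY hZ]
  · have lie : ∀ {U V : VField I M}, SmoothField I U → SmoothField I V →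
        q x (bracket I X U x) (V x) =
          along I X (fun y ↦ q y (U y) (V y)) x - q x (U x) (bracket I X V x) := by
      intro U V hU hV
      have := hXq U V hU hV x
      simp only [lieBilin] at this
      linarith
    have hs : SmoothFn I (fun y ↦ q y (Z y) (W y)) := hq.smoothFn hZ hW
    have m1 := h.metric hY hZ (hX.bracket hW) x
    have m2 := h.metric hY (hX.bracket hZ) hW x
    have m3 := h.metric (hX.bracket hY) hZ hW x
    have l1 := lie (hY.nabla hD hZ) hW
    have l2 := lie (hY.nabla hD hW) hZ
    have b := congrFun (along_bracket hX hY hs) x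
    have a1 : along I Y (fun y ↦ q y (Z y) (W y)) =
        (fun y ↦ q y (nabla D Y Z y) (W y)) + fun y ↦ q y (nabla D Y W y) (Z y) := by
      funext y
      rw [h.metric hY hZ hW y, hsymm y (Z y)]; rfl
    have a2 : along I X (fun y ↦ q y (Z y) (W y)) =
        (fun y ↦ q y (bracket I X Z y) (W y)) + fun y ↦ q y (Z y) (bracket I X W y) := by
      funext y
      have := hXq Z W hZ hW y
      simp only [lieBilin] at this
      simp only [Pi.add_apply]
      linarith
    simp only [Pi.sub_apply] at b
    rw [a1, a2, along_add (hq.smoothFn (hY.nabla hD hZ) hW) (hq.smoothFn (hY.nabla hD hW) hZ),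
      along_add (hq.smoothFn (hX.bracket hZ) hW) (hq.smoothFn hZ (hX.bracket hW))] at b
    simp only [Pi.add_apply] at b
    have s1 := hsymm x (Z x) (nabla D Y (bracket I X W) x)
    have s2 := hsymm x (Z x) (nabla D (bracket I X Y) W x)
    have s3 := hsymm x (bracket I X Z x) (nabla D Y W x)
    simp only [lieConn, map_sub, sub_apply]
    linarith

theorem IsLeviCivita.unique {D' : Connection I M} (h : IsLeviCivita q D) (h' : IsLeviCivita q D')
    (hsymm : ∀ x u w, q x u w = q x w u) (hY : SmoothField I Y) (hZ : SmoothField I Z)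
    (hW : SmoothField I W) (x : M) : q x (nabla D Y Z x - nabla D' Y Z x) (W x) = 0 := by
  refine eq_zero_of_symm_of_skew (S := SmoothField I)
    (t := fun Y Z W ↦ q x (nabla D Y Z x - nabla D' Y Z x) (W x)) (fun Y Z W hY hZ hW ↦ ?_)
    (fun Y Z W hY hZ hW ↦ ?_) hY hZ hW
  · have t1 := h.2.1 Y Z hY hZ x
    have t2 := h'.2.1 Y Z hY hZ x
    have : nabla D Y Z x - nabla D' Y Z x = nabla D Z Y x - nabla D' Z Y x := by
      rw [← sub_eq_zero] at t1 t2 ⊢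
      rw [← sub_self (0 : TangentSpace I x)]
      nth_rw 1 [← t1]
      rw [← t2]
      abel
    simp only [this]
  · have m1 := h.metric hY hZ hW x
    have m2 := h'.metric hY hZ hW x
    have s1 := hsymm x (Z x) (nabla D Y W x)
    have s2 := hsymm x (Z x) (nabla D' Y W x)
    simp only [map_sub, sub_apply]
    linarith

theorem IsLeviCivita.curvature_skew (h : IsLeviCivita q D) (hq : SmoothOnFields q)
    (hsymm : ∀ x u w, q x u w = q x w u) (hX : SmoothField I X) (hY : SmoothField I Y)
    (hZ : SmoothField I Z) (x : M) : q x (curvature D X Y Z x) (Z x) = 0 := by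
  have hD := h.1
  have key : ∀ {U V : VField I M}, SmoothField I U → SmoothField I V →
      along I U (along I V (fun y ↦ q y (Z y) (Z y))) x =
      2 * (q x (nabla D U (nabla D V Z) x) (Z x) + q x (nabla D V Z x) (nabla D U Z x)) := by
    intro U V hU hV
    have a1 : along I V (fun y ↦ q y (Z y) (Z y)) =
        (fun y ↦ q y (nabla D V Z y) (Z y)) + fun y ↦ q y (nabla D V Z y) (Z y) := by
      funext y
      rw [h.metric hV hZ hZ y, hsymm y (Z y)]; rfl
    have hs := hq.smoothFn (hV.nabla hD hZ) hZ
    rw [a1, along_add hs hs, Pi.add_apply, h.metric hU (hV.nabla hD hZ) hZ x]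
    ring
  have b := congrFun (along_bracket hX hY (hq.smoothFn hZ hZ)) x
  rw [Pi.sub_apply, key hX hY, key hY hX, h.metric (hX.bracket hY) hZ hZ x] at b
  have s1 := hsymm x (Z x) (nabla D (bracket I X Y) Z x)
  have s2 := hsymm x (nabla D X Z x) (nabla D Y Z x)
  simp only [curvature, map_sub, sub_apply]
  linarith

end Metric

end Connections

section Immersions

variable {E : Type*} [NormedAddCommGroup E] [NormedSpace ℝ E] [FiniteDimensional ℝ E]
  {H : Type*} [TopologicalSpace H]
  {I : ModelWithCorners ℝ E H} {M : Type*} [TopologicalSpace M] [ChartedSpace H M]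
  [IsManifold I ∞ M] [T2Space M]
  {E' : Type*} [NormedAddCommGroup E'] [NormedSpace ℝ E'] [FiniteDimensional ℝ E'] {H' : Type*}
  [TopologicalSpace H'] {I' : ModelWithCorners ℝ E' H'} {N : Type*} [TopologicalSpace N]
  [ChartedSpace H' N] [IsManifold I' ∞ N] [T2Space N]
  {j : N → M}

/-- The fields `Y` and `Y'` are related by `j` near `p`. -/
def RelatedNear (j : N → M) (p : N) (Y : VField I' N) (Y' : VField I M) : Prop :=
  ∀ᶠ r in 𝓝 p, Y' (j r) = mfderiv I' I j r (Y r)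

theorem exists_local_retraction [I'.Boundaryless] (hj : Manifold.IsImmersion I' I ∞ j) (p : N) :
    ∃ (ρ : M → N) (u : Set M), IsOpen u ∧ j p ∈ u ∧ ContMDiffOn I I' ∞ ρ u ∧
      ∀ᶠ r in 𝓝 p, ρ (j r) = r := by
  obtain ⟨F, _, _, φ, ψ, hp, hjp, hφ, hψ, -, L, hL⟩ := hj.isImmersionAt p
  let g : M → E' := fun y ↦ (L.symm (ψ.extend I y)).1
  have hg : ContMDiffOn I 𝓘(ℝ, E') ∞ g ψ.source := by
    have h2 : ContMDiff 𝓘(ℝ, E) 𝓘(ℝ, E') ∞ fun y ↦ (L.symm y).1 :=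
      ContDiff.contMDiff (contDiff_fst.comp L.symm.contDiff)
    exact h2.comp_contMDiffOn (ψ.contMDiffOn_extend hψ)
  have hs : ∀ r ∈ φ.source, r ∈ (φ.extend I').source := fun r hr ↦ by
    rwa [φ.extend_source]
  have hgj : ∀ r ∈ φ.source, g (j r) = φ.extend I' r := by
    intro r hr
    have h1 : ψ.extend I (j ((φ.extend I').symm (φ.extend I' r))) = L (φ.extend I' r, 0) :=
      hL ((φ.extend I').map_source (hs r hr))
    rw [(φ.extend I').left_inv (hs r hr)] at h1
    change (L.symm (ψ.extend I (j r))).1 = _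
    rw [h1, L.symm_apply_apply]
  have hopen : IsOpen (ψ.source ∩ g ⁻¹' (φ.extend I').target) :=
    hg.continuousOn.isOpen_inter_preimage ψ.open_source φ.isOpen_extend_target
  refine ⟨(φ.extend I').symm ∘ g, _, hopen, ⟨hjp, ?_⟩, ?_, ?_⟩
  · rw [Set.mem_preimage, hgj p hp]
    exact (φ.extend I').map_source (hs p hp)
  · refine ContMDiffOn.comp (contMDiffOn_extend_symm hφ) (hg.mono Set.inter_subset_left)
      fun y hy ↦ ?_
    have := hy.2
    rwa [Set.mem_preimage, OpenPartialHomeomorph.extend_target'] at this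
  · filter_upwards [φ.open_source.mem_nhds hp] with r hr
    rw [Function.comp_apply, hgj r hr, (φ.extend I').left_inv (hs r hr)]

theorem mfderiv_injective_of_isImmersion [I'.Boundaryless] (hj : Manifold.IsImmersion I' I ∞ j)
    (p : N) : Function.Injective (mfderiv I' I j p) := by
  obtain ⟨ρ, u, hu, hp, hρ, h⟩ := exists_local_retraction hj p
  have h1 : MDifferentiableAt I I' ρ (j p) :=
    (hρ.contMDiffAt (hu.mem_nhds hp)).mdifferentiableAt (by simp)
  have h2 : MDifferentiableAt I' I j p := (hj.contMDiff p).mdifferentiableAt (by simp)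
  have h3 : (ρ ∘ j) =ᶠ[𝓝 p] id := h
  have h4 := mfderiv_comp p h1 h2
  rw [h3.mfderiv_eq, mfderiv_id] at h4
  intro a b hab
  have h5 : ∀ c : TangentSpace I' p, c = mfderiv I I' ρ (j p) (mfderiv I' I j p c) := fun c ↦
    congrArg (fun L ↦ L c) h4
  rw [h5 a, h5 b, hab]

theorem exists_relatedNear [I'.Boundaryless] (hj : Manifold.IsImmersion I' I ∞ j) (p : N)
    {Y : VField I' N} (hY : SmoothField I' Y) :
    ∃ Y' : VField I M, SmoothField I Y' ∧ RelatedNear j p Y Y' := by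
  obtain ⟨ρ, u, hu, hp, hρ, h⟩ := exists_local_retraction hj p
  let e := trivializationAt E (TangentSpace I : M → Type _) (j p)
  have hjs : ContMDiff I' I ∞ j := hj.contMDiff
  have hpe : j p ∈ e.baseSet := FiberBundle.mem_baseSet_trivializationAt' (j p)
  let w : N → E := fun r ↦ (e (⟨j r, mfderiv I' I j r (Y r)⟩ : TangentBundle I M)).2
  have hv : IsOpen (j ⁻¹' e.baseSet) := e.open_baseSet.preimage hjs.continuous
  have hw : ContMDiffOn I' 𝓘(ℝ, E) ∞ w (j ⁻¹' e.baseSet) := by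
    have h1 : ContMDiff I' I.tangent ∞ fun r ↦ (⟨j r, mfderiv I' I j r (Y r)⟩ : TangentBundle I M) :=
      (ContMDiff.contMDiff_tangentMap hjs (m := ∞) (by simp)).comp hY
    have h2 : ContMDiffOn I.tangent (I.prod 𝓘(ℝ, E)) ∞ e e.source := e.contMDiffOn
    have h3 := h2.comp h1.contMDiffOn (s := j ⁻¹' e.baseSet) (fun r hr ↦ e.mem_source.2 hr)
    exact contMDiff_snd.comp_contMDiffOn h3
  let u' := u ∩ ρ ⁻¹' (j ⁻¹' e.baseSet) ∩ e.baseSet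
  have hu' : IsOpen u' :=
    (hρ.continuousOn.isOpen_inter_preimage hu hv).inter e.open_baseSet
  have hp' : j p ∈ u' := ⟨⟨hp, by simpa [h.self_of_nhds] using hpe⟩, hpe⟩
  obtain ⟨Y', hY', hYe⟩ := exists_smoothField_eventuallyEq (I := I) hu' hp'
    (V := fun y ↦ e.symm y (w (ρ y))) (by
      refine (e.contMDiffOn_section_iff (IB := I) hu' Set.inter_subset_right).2 ?_
      have h4 : ContMDiffOn I 𝓘(ℝ, E) ∞ (w ∘ ρ) u' :=
        hw.comp (hρ.mono fun y hy ↦ hy.1.1) fun y hy ↦ hy.1.2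
      refine h4.congr fun y hy ↦ ?_
      rw [e.apply_mk_symm hy.2]; rfl)
  refine ⟨Y', hY', ?_⟩
  filter_upwards [hjs.continuous.continuousAt.eventually hYe, h,
    hv.mem_nhds (x := p) hpe] with r h1 h2 h3
  rw [h1, h2]
  exact e.symm_apply_apply_mk h3 _

section Related

variable {p : N} {Y Z W : VField I' N} {Y' Z' W' : VField I M}

theorem RelatedNear.eventually (h : RelatedNear j p Y Y') : ∀ᶠ r in 𝓝 p, RelatedNear j r Y Y' :=
  h.eventually_nhds

theorem RelatedNear.along (hj : ContMDiff I' I ∞ j) (h : RelatedNear j p Y Y') {f : M → ℝ}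
    (hf : SmoothFn I f) :
    along I Y' f ∘ j =ᶠ[𝓝 p] along I' Y (f ∘ j) := by
  filter_upwards [h] with r hr
  have := mvfderiv_comp_apply r (hf.mdiff (j r)) ((hj r).mdifferentiableAt (by simp)) (Y r)
  simp only [Function.comp_apply, Horizon.along, hr, this]

theorem RelatedNear.bracket (hj : ContMDiff I' I ∞ j) (hY : SmoothField I' Y)
    (hZ : SmoothField I' Z) (hY' : SmoothField I Y') (hZ' : SmoothField I Z')
    (h1 : RelatedNear j p Y Y') (h2 : RelatedNear j p Z Z') :
    RelatedNear j p (bracket I' Y Z) (bracket I Y' Z') := by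
  filter_upwards [h1.eventually, h2.eventually] with r h1 h2
  refine tangent_ext fun f hf ↦ ?_
  have e1 := congrFun (along_bracket hY' hZ' hf) (j r)
  have hfj : SmoothFn I' (f ∘ j) := hf.comp hj
  have e2 := congrFun (along_bracket hY hZ hfj) r
  have e3 := mvfderiv_comp_apply r (hf.mdiff (j r)) ((hj r).mdifferentiableAt (by simp))
    (Horizon.bracket I' Y Z r)
  have a1 := (h1.along hj (smoothFn_along hZ' hf)).self_of_nhds
  have a2 := (h2.along hj (smoothFn_along hY' hf)).self_of_nhds
  rw [along_congr (h2.along hj hf)] at a1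
  rw [along_congr (h1.along hj hf)] at a2
  simp only [Horizon.along, Function.comp_apply, Pi.sub_apply] at *
  rw [e1, a1, a2, ← e3, e2]

theorem RelatedNear.nabla {D' : Connection I M} {D : Connection I' N} (hD : IsInduced j D' D)
    (hZ : SmoothField I' Z) (hZ' : SmoothField I Z')
    (h1 : RelatedNear j p Y Y') (h2 : RelatedNear j p Z Z') :
    RelatedNear j p (nabla D Y Z) (nabla D' Y' Z') := by
  filter_upwards [h1, h2.eventually] with r h1 h2
  simp only [Horizon.nabla]
  rw [hD r Z Z' hZ hZ' h2 (Y r), h1]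

theorem RelatedNear.sub (h1 : RelatedNear j p Y Y') (h2 : RelatedNear j p Z Z') :
    RelatedNear j p (Y - Z) (Y' - Z') := by
  filter_upwards [h1, h2] with r h1 h2
  simp [h1, h2]

theorem RelatedNear.curvature {D' : Connection I M} {D : Connection I' N} (hj : ContMDiff I' I ∞ j)
    (hD : IsInduced j D' D) (hDs : SmoothConnection D) (hDs' : SmoothConnection D')
    (hY : SmoothField I' Y) (hZ : SmoothField I' Z) (hW : SmoothField I' W)
    (hY' : SmoothField I Y') (hZ' : SmoothField I Z') (hW' : SmoothField I W')
    (h1 : RelatedNear j p Y Y') (h2 : RelatedNear j p Z Z') (h3 : RelatedNear j p W W') :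
    RelatedNear j p (curvature D Y Z W) (curvature D' Y' Z' W') :=
  ((h1.nabla hD (hZ.nabla hDs hW) (hZ'.nabla hDs' hW') (h2.nabla hD hW hW' h3)).sub
    (h2.nabla hD (hY.nabla hDs hW) (hY'.nabla hDs' hW') (h1.nabla hD hW hW' h3))).sub
    ((h1.bracket hj hY hZ hY' hZ' h2).nabla hD hW hW' h3)

theorem pullBilin_eventuallyEq (g : BilinField I M) (h1 : RelatedNear j p Y Y')
    (h2 : RelatedNear j p Z Z') :
    (fun r ↦ pullBilin (I' := I') j g r (Y r) (Z r)) =ᶠ[𝓝 p] (fun x ↦ g x (Y' x) (Z' x)) ∘ j := by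
  filter_upwards [h1, h2] with r h1 h2
  simp only [Function.comp_apply, h1, h2]
  rfl

end Related

variable [I'.Boundaryless] {g : BilinField I M} {D' : Connection I M} {D : Connection I' N}

/-- The connection induced on an immersed submanifold is torsion free and compatible with the
induced (possibly degenerate) metric. -/
theorem isLeviCivita_pullBilin (hj : Manifold.IsImmersion I' I ∞ j) (hg : SmoothOnFields g)
    (hD' : IsLeviCivita g D') (hD : SmoothConnection D) (hind : IsInduced j D' D) :
    IsLeviCivita (pullBilin (I' := I') j g) D := by
  refine ⟨hD, fun Y Z hY hZ p ↦ ?_, fun X Y Z hX hY hZ p ↦ ?_⟩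
  · obtain ⟨Y', hY', h1⟩ := exists_relatedNear hj p hY
    obtain ⟨Z', hZ', h2⟩ := exists_relatedNear hj p hZ
    refine mfderiv_injective_of_isImmersion hj p ?_
    have e1 := (h1.bracket hj.contMDiff hY hZ hY' hZ' h2).self_of_nhds
    have e2 := (h1.nabla hind hZ hZ' h2).self_of_nhds
    have e3 := (h2.nabla hind hY hY' h1).self_of_nhds
    rw [map_sub, ← e1, ← e2, ← e3]
    exact hD'.2.1 Y' Z' hY' hZ' (j p)
  · obtain ⟨X', hX', h0⟩ := exists_relatedNear hj p hX
    obtain ⟨Y', hY', h1⟩ := exists_relatedNear hj p hY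
    obtain ⟨Z', hZ', h2⟩ := exists_relatedNear hj p hZ
    rw [along_congr (pullBilin_eventuallyEq g h1 h2)]
    have e1 := (h0.along hj.contMDiff (hg.smoothFn hY' hZ')).self_of_nhds
    rw [← e1, Function.comp_apply, hD'.metric hX' hY' hZ']
    have e2 := (pullBilin_eventuallyEq g (h0.nabla hind hY hY' h1) h2).self_of_nhds
    have e3 := (pullBilin_eventuallyEq g h1 (h0.nabla hind hZ hZ' h2)).self_of_nhds
    simp only [Function.comp_apply] at e2 e3
    rw [← e2, ← e3]

end Immersions

section LorentzForm

variable {n : ℕ} {V : Type*} [AddCommGroup V] [Module ℝ V]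

/-- The bilinear form `g` has signature `(-, +, …, +)`. -/
def IsLorentzForm (n : ℕ) (g : V →ₗ[ℝ] V →ₗ[ℝ] ℝ) : Prop :=
  ∃ b : Module.Basis (Fin (n + 1)) ℝ V, ∀ i j,
    g (b i) (b j) = if i = j then (if i = 0 then -1 else 1) else 0

variable {g : V →ₗ[ℝ] V →ₗ[ℝ] ℝ}

theorem IsLorentzForm.exists_decomposition (hg : IsLorentzForm n g) :
    ∃ (τ : V →ₗ[ℝ] ℝ) (s : V →ₗ[ℝ] EuclideanSpace ℝ (Fin n)),
      (∀ u w, g u w = -(τ u * τ w) + inner ℝ (s u) (s w)) ∧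
      (∀ u, τ u = 0 → s u = 0 → u = 0) ∧ ∀ φ : V →ₗ[ℝ] ℝ, ∃ w, ∀ y, g w y = φ y := by
  obtain ⟨b, hb⟩ := hg
  have hgb : ∀ u w, g u w = ∑ i, (if i = 0 then -1 else 1) * (b.repr u i * b.repr w i) := by
    intro u w
    conv_lhs => rw [← b.sum_repr u, ← b.sum_repr w]
    simp only [map_sum, LinearMap.sum_apply, map_smul, LinearMap.smul_apply, hb, smul_eq_mul]
    refine Finset.sum_congr rfl fun i _ ↦ ?_
    rw [Finset.sum_eq_single i (fun j _ hj ↦ by simp [hj]) (by simp)]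
    simp only [if_true]; ring
  refine ⟨b.coord 0, (WithLp.linearEquiv 2 ℝ (Fin n → ℝ)).symm.toLinearMap ∘ₗ
    LinearMap.pi fun i : Fin n ↦ b.coord i.succ, fun u w ↦ ?_, fun u h0 h1 ↦ ?_, fun φ ↦ ?_⟩
  · rw [hgb, Fin.sum_univ_succ]
    simp [PiLp.inner_apply, Fin.succ_ne_zero, mul_comm]
  · apply b.ext_elem
    intro i
    refine Fin.cases ?_ (fun i ↦ ?_) i
    · simpa using h0
    · have := congrArg (fun v : EuclideanSpace ℝ (Fin n) ↦ v i) h1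
      simpa using this
  · refine ⟨∑ i, ((if i = 0 then -1 else 1) * φ (b i)) • b i, fun y ↦ ?_⟩
    conv_rhs => rw [← b.sum_repr y, map_sum]
    rw [hgb]
    refine Finset.sum_congr rfl fun i _ ↦ ?_
    rw [b.repr_sum_self]
    split_ifs <;> simp [mul_comm]

theorem IsLorentzForm.symm (hg : IsLorentzForm n g) (u w : V) : g u w = g w u := by
  obtain ⟨τ, s, h, -, -⟩ := hg.exists_decomposition
  rw [h, h, real_inner_comm, mul_comm]

theorem IsLorentzForm.exists_dual (hg : IsLorentzForm n g) (φ : V →ₗ[ℝ] ℝ) :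
    ∃ w, ∀ y, g w y = φ y := by
  obtain ⟨τ, s, -, -, h⟩ := hg.exists_decomposition
  exact h φ

theorem IsLorentzForm.nonneg_of_orthogonal_null (hg : IsLorentzForm n g) {k w : V} (hk : k ≠ 0)
    (hkk : g k k = 0) (hwk : g w k = 0) : 0 ≤ g w w ∧ (g w w = 0 → ∃ c : ℝ, w = c • k) := by
  obtain ⟨τ, s, h, h0, -⟩ := hg.exists_decomposition
  rw [h, real_inner_self_eq_norm_sq] at hkk
  rw [h] at hwk
  have hτ : τ k ≠ 0 := by
    intro h1
    refine hk (h0 k h1 ?_)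
    rw [h1] at hkk
    simpa using hkk
  have key : ‖τ k • s w - τ w • s k‖ ^ 2 = τ k ^ 2 * g w w := by
    rw [h, norm_sub_sq_real, norm_smul, norm_smul, inner_smul_left, inner_smul_right,
      real_inner_self_eq_norm_sq, mul_pow, mul_pow, Real.norm_eq_abs, Real.norm_eq_abs, sq_abs, sq_abs]
    simp only [conj_trivial]
    have e1 : inner ℝ (s w) (s k) = τ w * τ k := by linarith
    have e2 : ‖s k‖ ^ 2 = τ k * τ k := by linarith
    rw [e1, e2]; ring
  have hτ2 : 0 < τ k ^ 2 := by positivity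
  constructor
  · by_contra hneg
    nlinarith [sq_nonneg ‖τ k • s w - τ w • s k‖]
  · intro hww
    rw [hww, mul_zero] at key
    have h2 : τ k • s w - τ w • s k = 0 := by simpa using key
    refine ⟨τ w / τ k, sub_eq_zero.1 (h0 _ ?_ ?_)⟩
    · simp only [map_sub, map_smul, smul_eq_mul]; field_simp; ring
    · have : s w = (τ w / τ k) • s k := by
        rw [div_eq_inv_mul, mul_smul, ← sub_eq_zero.1 h2, smul_smul, inv_mul_cancel₀ hτ, one_smul]
      simp [this]

/-- A basis adapted to a transverse vector `t` and to a vector `k` in the kernel of `l`. -/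
theorem exists_adapted_basis [FiniteDimensional ℝ V] {l : V →ₗ[ℝ] ℝ} {t k : V} (ht : l t ≠ 0)
    (hk : k ≠ 0) (hlk : l k = 0) :
    ∃ (r : ℕ) (b : Module.Basis (Fin (r + 2)) ℝ V), b 0 = t ∧ b 1 = k ∧
      ∀ i : Fin r, l (b i.succ.succ) = 0 := by
  let k' : LinearMap.ker l := ⟨k, hlk⟩
  have hk' : k' ≠ 0 := fun h ↦ hk (congrArg Subtype.val h)
  obtain ⟨C, hC⟩ := (Submodule.span ℝ {k'}).exists_isCompl
  let b1 := Module.Basis.mkFinCons k' (Module.finBasis ℝ C)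
    (fun c x hx h ↦ by
      have h1 : c • k' ∈ C := by rw [eq_neg_of_add_eq_zero_left h]; exact C.neg_mem hx
      have h2 : c • k' ∈ Submodule.span ℝ {k'} :=
        Submodule.smul_mem _ _ (Submodule.mem_span_singleton_self _)
      have h3 := (Submodule.disjoint_def.1 hC.disjoint) _ h2 h1
      exact (smul_eq_zero.1 h3).resolve_right hk')
    (fun z ↦ by
      have hz : z ∈ Submodule.span ℝ {k'} ⊔ C := by rw [hC.sup_eq_top]; trivial
      obtain ⟨y, hy, x, hx, rfl⟩ := Submodule.mem_sup.1 hz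
      obtain ⟨c, rfl⟩ := Submodule.mem_span_singleton.1 hy
      exact ⟨-c, by simpa [add_comm, add_assoc] using hx⟩)
  let b := Module.Basis.mkFinCons t b1
    (fun c x hx h ↦ by
      have h1 := congrArg l h
      rw [map_add, LinearMap.mem_ker.1 hx, map_smul, map_zero, add_zero] at h1
      exact (smul_eq_zero.1 h1).resolve_right ht)
    (fun z ↦ ⟨-(l z / l t), by
      rw [LinearMap.mem_ker, map_add, map_smul, smul_eq_mul]; field_simp; ring⟩)
  have hb : (b : Fin _ → V) = Fin.cons t ((↑) ∘ b1) := Module.Basis.coe_mkFinCons _ _ _ _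
  have hb1 : (b1 : Fin _ → LinearMap.ker l) = Fin.cons k' ((↑) ∘ Module.finBasis ℝ C) :=
    Module.Basis.coe_mkFinCons _ _ _ _
  refine ⟨_, b, by rw [hb]; rfl, ?_, fun i ↦ ?_⟩
  · rw [hb, ← Fin.succ_zero_eq_one, Fin.cons_succ, Function.comp_apply, hb1]; rfl
  · rw [hb, Fin.cons_succ, Function.comp_apply]
    exact (b1 i.succ).2

theorem sum_coord_eq_of_adapted {r : ℕ} {b : Module.Basis (Fin (r + 2)) ℝ V} {l : V →ₗ[ℝ] ℝ}
    {A : Fin (r + 2) → V} {c : ℝ} (ht : l (b 0) ≠ 0) (hk : l (b 1) = 0)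
    (hb : ∀ i : Fin r, l (b i.succ.succ) = 0) (h0 : l (A 0) = 0) (h1 : A 1 = c • b 1)
    (h2 : ∀ i : Fin r, ∃ a : ℝ, A i.succ.succ = a • b 1) : ∑ i, b.coord i (A i) = c := by
  rw [Fin.sum_univ_succ, Fin.sum_univ_succ, Finset.sum_eq_zero, Fin.succ_zero_eq_one, h1]
  · have h3 : b.coord 0 (A 0) = 0 := by
      have h4 := h0
      rw [← b.sum_repr (A 0), map_sum, Fin.sum_univ_succ, Fin.sum_univ_succ] at h4
      simp only [map_smul, hb, Fin.succ_zero_eq_one, hk, Finset.sum_const_zero, add_zero,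
        mul_zero, smul_eq_mul] at h4
      exact (mul_eq_zero.1 h4).resolve_right ht
    simp [h3]
  · intro i _
    obtain ⟨a, ha⟩ := h2 i
    rw [ha, map_smul, b.coord_apply, b.repr_self, ← Fin.succ_zero_eq_one,
      Finsupp.single_eq_of_ne (by simp [Fin.ext_iff]), smul_zero]

end LorentzForm

section CurvatureAlgebra

variable {E : Type*} [NormedAddCommGroup E] [NormedSpace ℝ E] [FiniteDimensional ℝ E]
  {H : Type*} [TopologicalSpace H]
  {I : ModelWithCorners ℝ E H} {M : Type*} [TopologicalSpace M] [ChartedSpace H M]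
  [IsManifold I ∞ M] [T2Space M]

theorem curvature_self {D : Connection I M} (X Z : VField I M) : curvature D X X Z = 0 := by
  funext x
  simp [curvature, nabla]

variable {q : BilinField I M} {D : Connection I M} {k : VField I M}

/-- Covariant derivatives of degenerate fields are degenerate. -/
theorem IsLeviCivita.nabla_degenerate (h : IsLeviCivita q D) (hk : SmoothField I k)
    (hqk : ∀ Y, SmoothField I Y → ∀ p, q p (k p) (Y p) = 0) {Y : VField I M} (hY : SmoothField I Y) :
    ∀ Z, SmoothField I Z → ∀ p, q p (nabla D Y k p) (Z p) = 0 := by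
  intro Z hZ p
  have h1 := h.metric hY hk hZ p
  rw [hqk _ (hY.nabla h.1 hZ) p, add_zero] at h1
  rw [← h1]
  have : (fun y ↦ q y (k y) (Z y)) = fun _ ↦ 0 := funext (hqk Z hZ)
  rw [this, along_const]; rfl

theorem IsLeviCivita.curvature_degenerate (h : IsLeviCivita q D) (hk : SmoothField I k)
    (hqk : ∀ Y, SmoothField I Y → ∀ p, q p (k p) (Y p) = 0) {X Y Z : VField I M}
    (hX : SmoothField I X) (hY : SmoothField I Y) (hZ : SmoothField I Z) (p : M) :
    q p (curvature D X Y k p) (Z p) = 0 := by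
  have h1 := h.nabla_degenerate (hY.nabla h.1 hk) (h.nabla_degenerate hk hqk hY) hX Z hZ p
  have h2 := h.nabla_degenerate (hX.nabla h.1 hk) (h.nabla_degenerate hk hqk hX) hY Z hZ p
  have h3 := h.nabla_degenerate hk hqk (hX.bracket hY) Z hZ p
  simp only [curvature, map_sub, sub_apply, h1, h2, h3, sub_zero]

end CurvatureAlgebra

section Spacetime

variable {m : ℕ} {M : Type*} [TopologicalSpace M] [T2Space M]
    [ChartedSpace (EuclideanSpace ℝ (Fin (m + 2))) M] [IsManifold (𝓡 (m + 2)) ∞ M]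
    {S : Spacetime m M} {B : Type*} [TopologicalSpace B] [T2Space B]
    [ChartedSpace (EuclideanSpace ℝ (Fin m)) B] [IsManifold (𝓡 m) ∞ B]

/-- The metric at a point, as a linear map. -/
def Spacetime.form (S : Spacetime m M) (x : M) :
    TangentSpace (𝓡 (m + 2)) x →ₗ[ℝ] TangentSpace (𝓡 (m + 2)) x →ₗ[ℝ] ℝ :=
  ContinuousLinearMap.coeLM ℝ ∘ₗ (S.g x : TangentSpace (𝓡 (m + 2)) x →ₗ[ℝ] _)

theorem Spacetime.isLorentzForm (S : Spacetime m M) (x : M) : IsLorentzForm (m + 1) (S.form x) :=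
  S.lorentzian x

variable (h : NonExpandingHorizon S B)

theorem NonExpandingHorizon.q_apply (p : B × ℝ) (u w : TangentSpace (model m) p) :
    h.q p u w = S.g (h.emb p) (mfderiv (model m) (𝓡 (m + 2)) h.emb p u)
      (mfderiv (model m) (𝓡 (m + 2)) h.emb p w) := rfl

theorem NonExpandingHorizon.mfderiv_injective (p : B × ℝ) :
    Function.Injective (mfderiv (model m) (𝓡 (m + 2)) h.emb p) :=
  mfderiv_injective_of_isImmersion h.isEmbedding.isImmersion p

theorem NonExpandingHorizon.q_symm (p : B × ℝ) (u w : TangentSpace (model m) p) :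
    h.q p u w = h.q p w u := (S.isLorentzForm _).symm _ _

theorem NonExpandingHorizon.vertical_ne_zero (p : B × ℝ) : vertical m B p ≠ 0 := by
  intro h0
  have := congrArg (fun u : EuclideanSpace ℝ (Fin m) × ℝ ↦ u.2) h0
  exact one_ne_zero this

theorem NonExpandingHorizon.q_nonneg (p : B × ℝ) (u : TangentSpace (model m) p) :
    0 ≤ h.q p u u ∧ (h.q p u u = 0 → ∃ c : ℝ, u = c • vertical m B p) := by
  have hv := h.null_generators p
  have h1 := (S.isLorentzForm (h.emb p)).nonneg_of_orthogonal_null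
    (k := mfderiv (model m) (𝓡 (m + 2)) h.emb p (vertical m B p))
    (w := mfderiv (model m) (𝓡 (m + 2)) h.emb p u)
    ((map_ne_zero_iff _ (h.mfderiv_injective p)).2 (NonExpandingHorizon.vertical_ne_zero p))
    (hv _) ((h.q_symm p _ _).trans (hv u))
  refine ⟨h1.1, fun h0 ↦ ?_⟩
  obtain ⟨c, hc⟩ := h1.2 h0
  exact ⟨c, h.mfderiv_injective p (by rw [hc, map_smul])⟩

theorem NonExpandingHorizon.eq_smul_vertical {p : B × ℝ} {u : TangentSpace (model m) p}
    (hu : ∀ w, h.q p u w = 0) : ∃ c : ℝ, u = c • vertical m B p := (h.q_nonneg p u).2 (hu u)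

theorem NonExpandingHorizon.isLeviCivita : IsLeviCivita h.q h.D :=
  isLeviCivita_pullBilin h.isEmbedding.isImmersion S.smooth_g.smoothOnFields S.leviCivita
    h.smooth_D h.induced_D

/-- The Ricci tensor contracted with a null normal `k` is read off from the curvature of the
induced connection. -/
theorem NonExpandingHorizon.ric_eq {k Y : VField (model m) (B × ℝ)} (hk : SmoothField (model m) k)
    (hY : SmoothField (model m) Y) (hqk : ∀ p u, h.q p (k p) u = 0) {p : B × ℝ} (hkp : k p ≠ 0)
    {c : ℝ} (hc : curvature h.D k Y k p = c • k p) :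
    S.ric (h.emb p) (mfderiv (model m) (𝓡 (m + 2)) h.emb p (Y p))
      (mfderiv (model m) (𝓡 (m + 2)) h.emb p (k p)) = c := by
  have : FiniteDimensional ℝ (TangentSpace (𝓡 (m + 2)) (h.emb p)) :=
    inferInstanceAs (FiniteDimensional ℝ (EuclideanSpace ℝ (Fin (m + 2))))
  have hj := h.isEmbedding.isImmersion
  have hlc := h.isLeviCivita
  set L : TangentSpace (model m) p →L[ℝ] TangentSpace (𝓡 (m + 2)) (h.emb p) :=
    mfderiv (model m) (𝓡 (m + 2)) h.emb p with hL
  have hLinj : Function.Injective L := h.mfderiv_injective p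
  have hlor := S.isLorentzForm (h.emb p)
  have hnull : ∀ u, S.form (h.emb p) (L (k p)) (L u) = 0 := hqk p
  have hLk : L (k p) ≠ 0 := (map_ne_zero_iff _ hLinj).2 hkp
  have htk : S.form (h.emb p) (S.time (h.emb p)) (L (k p)) ≠ 0 := fun h0 ↦
    absurd (hlor.nonneg_of_orthogonal_null hLk (hnull _) h0).1 (not_le.2 (S.timelike _))
  -- the tangent space of the horizon is the orthogonal complement of the null normal
  let N : Submodule ℝ (TangentSpace (𝓡 (m + 2)) (h.emb p)) :=
    LinearMap.ker (S.form (h.emb p) (L (k p)))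
  have hN : ∀ w, w ∈ N → ∃ u, L u = w := by
    have hle : LinearMap.range L.toLinearMap ≤ N := by
      rintro _ ⟨u, rfl⟩
      exact hnull u
    have h1 : Module.finrank ℝ (LinearMap.range L.toLinearMap) = m + 1 := by
      rw [LinearMap.finrank_range_of_inj hLinj]
      change Module.finrank ℝ (EuclideanSpace ℝ (Fin m) × ℝ) = _
      simp
    have h2 : Module.finrank ℝ N + 1 = m + 2 := by
      have e1 := LinearMap.finrank_range_add_finrank_ker (S.form (h.emb p) (L (k p)))
      have e2 : LinearMap.range (S.form (h.emb p) (L (k p))) = ⊤ := by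
        refine LinearMap.range_eq_top.2 (LinearMap.surjective fun h0 ↦ htk ?_)
        rw [hlor.symm, h0]; rfl
      have e3 : Module.finrank ℝ (TangentSpace (𝓡 (m + 2)) (h.emb p)) = m + 2 := by
        change Module.finrank ℝ (EuclideanSpace ℝ (Fin (m + 2))) = _
        simp
      rw [e2, finrank_top, e3] at e1
      rw [Module.finrank_self] at e1
      change 1 + Module.finrank ℝ N = _ at e1
      omega
    have h3 := Submodule.eq_of_le_of_finrank_eq hle (by omega)
    intro w hw
    rw [← h3] at hw
    exact hw
  have hkN : L (k p) ∈ N := hnull _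
  obtain ⟨r, b, hb0, hb1, hb2⟩ := exists_adapted_basis (l := S.form (h.emb p) (L (k p)))
    (t := S.time (h.emb p)) (by rwa [hlor.symm]) hLk (hnull _)
  obtain ⟨k', hk', rk⟩ := exists_relatedNear hj p hk
  obtain ⟨Y', hY', rY⟩ := exists_relatedNear hj p hY
  have hW : ∀ i : Fin r, ∃ (W : VField (model m) (B × ℝ)) (W' : VField (𝓡 (m + 2)) M),
      SmoothField (model m) W ∧ SmoothField (𝓡 (m + 2)) W' ∧ RelatedNear h.emb p W W' ∧
      b i.succ.succ = W' (h.emb p) := by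
    intro i
    obtain ⟨u, hu⟩ := hN _ (hb2 i)
    obtain ⟨W, hW, rfl⟩ := exists_smoothField_apply p u
    obtain ⟨W', hW', rW⟩ := exists_relatedNear hj p hW
    exact ⟨W, W', hW, hW', rW, by rw [← hu, rW.self_of_nhds]⟩
  choose W W' hWs hWs' rW hbW using hW
  let V : Fin (r + 2) → VField (𝓡 (m + 2)) M := Fin.cons S.time (Fin.cons k' W')
  have hV : ∀ i, SmoothField (𝓡 (m + 2)) (V i) := by
    intro i
    refine Fin.cases S.smooth_time (fun i ↦ ?_) i
    exact Fin.cases hk' (fun i ↦ hWs' i) i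
  have hbV : ∀ i, b i = V i (h.emb p) := by
    intro i
    refine Fin.cases hb0 (fun i ↦ ?_) i
    refine Fin.cases ?_ (fun i ↦ hbW i) i
    exact hb1.trans rk.self_of_nhds.symm
  have hric := S.isRicci _ V Y' k' hV hY' hk' (h.emb p) b hbV
  rw [rY.self_of_nhds, rk.self_of_nhds] at hric
  rw [hric]
  have hcurv : ∀ {U : VField (model m) (B × ℝ)} {U' : VField (𝓡 (m + 2)) M},
      SmoothField (model m) U → SmoothField (𝓡 (m + 2)) U' → RelatedNear h.emb p U U' →
      curvature S.conn U' Y' k' (h.emb p) = L (curvature h.D U Y k p) := fun hU hU' rU ↦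
    (rU.curvature hj.contMDiff h.induced_D h.smooth_D S.leviCivita.1 hU hY hk hU' hY' hk' rY
      rk).self_of_nhds
  refine sum_coord_eq_of_adapted (l := S.form (h.emb p) (L (k p))) (by rwa [hb0, hlor.symm])
    (by rw [hb1]; exact hnull _) hb2 ?_ ?_ fun i ↦ ?_
  · rw [hlor.symm, ← rk.self_of_nhds]
    exact S.leviCivita.curvature_skew S.smooth_g.smoothOnFields
      (fun x ↦ (S.isLorentzForm x).symm) S.smooth_time hY' hk' (h.emb p)
  · change curvature S.conn k' Y' k' (h.emb p) = _
    rw [hcurv hk hk' rk, hc, map_smul, hb1]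
  · have h1 : ∀ w, h.q p (curvature h.D (W i) Y k p) w = 0 := by
      intro w
      obtain ⟨Z, hZ, rfl⟩ := exists_smoothField_apply p w
      exact hlc.curvature_degenerate hk (fun Z _ p ↦ hqk p (Z p)) (hWs i) hY hZ p
    obtain ⟨c1, hc1⟩ := h.eq_smul_vertical h1
    obtain ⟨c2, hc2⟩ := h.eq_smul_vertical (hqk p)
    have hc20 : c2 ≠ 0 := by rintro rfl; exact hkp (by rw [hc2, zero_smul])
    refine ⟨c1 / c2, ?_⟩
    change curvature S.conn (W' i) Y' k' (h.emb p) = _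
    rw [hcurv (hWs i) (hWs' i) (rW i), hb1, ← map_smul, hc1, hc2, smul_smul, div_mul_cancel₀ _ hc20]

/-- By the Einstein equations and the energy condition, `R(k, Y) k = 0` for null normals `k`. -/
theorem NonExpandingHorizon.curvature_null {k Y : VField (model m) (B × ℝ)}
    (hk : SmoothField (model m) k) (hY : SmoothField (model m) Y)
    (hqk : ∀ p u, h.q p (k p) u = 0) {p : B × ℝ} (hkp : k p ≠ 0) :
    curvature h.D k Y k p = 0 := by
  have hlc := h.isLeviCivita
  have hlor := S.isLorentzForm (h.emb p)
  have hT : ∀ Z : VField (model m) (B × ℝ), SmoothField (model m) Z → ∀ c : ℝ,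
      curvature h.D k Z k p = c • k p →
      c = 8 * Real.pi * S.G * S.T (h.emb p) (mfderiv (model m) (𝓡 (m + 2)) h.emb p (Z p))
        (mfderiv (model m) (𝓡 (m + 2)) h.emb p (k p)) := by
    intro Z hZ c hc
    have h1 := S.einstein (h.emb p) (mfderiv (model m) (𝓡 (m + 2)) h.emb p (Z p))
        (mfderiv (model m) (𝓡 (m + 2)) h.emb p (k p))
    have h2 : S.g (h.emb p) (mfderiv (model m) (𝓡 (m + 2)) h.emb p (Z p))
        (mfderiv (model m) (𝓡 (m + 2)) h.emb p (k p)) = 0 := by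
      rw [← h.q_apply, h.q_symm]; exact hqk p _
    rw [h.ric_eq hk hZ hqk hkp hc, h2] at h1
    linarith
  set L : TangentSpace (model m) p →L[ℝ] TangentSpace (𝓡 (m + 2)) (h.emb p) :=
    mfderiv (model m) (𝓡 (m + 2)) h.emb p with hL
  have hLinj : Function.Injective L := h.mfderiv_injective p
  have hpi : 8 * Real.pi * S.G ≠ 0 := by have := S.G_pos; have := Real.pi_pos; positivity
  have hTkk : S.T (h.emb p) (L (k p)) (L (k p)) = 0 := by
    have := hT k hk 0 (by rw [curvature_self, zero_smul]; rfl)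
    exact (mul_eq_zero.1 this.symm).resolve_left hpi
  have hnull : ∀ u, S.form (h.emb p) (L (k p)) (L u) = 0 := hqk p
  -- the future oriented null vector proportional to `k`
  obtain ⟨ε, hε, hfut⟩ : ∃ ε : ℝ, ε ≠ 0 ∧ S.form (h.emb p) (L (ε • k p)) (S.time (h.emb p)) < 0 := by
    have htk : S.form (h.emb p) (L (k p)) (S.time (h.emb p)) ≠ 0 := fun h0 ↦
      absurd (hlor.nonneg_of_orthogonal_null ((map_ne_zero_iff _ hLinj).2 hkp) (hnull _)
        (by rwa [hlor.symm])).1 (not_le.2 (S.timelike _))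
    rcases lt_or_gt_of_ne htk with h1 | h1
    · exact ⟨1, one_ne_zero, by simpa using h1⟩
    · exact ⟨-1, by norm_num, by simpa using h1⟩
  set u := ε • k p with hu
  have hu0 : u ≠ 0 := smul_ne_zero hε hkp
  have hnull' : ∀ y, S.form (h.emb p) (L u) (L y) = 0 := fun y ↦ by
    rw [hu, map_smul, map_smul, LinearMap.smul_apply, hnull, smul_zero]
  have hTuu : S.T (h.emb p) (L u) (L u) = 0 := by
    simp only [hu, map_smul, smul_apply, hTkk, smul_zero]
  obtain ⟨w, hw⟩ := hlor.exists_dual (-(S.T (h.emb p) (L u)).toLinearMap)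
  have hcausal := h.energy_condition p u hu0 (hnull' u) hfut w hw
  have hwu : S.form (h.emb p) w (L u) = 0 := by
    rw [hw]; change -(S.T (h.emb p) (L u) (L u)) = 0; rw [hTuu, neg_zero]
  have h1 := hlor.nonneg_of_orthogonal_null ((map_ne_zero_iff _ hLinj).2 hu0) (hnull' _) hwu
  obtain ⟨c, hc⟩ := h1.2 (le_antisymm hcausal.1 h1.1)
  have hTk : ∀ y, S.T (h.emb p) (L y) (L (k p)) = 0 := by
    intro y
    have h2 := hw (L y)
    rw [hc, map_smul, LinearMap.smul_apply, hnull', smul_zero] at h2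
    have h3 : S.T (h.emb p) (L u) (L y) = 0 := by
      have : (0 : ℝ) = -(S.T (h.emb p) (L u) (L y)) := h2
      linarith
    rw [S.symm_T, hu, map_smul] at h3
    simp only [map_smul, smul_eq_mul, mul_eq_zero] at h3
    exact h3.resolve_left hε
  have h4 : ∀ w, h.q p (curvature h.D k Y k p) w = 0 := by
    intro w
    obtain ⟨Z, hZ, rfl⟩ := exists_smoothField_apply p w
    exact hlc.curvature_degenerate hk (fun Z _ p ↦ hqk p (Z p)) hk hY hZ p
  obtain ⟨c1, hc1⟩ := h.eq_smul_vertical h4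
  obtain ⟨c2, hc2⟩ := h.eq_smul_vertical (hqk p)
  have hc20 : c2 ≠ 0 := by rintro rfl; exact hkp (by rw [hc2, zero_smul])
  have h5 : curvature h.D k Y k p = (c1 / c2) • k p := by
    rw [hc1, hc2, smul_smul, div_mul_cancel₀ _ hc20]
  rw [h5, hT Y hY _ h5, hTk, mul_zero, zero_smul]

end Spacetime

section ProductToolkit

variable {m : ℕ} {B : Type*} [TopologicalSpace B] [ChartedSpace (EuclideanSpace ℝ (Fin m)) B]
  [IsManifold (𝓡 m) ∞ B]

section Components

variable {p : B × ℝ} (u w : TangentSpace (model m) p) (c : ℝ)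

@[simp] theorem hor_add : hor (u + w) = hor u + hor w := rfl
@[simp] theorem ver_add : ver (u + w) = ver u + ver w := rfl
@[simp] theorem hor_sub : hor (u - w) = hor u - hor w := rfl
@[simp] theorem ver_sub : ver (u - w) = ver u - ver w := rfl
@[simp] theorem hor_neg : hor (-u) = -hor u := rfl
@[simp] theorem ver_neg : ver (-u) = -ver u := rfl
@[simp] theorem hor_smul : hor (c • u) = c • hor u := rfl
@[simp] theorem ver_smul : ver (c • u) = c * ver u := rfl
@[simp] theorem hor_zero : hor (0 : TangentSpace (model m) p) = 0 := rfl
@[simp] theorem ver_zero : ver (0 : TangentSpace (model m) p) = 0 := rfl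
@[simp] theorem hor_tvec (w : TangentSpace (𝓡 m) p.1) (c : ℝ) : hor (tvec p w c) = w := rfl
@[simp] theorem ver_tvec (w : TangentSpace (𝓡 m) p.1) (c : ℝ) : ver (tvec p w c) = c := rfl
@[simp] theorem hor_vertical : hor (vertical m B p) = 0 := rfl
@[simp] theorem ver_vertical : ver (vertical m B p) = 1 := rfl

theorem tangent_prod_ext {u w : TangentSpace (model m) p} (h1 : hor u = hor w)
    (h2 : ver u = ver w) : u = w := Prod.ext h1 h2

theorem hor_sum {ι : Type*} (s : Finset ι) (f : ι → TangentSpace (model m) p) :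
    hor (∑ i ∈ s, f i) = ∑ i ∈ s, hor (f i) :=
  map_sum (ContinuousLinearMap.fst ℝ (EuclideanSpace ℝ (Fin m)) ℝ) f s

theorem eq_smul_vertical_of_hor_eq_zero {u : TangentSpace (model m) p} (h : hor u = 0) :
    u = ver u • vertical m B p := tangent_prod_ext (by simp [h]) (by simp)

theorem mvfderiv_comp_fst {f : B → ℝ} (hf : SmoothFn (𝓡 m) f) :
    mvfderiv (model m) (fun p : B × ℝ ↦ f p.1) p u = mvfderiv (𝓡 m) f p.1 (hor u) := by
  have := mvfderiv_comp_apply (I' := model m) (I := 𝓡 m) p (hf.mdiff p.1)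
    (mdifferentiableAt_fst (I := 𝓡 m) (I' := 𝓘(ℝ, ℝ))) u
  refine this.trans ?_
  rw [mfderiv_fst]; rfl

theorem mvfderiv_snd : mvfderiv (model m) (Prod.snd : B × ℝ → ℝ) p u = ver u := by
  have h : mfderiv (model m) 𝓘(ℝ, ℝ) (Prod.snd : B × ℝ → ℝ) p = _ := mfderiv_snd
  have : mvfderiv (model m) (Prod.snd : B × ℝ → ℝ) p u
    = mfderiv (model m) 𝓘(ℝ, ℝ) (Prod.snd : B × ℝ → ℝ) p u := rfl
  rw [this, h]; rfl

end Components

theorem smoothFn_comp_fst {f : B → ℝ} (hf : SmoothFn (𝓡 m) f) :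
    SmoothFn (model m) (fun p : B × ℝ ↦ f p.1) := hf.comp contMDiff_fst

theorem smoothFn_snd : SmoothFn (model m) (Prod.snd : B × ℝ → ℝ) := contMDiff_snd

theorem smoothFn_slice {f : B × ℝ → ℝ} (hf : SmoothFn (model m) f) (v : ℝ) :
    SmoothFn (𝓡 m) (fun x ↦ f (x, v)) := hf.comp (contMDiff_id.prodMk contMDiff_const)

/-- The vector field on `B × ℝ` with components `Y` along `B` and `0` along `ℝ`. -/
def liftField (Y : VField (𝓡 m) B) : VField (model m) (B × ℝ) := fun p ↦ tvec p (Y p.1) 0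

@[simp] theorem hor_liftField (Y : VField (𝓡 m) B) (p : B × ℝ) : hor (liftField Y p) = Y p.1 := rfl
@[simp] theorem ver_liftField (Y : VField (𝓡 m) B) (p : B × ℝ) : ver (liftField Y p) = 0 := rfl

theorem SmoothField.liftField {Y : VField (𝓡 m) B} (hY : SmoothField (𝓡 m) Y) :
    SmoothField (model m) (liftField Y) := by
  have : IsManifold (𝓡 m) (∞ + 1) B := by simpa using! (inferInstance : IsManifold (𝓡 m) ∞ B)
  have h1 : ContMDiff (model m) ((𝓡 m).tangent.prod 𝓘(ℝ, ℝ).tangent) ∞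
      (fun p : B × ℝ ↦ ((⟨p.1, Y p.1⟩ : TangentBundle (𝓡 m) B),
        (⟨p.2, 0⟩ : TangentBundle 𝓘(ℝ, ℝ) ℝ))) :=
    (ContMDiff.comp hY contMDiff_fst).prodMk
      ((Bundle.contMDiff_zeroSection ℝ (TangentSpace 𝓘(ℝ, ℝ) : ℝ → Type _)).comp contMDiff_snd)
  exact contMDiff_equivTangentBundleProd_symm.comp h1

theorem smoothField_vertical : SmoothField (model m) (vertical m B) := by
  have : IsManifold (𝓡 m) (∞ + 1) B := by simpa using! (inferInstance : IsManifold (𝓡 m) ∞ B)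
  have h0 : ContMDiff 𝓘(ℝ, ℝ) 𝓘(ℝ, ℝ).tangent ∞
      (fun v : ℝ ↦ (⟨v, (1 : ℝ)⟩ : TangentBundle 𝓘(ℝ, ℝ) ℝ)) := by
    exact contMDiff_vectorSpace_iff_contDiff.2 contDiff_const
  have h1 : ContMDiff (model m) ((𝓡 m).tangent.prod 𝓘(ℝ, ℝ).tangent) ∞
      (fun p : B × ℝ ↦ ((⟨p.1, 0⟩ : TangentBundle (𝓡 m) B),
        (⟨p.2, (1 : ℝ)⟩ : TangentBundle 𝓘(ℝ, ℝ) ℝ))) :=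
    ((Bundle.contMDiff_zeroSection ℝ (TangentSpace (𝓡 m) : B → Type _)).comp
      contMDiff_fst).prodMk (h0.comp contMDiff_snd)
  exact contMDiff_equivTangentBundleProd_symm.comp h1

/-- The part along `B` of a smooth field on `B × ℝ`, on the slice `B × {v}`. -/
theorem SmoothField.hor_slice {W : VField (model m) (B × ℝ)} (hW : SmoothField (model m) W) (v : ℝ) :
    SmoothField (𝓡 m) (fun x ↦ hor (W (x, v))) := by
  have : IsManifold (𝓡 m) (∞ + 1) B := by simpa using! (inferInstance : IsManifold (𝓡 m) ∞ B)
  have h1 : ContMDiff (𝓡 m) ((𝓡 m).tangent.prod 𝓘(ℝ, ℝ).tangent) ∞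
      (fun x : B ↦ equivTangentBundleProd (𝓡 m) B 𝓘(ℝ, ℝ) ℝ ⟨(x, v), W (x, v)⟩) :=
    contMDiff_equivTangentBundleProd.comp (ContMDiff.comp hW (contMDiff_id.prodMk contMDiff_const))
  exact contMDiff_fst.comp h1

theorem along_snd (W : VField (model m) (B × ℝ)) :
    along (model m) W Prod.snd = fun p ↦ ver (W p) := funext fun _ ↦ mvfderiv_snd _

theorem SmoothField.smoothFn_ver {W : VField (model m) (B × ℝ)} (hW : SmoothField (model m) W) :
    SmoothFn (model m) (fun p ↦ ver (W p)) := by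
  rw [← along_snd]; exact smoothFn_along hW smoothFn_snd

theorem along_comp_fst (W : VField (model m) (B × ℝ)) {f : B → ℝ} (hf : SmoothFn (𝓡 m) f) :
    along (model m) W (fun p ↦ f p.1) = fun p ↦ mvfderiv (𝓡 m) f p.1 (hor (W p)) :=
  funext fun _ ↦ mvfderiv_comp_fst _ hf

theorem along_liftField_comp_fst (Y : VField (𝓡 m) B) {f : B → ℝ} (hf : SmoothFn (𝓡 m) f) :
    along (model m) (liftField Y) (fun p ↦ f p.1) = fun p ↦ along (𝓡 m) Y f p.1 :=
  along_comp_fst _ hf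

theorem along_vertical_comp_fst {f : B → ℝ} (hf : SmoothFn (𝓡 m) f) :
    along (model m) (vertical m B) (fun p ↦ f p.1) = 0 := by
  rw [along_comp_fst _ hf]; funext p; simp

theorem hasDerivAt_along_vertical {f : B × ℝ → ℝ} (hf : SmoothFn (model m) f) (x : B) (v : ℝ) :
    HasDerivAt (fun v ↦ f (x, v)) (along (model m) (vertical m B) f (x, v)) v := by
  have h1 : MDifferentiableAt 𝓘(ℝ, ℝ) (model m) (fun v : ℝ ↦ (x, v)) v :=
    mdifferentiableAt_const.prodMk mdifferentiableAt_id
  have h2 : MDifferentiableAt 𝓘(ℝ, ℝ) 𝓘(ℝ, ℝ) (fun v ↦ f (x, v)) v :=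
    MDifferentiableAt.comp v (hf.mdiff (x, v)) h1
  have h3 : deriv (fun v ↦ f (x, v)) v = along (model m) (vertical m B) f (x, v) := ?_
  · rw [← h3]; exact h2.differentiableAt.hasDerivAt
  rw [← fderiv_apply_one_eq_deriv]
  have h4 := mfderiv_comp_apply v (hf.mdiff (x, v)) h1 (1 : ℝ)
  rw [mfderiv_prod_right] at h4
  have h5 : mfderiv 𝓘(ℝ, ℝ) 𝓘(ℝ, ℝ) (fun v ↦ f (x, v)) v = fderiv ℝ (fun v ↦ f (x, v)) v :=
    mfderiv_eq_fderiv
  rw [← h5]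
  exact h4

theorem along_vertical_eq_deriv {f : B × ℝ → ℝ} (hf : SmoothFn (model m) f) (p : B × ℝ) :
    along (model m) (vertical m B) f p = deriv (fun v ↦ f (p.1, v)) p.2 :=
  (hasDerivAt_along_vertical hf p.1 p.2).deriv.symm

/-- A function whose derivative along the fibres vanishes is constant along them. -/
theorem eq_of_along_vertical_eq_zero {f : B × ℝ → ℝ} (hf : SmoothFn (model m) f)
    (h : ∀ p, along (model m) (vertical m B) f p = 0) (x : B) (v v' : ℝ) : f (x, v) = f (x, v') :=
  is_const_of_deriv_eq_zero (f := fun v ↦ f (x, v))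
    (fun v ↦ (hasDerivAt_along_vertical hf x v).differentiableAt)
    (fun v ↦ by rw [(hasDerivAt_along_vertical hf x v).deriv, h]) v v'

variable [T2Space B]

variable {X Y : VField (model m) (B × ℝ)}

theorem ver_bracket (hX : SmoothField (model m) X) (hY : SmoothField (model m) Y) (p : B × ℝ) :
    ver (bracket (model m) X Y p) =
      along (model m) X (fun p ↦ ver (Y p)) p - along (model m) Y (fun p ↦ ver (X p)) p := by
  have := congrFun (along_bracket hX hY smoothFn_snd) p
  simpa only [along_snd] using! this

theorem hor_bracket_apply (hX : SmoothField (model m) X) (hY : SmoothField (model m) Y) (p : B × ℝ)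
    {f : B → ℝ} (hf : SmoothFn (𝓡 m) f) :
    mvfderiv (𝓡 m) f p.1 (hor (bracket (model m) X Y p)) =
      along (model m) X (along (model m) Y (fun p ↦ f p.1)) p -
      along (model m) Y (along (model m) X (fun p ↦ f p.1)) p := by
  rw [← mvfderiv_comp_fst _ hf]
  exact congrFun (along_bracket hX hY (smoothFn_comp_fst hf)) p

theorem bracket_liftField {Y Z : VField (𝓡 m) B} (hY : SmoothField (𝓡 m) Y)
    (hZ : SmoothField (𝓡 m) Z) :
    bracket (model m) (liftField Y) (liftField Z) = liftField (bracket (𝓡 m) Y Z) := by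
  funext p
  refine tangent_prod_ext (tangent_ext (I := 𝓡 m) fun f hf ↦ ?_) ?_
  · rw [hor_bracket_apply hY.liftField hZ.liftField p hf, along_liftField_comp_fst _ hf,
      along_liftField_comp_fst _ hf, along_liftField_comp_fst _ (smoothFn_along hZ hf),
      along_liftField_comp_fst _ (smoothFn_along hY hf)]
    exact (congrFun (along_bracket hY hZ hf) p.1).symm
  · rw [ver_bracket hY.liftField hZ.liftField]
    simp [along_const]

theorem bracket_vertical_liftField {Y : VField (𝓡 m) B} (hY : SmoothField (𝓡 m) Y) :
    bracket (model m) (vertical m B) (liftField Y) = 0 := by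
  funext p
  refine tangent_prod_ext (tangent_ext (I := 𝓡 m) fun f hf ↦ ?_) ?_
  · rw [hor_bracket_apply smoothField_vertical hY.liftField p hf, along_liftField_comp_fst _ hf,
      along_vertical_comp_fst hf, along_vertical_comp_fst (smoothFn_along hY hf)]
    have := congrFun (along_const (I := model m) (X := liftField Y) 0) p
    simpa using! this
  · rw [ver_bracket smoothField_vertical hY.liftField]
    simp [along_const]

theorem bracket_self (X : VField (model m) (B × ℝ)) : bracket (model m) X X = 0 :=
  VectorField.mlieBracket_self

end ProductToolkit

section LocalDiffeo

variable {E : Type*} [NormedAddCommGroup E] [NormedSpace ℝ E] [FiniteDimensional ℝ E]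
  {H : Type*} [TopologicalSpace H]
  {I : ModelWithCorners ℝ E H} {M : Type*} [TopologicalSpace M] [ChartedSpace H M]
  [IsManifold I ∞ M] [T2Space M]
  {E' : Type*} [NormedAddCommGroup E'] [NormedSpace ℝ E'] [FiniteDimensional ℝ E'] {H' : Type*}
  [TopologicalSpace H'] {I' : ModelWithCorners ℝ E' H'} {N : Type*} [TopologicalSpace N]
  [ChartedSpace H' N] [IsManifold I' ∞ N] [T2Space N]
  {j : N → M}

theorem isInvertible_mfderiv_of_isLocalDiffeomorph (hj : IsLocalDiffeomorph I' I ∞ j) (p : N) :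
    (mfderiv I' I j p).IsInvertible :=
  ⟨hj.mfderivToContinuousLinearEquiv (by simp) p, rfl⟩

theorem SmoothField.mpullback {W : VField I M} (hW : SmoothField I W)
    (hj : IsLocalDiffeomorph I' I ∞ j) : SmoothField I' (VectorField.mpullback I' I j W) := by
  have : IsManifold I (((⊤ : ℕ∞) : ℕ∞ω) + 1) M := by simpa using! (inferInstance : IsManifold I ∞ M)
  have : IsManifold I' (((⊤ : ℕ∞) : ℕ∞ω) + 1) N := by
    simpa using! (inferInstance : IsManifold I' ∞ N)
  exact ContMDiff.mpullback_vectorField hW hj.contMDiff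
    (isInvertible_mfderiv_of_isLocalDiffeomorph hj) (by simp)

theorem mfderiv_mpullback (hj : IsLocalDiffeomorph I' I ∞ j) (W : VField I M) (p : N) :
    mfderiv I' I j p (VectorField.mpullback I' I j W p) = W (j p) :=
  (isInvertible_mfderiv_of_isLocalDiffeomorph hj p).self_apply_inverse _

theorem relatedNear_mpullback (hj : IsLocalDiffeomorph I' I ∞ j) (W : VField I M) (p : N) :
    RelatedNear j p (VectorField.mpullback I' I j W) W :=
  Filter.Eventually.of_forall fun r ↦ (mfderiv_mpullback hj W r).symm

theorem RelatedNear.lieConn {D' : Connection I M} {D : Connection I' N} {p : N}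
    {X Y Z : VField I' N} {X' Y' Z' : VField I M} (hj : ContMDiff I' I ∞ j)
    (hD : IsInduced j D' D) (hDs : SmoothConnection D) (hDs' : SmoothConnection D')
    (hX : SmoothField I' X) (hY : SmoothField I' Y) (hZ : SmoothField I' Z)
    (hX' : SmoothField I X') (hY' : SmoothField I Y') (hZ' : SmoothField I Z')
    (h1 : RelatedNear j p X X') (h2 : RelatedNear j p Y Y') (h3 : RelatedNear j p Z Z') :
    RelatedNear j p (lieConn X D Y Z) (lieConn X' D' Y' Z') := by
  rw [lieConn_eq, lieConn_eq]
  exact ((h1.bracket hj hX (hY.nabla hDs hZ) hX' (hY'.nabla hDs' hZ')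
    (h2.nabla hD hZ hZ' h3)).sub ((h1.bracket hj hX hY hX' hY' h2).nabla hD hZ hZ' h3)).sub
    (h2.nabla hD (hX.bracket hZ) (hX'.bracket hZ') (h1.bracket hj hX hZ hX' hZ' h3))

end LocalDiffeo

section BasicFields

variable {m : ℕ} {B : Type*} [TopologicalSpace B] [ChartedSpace (EuclideanSpace ℝ (Fin m)) B]
  [IsManifold (𝓡 m) ∞ B]

/-- The vector field on `B × ℝ` with components `Y` along `B` and the constant `a` along `ℝ`. -/
def basicField (Y : VField (𝓡 m) B) (a : ℝ) : VField (model m) (B × ℝ) :=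
  liftField Y + a • vertical m B

theorem basicField_apply (Y : VField (𝓡 m) B) (a : ℝ) (p : B × ℝ) :
    basicField Y a p = tvec p (Y p.1) a := tangent_prod_ext (by simp [basicField])
      (by simp [basicField])

@[simp] theorem hor_basicField (Y : VField (𝓡 m) B) (a : ℝ) (p : B × ℝ) :
    hor (basicField Y a p) = Y p.1 := by simp [basicField]

@[simp] theorem ver_basicField (Y : VField (𝓡 m) B) (a : ℝ) (p : B × ℝ) :
    ver (basicField Y a p) = a := by simp [basicField]

theorem basicField_zero (Y : VField (𝓡 m) B) : basicField Y 0 = liftField Y := by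
  simp [basicField]

theorem basicField_one : basicField (0 : VField (𝓡 m) B) 1 = vertical m B := by
  funext p; exact tangent_prod_ext (by simp) (by simp)

theorem SmoothField.basicField {Y : VField (𝓡 m) B} (hY : SmoothField (𝓡 m) Y) (a : ℝ) :
    SmoothField (model m) (basicField Y a) := hY.liftField.add (smoothField_vertical.const_smul a)

theorem along_basicField_comp_fst (Y : VField (𝓡 m) B) (a : ℝ) {f : B → ℝ}
    (hf : SmoothFn (𝓡 m) f) :
    along (model m) (basicField Y a) (fun p ↦ f p.1) = fun p ↦ along (𝓡 m) Y f p.1 := by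
  rw [along_comp_fst _ hf]; simp [along]

variable [T2Space B]

theorem exists_basicField_apply (p : B × ℝ) (u : TangentSpace (model m) p) :
    ∃ Y : VField (𝓡 m) B, SmoothField (𝓡 m) Y ∧ basicField Y (ver u) p = u := by
  obtain ⟨Y, hY, h⟩ := exists_smoothField_apply (I := 𝓡 m) p.1 (hor u)
  exact ⟨Y, hY, tangent_prod_ext (by simp [h]) (by simp)⟩

theorem bracket_basicField {Y Z : VField (𝓡 m) B} (hY : SmoothField (𝓡 m) Y)
    (hZ : SmoothField (𝓡 m) Z) (a b : ℝ) :
    bracket (model m) (basicField Y a) (basicField Z b) = liftField (bracket (𝓡 m) Y Z) := by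
  have hv := smoothField_vertical (m := m) (B := B)
  have h1 : bracket (model m) (liftField Y) (vertical m B) = 0 := by
    rw [bracket_swap, bracket_vertical_liftField hY, neg_zero]
  simp only [basicField]
  rw [bracket_add_left hY.liftField (hv.const_smul a),
    bracket_add_right hZ.liftField (hv.const_smul b),
    bracket_add_right hZ.liftField (hv.const_smul b), bracket_const_smul_right b hv,
    bracket_const_smul_left a hv, bracket_const_smul_left a hv, bracket_const_smul_right b hv, h1,
    bracket_vertical_liftField hZ, bracket_self, bracket_liftField hY hZ]
  simp

end BasicFields

section Extension

variable {m : ℕ} {B : Type*} [TopologicalSpace B] [T2Space B]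
  [ChartedSpace (EuclideanSpace ℝ (Fin m)) B] [IsManifold (𝓡 m) ∞ B]

namespace MaximalAnalyticExtension

section General

variable {q : BilinField (model m) (B × ℝ)} {D : Connection (model m) (B × ℝ)}
  (A : MaximalAnalyticExtension q D)

/-- The pull-back to the horizon of a vector field of the extension. -/
abbrev pull (W : VField (model m) (B × ℝ)) : VField (model m) (B × ℝ) :=
  VectorField.mpullback (model m) (model m) A.incl W

theorem contMDiff_incl : ContMDiff (model m) (model m) ∞ A.incl := A.incl_localDiffeo.contMDiff

theorem mfderiv_injective (p : B × ℝ) :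
    Function.Injective (mfderiv (model m) (model m) A.incl p) :=
  (isInvertible_mfderiv_of_isLocalDiffeomorph A.incl_localDiffeo p).injective

theorem mfderiv_surjective (p : B × ℝ) :
    Function.Surjective (mfderiv (model m) (model m) A.incl p) :=
  (isInvertible_mfderiv_of_isLocalDiffeomorph A.incl_localDiffeo p).surjective

theorem smooth_pull {W : VField (model m) (B × ℝ)} (hW : SmoothField (model m) W) :
    SmoothField (model m) (A.pull W) := hW.mpullback A.incl_localDiffeo

theorem mfderiv_pull (W : VField (model m) (B × ℝ)) (p : B × ℝ) :
    mfderiv (model m) (model m) A.incl p (A.pull W p) = W (A.incl p) :=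
  mfderiv_mpullback A.incl_localDiffeo W p

theorem related_pull (W : VField (model m) (B × ℝ)) (p : B × ℝ) :
    RelatedNear A.incl p (A.pull W) W := relatedNear_mpullback A.incl_localDiffeo W p

theorem hor_mfderiv (p : B × ℝ) (u : TangentSpace (model m) p) :
    hor (mfderiv (model m) (model m) A.incl p u) = (hor u : EuclideanSpace ℝ (Fin m)) := by
  have h1 : (Prod.fst ∘ A.incl : B × ℝ → B) = Prod.fst := funext A.incl_fst
  have h2 := mfderiv_comp_apply (I := model m) (I' := model m) (I'' := 𝓡 m) p
    (mdifferentiableAt_fst (I := 𝓡 m) (I' := 𝓘(ℝ, ℝ)) (x := A.incl p))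
    ((A.contMDiff_incl p).mdifferentiableAt (by simp)) u
  rw [h1, mfderiv_fst, mfderiv_fst] at h2
  exact h2.symm

theorem hor_pull (W : VField (model m) (B × ℝ)) (p : B × ℝ) :
    hor (A.pull W p) = (hor (W (A.incl p)) : EuclideanSpace ℝ (Fin m)) := by
  rw [← A.hor_mfderiv p, A.mfderiv_pull]

theorem mfderiv_vertical (p : B × ℝ) :
    ∃ c : ℝ, c ≠ 0 ∧ mfderiv (model m) (model m) A.incl p (vertical m B p) =
      c • vertical m B (A.incl p) := by
  have h1 := eq_smul_vertical_of_hor_eq_zero (A.hor_mfderiv p (vertical m B p))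
  refine ⟨_, fun h0 ↦ ?_, h1⟩
  rw [h0, zero_smul] at h1
  exact NonExpandingHorizon.vertical_ne_zero p (A.mfderiv_injective p (by rw [h1, map_zero]))

theorem isOpen_range : IsOpen (Set.range A.incl) := A.incl_localDiffeo.isOpen_range

/-- Identity theorem along the null curves. -/
theorem eq_of_analytic {F : Type*} [NormedAddCommGroup F] [NormedSpace ℝ F] {f g : ℝ → F}
    (hf : AnalyticOnNhd ℝ f Set.univ) (hg : AnalyticOnNhd ℝ g Set.univ) (x : B)
    (h : ∀ v p, A.incl p = (x, v) → f v = g v) : f = g := by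
  refine hf.eq_of_eventuallyEq hg (z₀ := (A.incl (x, 0)).2) ?_
  have h1 : Filter.Tendsto (fun v : ℝ ↦ (x, v)) (𝓝 (A.incl (x, 0)).2) (𝓝 (A.incl (x, 0))) := by
    have h2 : A.incl (x, 0) = (x, (A.incl (x, 0)).2) := Prod.ext (A.incl_fst (x, 0)) rfl
    conv_rhs => rw [h2]
    exact (Continuous.prodMk_right x).tendsto _
  filter_upwards [h1 (A.isOpen_range.mem_nhds (Set.mem_range_self _))] with v ⟨p, hp⟩
  exact h v p hp

theorem analytic_nabla {Y Z : VField (𝓡 m) B} (hZ : SmoothField (𝓡 m) Z) (a b : ℝ) (x : B) :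
    AnalyticOnNhd ℝ (fun v : ℝ ↦ (show EuclideanSpace ℝ (Fin m) × ℝ from
      nabla A.DExt (basicField Y a) (basicField Z b) (x, v))) Set.univ := by
  have := A.analytic_D (basicField Z b) (hZ.basicField b) (fun x v v' ↦ by simp) x (Y x, a)
  simp only [nabla, basicField_apply]
  exact this

theorem restrict_q_apply (p : B × ℝ) (u w : TangentSpace (model m) p) :
    A.qExt (A.incl p) (mfderiv (model m) (model m) A.incl p u)
      (mfderiv (model m) (model m) A.incl p w) = q p u w := by
  rw [← A.restrict_q p]; rfl

end General

section Horizon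

variable {M : Type*} [TopologicalSpace M] [T2Space M]
    [ChartedSpace (EuclideanSpace ℝ (Fin (m + 2))) M] [IsManifold (𝓡 (m + 2)) ∞ M]
    {S : Spacetime m M} {h : NonExpandingHorizon S B} (A : MaximalAnalyticExtension h.q h.D)

theorem qExt_vertical (p : B × ℝ) (u : TangentSpace (model m) p) :
    A.qExt p (vertical m B p) u = 0 := by
  have h1 := A.eq_of_analytic (A.analytic_q p.1 (0, 1) (hor u, ver u)) analyticOnNhd_const p.1
    (g := fun _ ↦ (0 : ℝ)) (fun v r hr ↦ by
      obtain ⟨c, hc, hv⟩ := A.mfderiv_vertical r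
      rw [← hr]
      obtain ⟨w, hw⟩ := A.mfderiv_surjective r (tvec (A.incl r) (hor u) (ver u))
      change A.qExt (A.incl r) (vertical m B (A.incl r)) _ = 0
      have h2 : h.q r (vertical m B r) w = 0 := h.null_generators r w
      rw [← A.restrict_q_apply, hv, hw, map_smul, smul_apply, smul_eq_mul] at h2
      exact (mul_eq_zero.1 h2).resolve_left hc)
  exact congrFun h1 p.2

theorem qExt_symm (p : B × ℝ) (u w : TangentSpace (model m) p) :
    A.qExt p u w = A.qExt p w u := by
  have h1 := A.eq_of_analytic (A.analytic_q p.1 (hor u, ver u) (hor w, ver w))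
    (A.analytic_q p.1 (hor w, ver w) (hor u, ver u)) p.1
    (fun v r hr ↦ by
      rw [← hr]
      obtain ⟨u', hu⟩ := A.mfderiv_surjective r (tvec (A.incl r) (hor u) (ver u))
      obtain ⟨w', hw⟩ := A.mfderiv_surjective r (tvec (A.incl r) (hor w) (ver w))
      change A.qExt (A.incl r) (tvec (A.incl r) (hor u) (ver u))
        (tvec (A.incl r) (hor w) (ver w)) = A.qExt (A.incl r) (tvec (A.incl r) (hor w) (ver w))
        (tvec (A.incl r) (hor u) (ver u))
      rw [← hu, ← hw, A.restrict_q_apply, A.restrict_q_apply, h.q_symm])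
  exact congrFun h1 p.2

theorem q_pull_vertical (p : B × ℝ) (u : TangentSpace (model m) p) :
    h.q p (A.pull (vertical m B) p) u = 0 := by
  rw [← A.restrict_q_apply, A.mfderiv_pull, A.qExt_vertical]

theorem along_vertical_qExt {Y Z : VField (𝓡 m) B} (hY : SmoothField (𝓡 m) Y)
    (hZ : SmoothField (𝓡 m) Z) (p : B × ℝ) : along (model m) (vertical m B)
      (fun p ↦ A.qExt p (liftField Y p) (liftField Z p)) p = 0 := by
  have hv := smoothField_vertical (m := m) (B := B)
  have hs : SmoothFn (model m) (fun p ↦ A.qExt p (liftField Y p) (liftField Z p)) :=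
    A.smooth_qExt.smoothFn hY.liftField hZ.liftField
  have han : AnalyticOnNhd ℝ (fun v : ℝ ↦ A.qExt (p.1, v) (liftField Y (p.1, v))
    (liftField Z (p.1, v))) Set.univ := A.analytic_q p.1 (Y p.1, 0) (Z p.1, 0)
  have h1 := A.eq_of_analytic han.deriv analyticOnNhd_const p.1
    (g := fun _ ↦ (0 : ℝ)) (fun v r hr ↦ by
      rw [(hasDerivAt_along_vertical hs p.1 v).deriv, ← hr]
      have hlc := h.isLeviCivita
      have sv := A.smooth_pull hv
      have sY := A.smooth_pull hY.liftField
      have sZ := A.smooth_pull hZ.liftField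
      have hdeg : ∀ {W : VField (model m) (B × ℝ)}, SmoothField (model m) W →
          ∀ Z, SmoothField (model m) Z → ∀ p,
            h.q p (nabla h.D W (A.pull (vertical m B)) p) (Z p) = 0 := fun hW ↦
        hlc.nabla_degenerate sv (fun W _ p ↦ A.q_pull_vertical p (W p)) hW
      have hbr : ∀ {W : VField (𝓡 m) B}, SmoothField (𝓡 m) W →
          nabla h.D (A.pull (vertical m B)) (A.pull (liftField W)) r =
          nabla h.D (A.pull (liftField W)) (A.pull (vertical m B)) r := by
        intro W hW
        have e1 := congrFun (hlc.torsion sv (A.smooth_pull hW.liftField)) r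
        have e2 := ((A.related_pull (vertical m B) r).bracket A.contMDiff_incl sv
          (A.smooth_pull hW.liftField) hv hW.liftField (A.related_pull _ r)).self_of_nhds
        rw [bracket_vertical_liftField hW] at e2
        have e3 : bracket (model m) (A.pull (vertical m B)) (A.pull (liftField W)) r = 0 :=
          A.mfderiv_injective r (by rw [← e2, map_zero]; rfl)
        rw [e3] at e1
        exact sub_eq_zero.1 e1
      have e4 := hlc.metric sv sY sZ r
      rw [hbr hY, hbr hZ, hdeg sY _ sZ, h.q_symm, hdeg sZ _ sY, add_zero] at e4
      have e5 := ((A.related_pull (vertical m B) r).along A.contMDiff_incl hs).self_of_nhds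
      rw [Function.comp_apply] at e5
      rw [e5, ← e4]
      congr 1
      funext y
      rw [Function.comp_apply, ← A.mfderiv_pull (liftField Y), ← A.mfderiv_pull (liftField Z),
        A.restrict_q_apply])
  rw [along_vertical_eq_deriv hs]
  exact congrFun h1 p.2

/-- The extended degenerate metric is the pull-back of the metric of the base. -/
theorem qExt_apply (p : B × ℝ) (u w : TangentSpace (model m) p) :
    A.qExt p u w = baseMetric A.qExt p.1 (hor u) (hor w) := by
  have hb : baseMetric A.qExt p.1 (hor u) (hor w) =
      A.qExt (p.1, 0) (tvec (p.1, 0) (hor u) 0) (tvec (p.1, 0) (hor w) 0) := by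
    have : mfderiv (𝓡 m) (model m) (fun x : B ↦ (x, (0 : ℝ))) p.1 = _ := mfderiv_prod_left
    change A.qExt (p.1, 0) (mfderiv (𝓡 m) (model m) (fun x : B ↦ (x, (0 : ℝ))) p.1 (hor u))
      (mfderiv (𝓡 m) (model m) (fun x : B ↦ (x, (0 : ℝ))) p.1 (hor w)) = _
    rw [this]; rfl
  have hsplit : ∀ u : TangentSpace (model m) p, u = tvec p (hor u) 0 + ver u • vertical m B p :=
    fun u ↦ tangent_prod_ext (by simp) (by simp)
  have h0 : A.qExt p u w = A.qExt p (tvec p (hor u) 0) (tvec p (hor w) 0) := by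
    conv_lhs => rw [hsplit u, hsplit w]
    simp only [map_add, add_apply, map_smul, smul_apply, A.qExt_vertical,
      A.qExt_symm p _ (vertical m B p)]
    simp
  obtain ⟨Y, hY, hYp⟩ := exists_smoothField_apply (I := 𝓡 m) p.1 (hor u)
  obtain ⟨Z, hZ, hZp⟩ := exists_smoothField_apply (I := 𝓡 m) p.1 (hor w)
  have h1 := eq_of_along_vertical_eq_zero (A.smooth_qExt.smoothFn hY.liftField hZ.liftField)
    (A.along_vertical_qExt hY hZ) p.1 p.2 0
  simp only [liftField, hYp, hZp] at h1
  exact h0.trans (h1.trans hb.symm)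

theorem baseMetric_eq : baseMetric h.q = baseMetric A.qExt := by
  have key : ∀ x (u w : TangentSpace (𝓡 m) x),
      baseMetric h.q x u w = baseMetric A.qExt x u w := by
    intro x u w
    have : mfderiv (𝓡 m) (model m) (fun x : B ↦ (x, (0 : ℝ))) x = _ := mfderiv_prod_left
    change h.q (x, 0) (mfderiv (𝓡 m) (model m) (fun x : B ↦ (x, (0 : ℝ))) x u)
      (mfderiv (𝓡 m) (model m) (fun x : B ↦ (x, (0 : ℝ))) x w) = _
    rw [this]
    change h.q (x, 0) (tvec (x, 0) u 0) (tvec (x, 0) w 0) = _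
    rw [← A.restrict_q_apply, A.qExt_apply, A.hor_mfderiv, A.hor_mfderiv]
    have h1 := A.incl_fst (x, 0)
    generalize A.incl (x, 0) = r at h1
    subst h1
    rfl
  funext x
  exact ContinuousLinearMap.ext fun u ↦ ContinuousLinearMap.ext fun w ↦ key x u w

theorem q_apply (p : B × ℝ) (u w : TangentSpace (model m) p) :
    h.q p u w = baseMetric A.qExt p.1 (hor u) (hor w) := by
  rw [← A.restrict_q_apply, A.qExt_apply, A.hor_mfderiv, A.hor_mfderiv]
  have h1 := A.incl_fst p
  generalize A.incl p = r at h1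
  obtain ⟨x, v⟩ := p
  obtain ⟨y, s⟩ := r
  obtain rfl : y = x := h1
  rfl

end Horizon

end MaximalAnalyticExtension

end Extension

section LeviCivitaTensorial

variable {E : Type*} [NormedAddCommGroup E] [NormedSpace ℝ E] [FiniteDimensional ℝ E]
  {H : Type*} [TopologicalSpace H]
  {I : ModelWithCorners ℝ E H} {M : Type*} [TopologicalSpace M] [ChartedSpace H M]
  [IsManifold I ∞ M] [T2Space M] {q : BilinField I M} {D : Connection I M}

/-- A connection is the Levi-Civita connection if this holds on a class of fields which take all
values. -/
theorem isLeviCivita_of_class {P : VField I M → Prop} (hP : ∀ Y, P Y → SmoothField I Y)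
    (hP' : ∀ (p : M) (u : TangentSpace I p), ∃ Y, P Y ∧ Y p = u) (hD : SmoothConnection D)
    (hq : SmoothOnFields q)
    (ht : ∀ Y Z, P Y → P Z → ∀ p, nabla D Y Z p - nabla D Z Y p = bracket I Y Z p)
    (hm : ∀ X Y Z, P X → P Y → P Z → ∀ p, along I X (fun y ↦ q y (Y y) (Z y)) p =
      q p (nabla D X Y p) (Z p) + q p (Y p) (nabla D X Z p)) : IsLeviCivita q D := by
  refine ⟨hD, fun Y Z hY hZ p ↦ ?_, fun X Y Z hX hY hZ p ↦ ?_⟩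
  · obtain ⟨Y1, hY1, hYp⟩ := hP' p (Y p)
    obtain ⟨Z1, hZ1, hZp⟩ := hP' p (Z p)
    let Φ : VField I M → VField I M → TangentSpace I p := fun Y Z ↦
      (nabla D Y Z - nabla D Z Y - bracket I Y Z) p
    have e1 : Φ Y Z = Φ Y1 Z := by
      refine congr_of_tensorial (Φ := fun Y ↦ Φ Y Z) (fun f Y hf hY ↦ ?_) (fun Y Y' hY hY' ↦ ?_)
        hY (hP _ hY1) hYp.symm
      · simp only [Φ, nabla_smul_left, nabla_smul_right hf hY, bracket_smul_left hf hY]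
        simp only [Pi.sub_apply, Pi.add_apply, Pi.smul_apply']
        module
      · simp only [Φ, nabla_add_left, nabla_add_right hY hY', bracket_add_left hY hY']
        simp only [Pi.sub_apply, Pi.add_apply]
        abel
    have e2 : Φ Y1 Z = Φ Y1 Z1 := by
      refine congr_of_tensorial (Φ := fun Z ↦ Φ Y1 Z) (fun f Z hf hZ ↦ ?_) (fun Z Z' hZ hZ' ↦ ?_)
        hZ (hP _ hZ1) hZp.symm
      · simp only [Φ, nabla_smul_left, nabla_smul_right hf hZ, bracket_smul_right hf hZ]
        simp only [Pi.sub_apply, Pi.add_apply, Pi.smul_apply']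
        module
      · simp only [Φ, nabla_add_left, nabla_add_right hZ hZ', bracket_add_right hZ hZ']
        simp only [Pi.sub_apply, Pi.add_apply]
        abel
    have e3 : Φ Y1 Z1 = 0 := sub_eq_zero.2 (ht Y1 Z1 hY1 hZ1 p)
    exact sub_eq_zero.1 (e1.trans (e2.trans e3))
  · obtain ⟨X1, hX1, hXp⟩ := hP' p (X p)
    obtain ⟨Y1, hY1, hYp⟩ := hP' p (Y p)
    obtain ⟨Z1, hZ1, hZp⟩ := hP' p (Z p)
    let Φ : VField I M → VField I M → ℝ := fun Y Z ↦ along I X (fun y ↦ q y (Y y) (Z y)) p -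
      q p (nabla D X Y p) (Z p) - q p (Y p) (nabla D X Z p)
    have e1 : Φ Y Z = Φ Y1 Z := by
      refine congr_of_tensorial (Φ := fun Y ↦ Φ Y Z) (fun f Y hf hY ↦ ?_) (fun Y Y' hY hY' ↦ ?_)
        hY (hP _ hY1) hYp.symm
      · have : (fun y ↦ q y ((f • Y) y) (Z y)) = f * fun y ↦ q y (Y y) (Z y) := by
          funext y; simp
        simp only [Φ, this, along_mul hf (hq.smoothFn hY hZ), nabla_smul_right hf hY]
        simp only [Pi.add_apply, Pi.mul_apply, Pi.smul_apply', map_add, map_smul, add_apply,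
          smul_apply, smul_eq_mul]
        ring
      · have : (fun y ↦ q y ((Y + Y') y) (Z y)) =
            (fun y ↦ q y (Y y) (Z y)) + fun y ↦ q y (Y' y) (Z y) := by
          funext y; simp
        simp only [Φ, this, along_add (hq.smoothFn hY hZ) (hq.smoothFn hY' hZ),
          nabla_add_right hY hY']
        simp only [Pi.add_apply, map_add, add_apply]
        ring
    have e2 : Φ Y1 Z = Φ Y1 Z1 := by
      have hY := hP _ hY1
      refine congr_of_tensorial (Φ := fun Z ↦ Φ Y1 Z) (fun f Z hf hZ ↦ ?_) (fun Z Z' hZ hZ' ↦ ?_)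
        hZ (hP _ hZ1) hZp.symm
      · have : (fun y ↦ q y (Y1 y) ((f • Z) y)) = f * fun y ↦ q y (Y1 y) (Z y) := by
          funext y; simp
        simp only [Φ, this, along_mul hf (hq.smoothFn hY hZ), nabla_smul_right hf hZ]
        simp only [Pi.add_apply, Pi.mul_apply, Pi.smul_apply', map_add, map_smul,
          smul_eq_mul]
        ring
      · have : (fun y ↦ q y (Y1 y) ((Z + Z') y)) =
            (fun y ↦ q y (Y1 y) (Z y)) + fun y ↦ q y (Y1 y) (Z' y) := by
          funext y; simp
        simp only [Φ, this, along_add (hq.smoothFn hY hZ) (hq.smoothFn hY hZ'),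
          nabla_add_right hZ hZ']
        simp only [Pi.add_apply, map_add]
        ring
    have e3 : Φ Y1 Z1 = 0 := by
      have := hm X1 Y1 Z1 hX1 hY1 hZ1 p
      simp only [along, hXp, nabla] at this
      simp only [Φ, along, nabla, this]
      ring
    have e4 : Φ Y Z = 0 := e1.trans (e2.trans e3)
    simp only [Φ] at e4
    linarith

end LeviCivitaTensorial

section Extension

variable {m : ℕ} {B : Type*} [TopologicalSpace B] [T2Space B]
  [ChartedSpace (EuclideanSpace ℝ (Fin m)) B] [IsManifold (𝓡 m) ∞ B]

/-- The properties of the extended horizon geometry `(q, D)` on `B × ℝ` with base metric `g`: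
`q` is the pull-back of `g`, and the rotation 1-form potential of the vertical field is the
pull-back of `r`. -/
structure IsStationaryGeometry (g : BilinField (𝓡 m) B) (r : CovField (𝓡 m) B)
    (q : BilinField (model m) (B × ℝ)) (D : Connection (model m) (B × ℝ)) : Prop where
  symm : ∀ x u w, g x u w = g x w u
  nonneg : ∀ x u, 0 ≤ g x u u
  definite : ∀ x u, g x u u = 0 → u = 0
  smooth_g : SmoothOnFields g
  smooth_q : SmoothOnFields q
  q_apply : ∀ p u w, q p u w = g p.1 (hor u) (hor w)
  leviCivita : IsLeviCivita q D
  nabla_vertical : ∀ p u, D (vertical m B) p u = r p.1 (hor u) • vertical m B p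
  analytic : ∀ Y Z, SmoothField (𝓡 m) Y → SmoothField (𝓡 m) Z → ∀ x,
    AnalyticOnNhd ℝ (fun v : ℝ ↦ (show EuclideanSpace ℝ (Fin m) × ℝ from
      nabla D (liftField Y) (liftField Z) (x, v))) Set.univ

namespace MaximalAnalyticExtension

variable {M : Type*} [TopologicalSpace M] [T2Space M]
    [ChartedSpace (EuclideanSpace ℝ (Fin (m + 2))) M] [IsManifold (𝓡 (m + 2)) ∞ M]
    {S : Spacetime m M} {h : NonExpandingHorizon S B} (A : MaximalAnalyticExtension h.q h.D)

theorem baseMetric_tvec (A : MaximalAnalyticExtension h.q h.D) (x : B) (v : ℝ) (u w : TangentSpace (𝓡 m) x) :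
    baseMetric h.q x u w = h.q (x, v) (tvec (x, v) u 0) (tvec (x, v) w 0) := by
  rw [A.baseMetric_eq, A.q_apply]; rfl

theorem baseMetric_qExt_tvec (A : MaximalAnalyticExtension h.q h.D) (x : B) (v : ℝ) (u w : TangentSpace (𝓡 m) x) :
    baseMetric h.q x u w = A.qExt (x, v) (tvec (x, v) u 0) (tvec (x, v) w 0) := by
  rw [A.baseMetric_eq, A.qExt_apply]; rfl

theorem smoothOnFields_baseMetric (A : MaximalAnalyticExtension h.q h.D) :
    SmoothOnFields (baseMetric h.q) := by
  intro Y Z hY hZ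
  have := smoothFn_slice (A.smooth_qExt.smoothFn hY.liftField hZ.liftField) 0
  simp only [A.baseMetric_qExt_tvec _ 0]
  exact this

theorem baseMetric_symm (A : MaximalAnalyticExtension h.q h.D) (x : B) (u w : TangentSpace (𝓡 m) x) :
    baseMetric h.q x u w = baseMetric h.q x w u := by
  rw [A.baseMetric_tvec x 0, h.q_symm, ← A.baseMetric_tvec x 0]

theorem baseMetric_nonneg (A : MaximalAnalyticExtension h.q h.D) (x : B) (u : TangentSpace (𝓡 m) x) :
    0 ≤ baseMetric h.q x u u := by
  rw [A.baseMetric_tvec x 0]; exact (h.q_nonneg _ _).1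

theorem baseMetric_definite (A : MaximalAnalyticExtension h.q h.D) (x : B)
    (u : TangentSpace (𝓡 m) x) (hu : baseMetric h.q x u u = 0) :
    u = 0 := by
  rw [A.baseMetric_tvec x 0] at hu
  obtain ⟨c, hc⟩ := (h.q_nonneg _ _).2 hu
  have := congrArg (fun u : TangentSpace (model m) (x, (0 : ℝ)) ↦ hor u) hc
  simpa using! this

theorem qExt_apply' (p : B × ℝ) (u w : TangentSpace (model m) p) :
    A.qExt p u w = baseMetric h.q p.1 (hor u) (hor w) := by
  rw [A.baseMetric_eq, A.qExt_apply]

/-- A basic field is transported to the horizon, together with its covariant derivatives. -/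
theorem mfderiv_nabla_pull {Y Z : VField (model m) (B × ℝ)} (hZ : SmoothField (model m) Z)
    (r : B × ℝ) :
    nabla A.DExt Y Z (A.incl r) = mfderiv (model m) (model m) A.incl r
      (nabla h.D (A.pull Y) (A.pull Z) r) :=
  ((A.related_pull Y r).nabla A.restrict_D (A.smooth_pull hZ) hZ (A.related_pull Z r)).self_of_nhds

theorem mfderiv_bracket_pull {Y Z : VField (model m) (B × ℝ)} (hY : SmoothField (model m) Y)
    (hZ : SmoothField (model m) Z) (r : B × ℝ) :
    bracket (model m) Y Z (A.incl r) = mfderiv (model m) (model m) A.incl r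
      (bracket (model m) (A.pull Y) (A.pull Z) r) :=
  ((A.related_pull Y r).bracket A.contMDiff_incl (A.smooth_pull hY) (A.smooth_pull hZ) hY hZ
    (A.related_pull Z r)).self_of_nhds

theorem isLeviCivita_ext : IsLeviCivita A.qExt A.DExt := by
  refine isLeviCivita_of_class
    (P := fun Y ↦ ∃ (Z : VField (𝓡 m) B) (a : ℝ), SmoothField (𝓡 m) Z ∧ Y = basicField Z a)
    ?_ (fun p u ↦ ?_) A.smooth_DExt A.smooth_qExt.smoothOnFields ?_ ?_
  · rintro _ ⟨Z, a, hZ, rfl⟩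
    exact hZ.basicField a
  · obtain ⟨Y, hY, h1⟩ := exists_basicField_apply p u
    exact ⟨_, ⟨Y, _, hY, rfl⟩, h1⟩
  · rintro _ _ ⟨Y, a, hY, rfl⟩ ⟨Z, b, hZ, rfl⟩ p
    have h1 := A.eq_of_analytic ((A.analytic_nabla (Y := Y) hZ a b p.1).sub
      (A.analytic_nabla (Y := Z) hY b a p.1)) analyticOnNhd_const p.1
      (g := fun _ ↦ (show EuclideanSpace ℝ (Fin m) × ℝ from (bracket (𝓡 m) Y Z p.1, (0 : ℝ)))) (fun v r hr ↦ by
        have e1 := congrFun (bracket_basicField hY hZ a b) (p.1, v)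
        refine Eq.trans (b := bracket (model m) (basicField Y a) (basicField Z b) (p.1, v)) ?_ e1
        change nabla A.DExt (basicField Y a) (basicField Z b) (p.1, v) -
          nabla A.DExt (basicField Z b) (basicField Y a) (p.1, v) = _
        rw [← hr, A.mfderiv_nabla_pull (hY.basicField a), A.mfderiv_nabla_pull (hZ.basicField b),
          ← map_sub, A.mfderiv_bracket_pull (hY.basicField a) (hZ.basicField b)]
        congr 1
        exact h.isLeviCivita.2.1 _ _ (A.smooth_pull (hY.basicField a))
          (A.smooth_pull (hZ.basicField b)) r)
    rw [bracket_basicField hY hZ]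
    exact congrFun h1 p.2
  · rintro _ _ _ ⟨X, a, hX, rfl⟩ ⟨Y, b, hY, rfl⟩ ⟨Z, c, hZ, rfl⟩ p
    have hg := A.smoothOnFields_baseMetric.smoothFn hY hZ
    have e1 : (fun p ↦ A.qExt p (basicField Y b p) (basicField Z c p)) =
        fun p ↦ baseMetric h.q p.1 (Y p.1) (Z p.1) := by
      funext p
      rw [A.qExt_apply', hor_basicField, hor_basicField]
    have han : ∀ {Y Z : VField (𝓡 m) B} {b : ℝ}, SmoothField (𝓡 m) Y → ∀ x,
        AnalyticOnNhd ℝ (fun v : ℝ ↦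
          baseMetric h.q x (hor (nabla A.DExt (basicField X a) (basicField Y b) (x, v))) (Z x))
          Set.univ := by
      intro Y Z b hY x
      let L : EuclideanSpace ℝ (Fin m) →L[ℝ] ℝ :=
        (show EuclideanSpace ℝ (Fin m) →L[ℝ] EuclideanSpace ℝ (Fin m) →L[ℝ] ℝ from
          baseMetric h.q x).flip (show EuclideanSpace ℝ (Fin m) from Z x)
      exact (L.comp (ContinuousLinearMap.fst ℝ (EuclideanSpace ℝ (Fin m)) ℝ)).comp_analyticOnNhd
        (A.analytic_nabla (Y := X) hY a b x)
    have h1 := A.eq_of_analytic ((han (Z := Z) (b := b) hY p.1).add (han (Z := Y) (b := c) hZ p.1))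
      analyticOnNhd_const p.1
      (g := fun _ ↦ along (𝓡 m) X (fun x ↦ baseMetric h.q x (Y x) (Z x)) p.1) (fun v r hr ↦ by
        have e2 := congrFun (along_basicField_comp_fst X a hg) (p.1, v)
        refine Eq.trans ?_ e2
        change baseMetric h.q (p.1, v).1 (hor (nabla A.DExt (basicField X a) (basicField Y b) (p.1, v)))
          (Z (p.1, v).1) + baseMetric h.q (p.1, v).1
            (hor (nabla A.DExt (basicField X a) (basicField Z c) (p.1, v))) (Y (p.1, v).1) = _
        rw [← hr, A.baseMetric_symm, ← hor_basicField Y b, ← hor_basicField Z c,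
          A.baseMetric_symm _ (hor (basicField Z c _)), ← A.qExt_apply', ← A.qExt_apply',
          A.qExt_symm _ _ (basicField Y b _), A.mfderiv_nabla_pull (hY.basicField b),
          A.mfderiv_nabla_pull (hZ.basicField c), ← A.mfderiv_pull (basicField Y b),
          ← A.mfderiv_pull (basicField Z c), A.restrict_q_apply, A.restrict_q_apply,
          ← h.isLeviCivita.metric (A.smooth_pull (hX.basicField a))
            (A.smooth_pull (hY.basicField b)) (A.smooth_pull (hZ.basicField c))]
        have e3 := ((A.related_pull (basicField X a) r).along A.contMDiff_incl
          (smoothFn_comp_fst hg)).self_of_nhds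
        rw [Function.comp_apply] at e3
        rw [e3]
        congr 1
        funext y
        rw [← A.restrict_q_apply, A.mfderiv_pull, A.mfderiv_pull, A.qExt_apply']
        simp)
    rw [e1, along_basicField_comp_fst X a hg, A.qExt_apply', A.qExt_apply',
      A.baseMetric_symm _ (hor (basicField Y b p))]
    simp only [hor_basicField]
    exact (congrFun h1 p.2).symm

/-- The rotation 1-form potential of the vertical field. -/
def omega {q : BilinField (model m) (B × ℝ)} {D : Connection (model m) (B × ℝ)}
    (A : MaximalAnalyticExtension q D) : CovField (𝓡 m) B := fun x ↦
  (ContinuousLinearMap.snd ℝ (EuclideanSpace ℝ (Fin m)) ℝ).comp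
    ((show EuclideanSpace ℝ (Fin m) × ℝ →L[ℝ] EuclideanSpace ℝ (Fin m) × ℝ from
      A.DExt (vertical m B) (x, 0)).comp
        (ContinuousLinearMap.inl ℝ (EuclideanSpace ℝ (Fin m)) ℝ))

theorem hor_nabla_vertical (p : B × ℝ) (u : TangentSpace (model m) p) :
    hor (A.DExt (vertical m B) p u) = 0 := by
  obtain ⟨Y, hY, rfl⟩ := exists_smoothField_apply p u
  have h1 : ∀ Z, SmoothField (model m) Z →
      A.qExt p (nabla A.DExt Y (vertical m B) p) (Z p) = 0 := fun Z hZ ↦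
    A.isLeviCivita_ext.nabla_degenerate smoothField_vertical
      (fun W _ p ↦ A.qExt_vertical p (W p)) hY Z hZ p
  have h2 := h1 _ (hY.nabla A.smooth_DExt smoothField_vertical)
  rw [A.qExt_apply'] at h2
  exact A.baseMetric_definite _ _ h2

theorem ver_nabla_vertical {Y : VField (𝓡 m) B} (hY : SmoothField (𝓡 m) Y) (x : B) (v v' : ℝ) :
    ver (nabla A.DExt (liftField Y) (vertical m B) (x, v)) =
      ver (nabla A.DExt (liftField Y) (vertical m B) (x, v')) := by
  have hv := smoothField_vertical (m := m) (B := B)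
  have hs := (hY.liftField.nabla A.smooth_DExt hv).smoothFn_ver
  refine eq_of_along_vertical_eq_zero hs (fun p ↦ ?_) x v v'
  have han : AnalyticOnNhd ℝ (fun v : ℝ ↦ ver (nabla A.DExt (liftField Y) (vertical m B) (p.1, v)))
      Set.univ := by
    have := A.analytic_nabla (Y := Y) SmoothField.zero 0 1 p.1
    rw [basicField_zero, basicField_one] at this
    exact (ContinuousLinearMap.snd ℝ (EuclideanSpace ℝ (Fin m)) ℝ).comp_analyticOnNhd this
  have h1 := A.eq_of_analytic han.deriv analyticOnNhd_const p.1
    (g := fun _ ↦ (0 : ℝ)) (fun v r hr ↦ by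
      rw [(hasDerivAt_along_vertical hs p.1 v).deriv, ← hr]
      have e1 := ((A.related_pull (vertical m B) r).curvature A.contMDiff_incl A.restrict_D
        h.smooth_D A.smooth_DExt (A.smooth_pull hv) (A.smooth_pull hY.liftField) (A.smooth_pull hv)
        hv hY.liftField hv (A.related_pull (liftField Y) r)
        (A.related_pull (vertical m B) r)).self_of_nhds
      rw [h.curvature_null (A.smooth_pull hv) (A.smooth_pull hY.liftField)
        A.q_pull_vertical (fun h0 ↦ NonExpandingHorizon.vertical_ne_zero (m := m) (A.incl r) (by
          rw [← A.mfderiv_pull (vertical m B), h0, map_zero])), map_zero] at e1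
      have e2 : nabla A.DExt (vertical m B) (vertical m B) = 0 := funext A.affine
      have e3 : nabla A.DExt (liftField Y) (0 : VField (model m) (B × ℝ)) = 0 := by
        have := nabla_const_smul_right (D := A.DExt) (X := liftField Y) 0 hv
        simpa using this
      have e4 : nabla A.DExt (0 : VField (model m) (B × ℝ)) (vertical m B) = 0 := by
        funext p; simp [nabla]
      have e5 : nabla A.DExt (liftField Y) (vertical m B) =
          (fun p ↦ ver (nabla A.DExt (liftField Y) (vertical m B) p)) • vertical m B := by
        funext p
        exact eq_smul_vertical_of_hor_eq_zero (A.hor_nabla_vertical p _)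
      simp only [curvature, e2, e3, bracket_vertical_liftField hY, e4] at e1
      rw [e5, nabla_smul_right hs hv, e2] at e1
      have e6 := congrArg (fun u ↦ ver u) e1
      simpa using! e6)
  rw [along_vertical_eq_deriv hs]
  exact congrFun h1 p.2

theorem isStationaryGeometry :
    IsStationaryGeometry (baseMetric h.q) A.omega A.qExt A.DExt where
  symm := A.baseMetric_symm
  nonneg := A.baseMetric_nonneg
  definite := A.baseMetric_definite
  smooth_g := A.smoothOnFields_baseMetric
  smooth_q := A.smooth_qExt.smoothOnFields
  q_apply := A.qExt_apply'
  leviCivita := A.isLeviCivita_ext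
  nabla_vertical p u := by
    obtain ⟨Y, hY, hYp⟩ := exists_smoothField_apply (I := 𝓡 m) p.1 (hor u)
    have h1 := A.ver_nabla_vertical hY p.1 p.2 0
    have h2 : u = liftField Y p + ver u • vertical m B p :=
      tangent_prod_ext (by simp [hYp]) (by simp)
    have h3 : A.DExt (vertical m B) p (vertical m B p) = 0 := A.affine p
    rw [eq_smul_vertical_of_hor_eq_zero (A.hor_nabla_vertical p u)]
    congr 1
    rw [← hYp]
    refine Eq.trans ?_ h1
    conv_lhs => rw [h2, map_add, map_smul, h3, smul_zero, add_zero]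
    rfl
  analytic Y Z hY hZ x := by
    have := A.analytic_nabla (Y := Y) hZ 0 0 x
    rwa [basicField_zero, basicField_zero] at this

end MaximalAnalyticExtension

end Extension

section Tensors

variable {E : Type*} [NormedAddCommGroup E] [NormedSpace ℝ E] [FiniteDimensional ℝ E]
  {H : Type*} [TopologicalSpace H]
  {I : ModelWithCorners ℝ E H} {M : Type*} [TopologicalSpace M] [ChartedSpace H M]
  [IsManifold I ∞ M]

theorem SmoothFn.sum {ι : Type*} (s : Finset ι) {f : ι → M → ℝ} (hf : ∀ i, SmoothFn I (f i)) :
    SmoothFn I (∑ i ∈ s, f i) := by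
  classical
  induction s using Finset.induction_on with
  | empty => exact contMDiff_const
  | insert a s ha ih => rw [Finset.sum_insert ha]; exact (hf a).add ih

theorem SmoothFn.prod {ι : Type*} (s : Finset ι) {f : ι → M → ℝ} (hf : ∀ i, SmoothFn I (f i)) :
    SmoothFn I (∏ i ∈ s, f i) := by
  classical
  induction s using Finset.induction_on with
  | empty => exact contMDiff_const
  | insert a s ha ih => rw [Finset.prod_insert ha]; exact (hf a).mul ih

theorem along_sum {ι : Type*} (s : Finset ι) {X : VField I M} {f : ι → M → ℝ}
    (hf : ∀ i, SmoothFn I (f i)) : along I X (∑ i ∈ s, f i) = ∑ i ∈ s, along I X (f i) := by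
  classical
  induction s using Finset.induction_on with
  | empty => exact along_const 0
  | insert a s ha ih =>
    rw [Finset.sum_insert ha, Finset.sum_insert ha, along_add (hf a) (SmoothFn.sum s hf), ih]

theorem along_const_mul {X : VField I M} {f : M → ℝ} (c : ℝ) (hf : SmoothFn I f) :
    along I X (fun y ↦ c * f y) = fun y ↦ c * along I X f y := by
  have := along_mul (X := X) (f := fun _ ↦ c) contMDiff_const hf
  rw [along_const] at this
  refine Eq.trans this ?_
  funext y; simp

theorem smoothFn_det {ι : Type*} [Fintype ι] [DecidableEq ι] {G : M → Matrix ι ι ℝ}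
    (hG : ∀ i j, SmoothFn I (fun y ↦ G y i j)) : SmoothFn I (fun y ↦ (G y).det) := by
  have : (fun y ↦ (G y).det) = ∑ σ : Equiv.Perm ι, fun y ↦
      ((Equiv.Perm.sign σ : ℤ) : ℝ) * (∏ i, fun y ↦ G y (σ i) i) y := by
    funext y
    simp [Matrix.det_apply', Finset.sum_apply, Finset.prod_apply]
  rw [this]
  exact SmoothFn.sum _ fun σ ↦ contMDiff_const.mul (SmoothFn.prod _ fun i ↦ hG _ _)

theorem smoothFn_adjugate {ι : Type*} [Fintype ι] [DecidableEq ι] {G : M → Matrix ι ι ℝ}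
    (hG : ∀ i j, SmoothFn I (fun y ↦ G y i j)) (i j : ι) :
    SmoothFn I (fun y ↦ (G y).adjugate i j) := by
  simp only [Matrix.adjugate_apply]
  refine smoothFn_det fun k l ↦ ?_
  simp only [Matrix.updateRow_apply]
  split_ifs
  · exact contMDiff_const
  · exact hG _ _

/-- Maps of vector fields which are given by a smooth 2-tensor. -/
structure IsTensor (c : VField I M → VField I M → M → ℝ) : Prop where
  smoothFn : ∀ {Y Z}, SmoothField I Y → SmoothField I Z → SmoothFn I (c Y Z)
  add_left : ∀ {Y Y' Z}, SmoothField I Y → SmoothField I Y' → SmoothField I Z →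
    c (Y + Y') Z = c Y Z + c Y' Z
  add_right : ∀ {Y Z Z'}, SmoothField I Y → SmoothField I Z → SmoothField I Z' →
    c Y (Z + Z') = c Y Z + c Y Z'
  smul_left : ∀ {f Y Z}, SmoothFn I f → SmoothField I Y → SmoothField I Z →
    c (f • Y) Z = f * c Y Z
  smul_right : ∀ {f Y Z}, SmoothFn I f → SmoothField I Y → SmoothField I Z →
    c Y (f • Z) = f * c Y Z

namespace IsTensor

variable {c : VField I M → VField I M → M → ℝ} {Y Z : VField I M}

theorem sum_left (hc : IsTensor c) {k : ℕ} {e : Fin k → VField I M} (he : ∀ i, SmoothField I (e i))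
    (a : Fin k → ℝ) (hZ : SmoothField I Z) (s : Finset (Fin k)) :
    c (∑ i ∈ s, a i • e i) Z = ∑ i ∈ s, fun y ↦ a i * c (e i) Z y := by
  have h1 : ∀ i, c (a i • e i) Z = fun y ↦ a i * c (e i) Z y := fun i ↦
    hc.smul_left (f := fun _ ↦ a i) contMDiff_const (he i) hZ
  induction s using Finset.induction_on with
  | empty =>
    have := hc.smul_left (f := fun _ ↦ 0) contMDiff_const SmoothField.zero hZ
    have h0 : (fun _ : M ↦ (0 : ℝ)) • (0 : VField I M) = 0 := by funext y; simp
    rw [h0] at this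
    rw [Finset.sum_empty, Finset.sum_empty, this]
    funext y; simp
  | insert a s ha ih =>
    rw [Finset.sum_insert ha, Finset.sum_insert ha, hc.add_left ((he _).const_smul _)
      (SmoothField.sum s fun i ↦ (he i).const_smul _) hZ, ih, h1]

theorem swap (hc : IsTensor c) : IsTensor (fun Y Z ↦ c Z Y) where
  smoothFn hY hZ := hc.smoothFn hZ hY
  add_left h1 h2 h3 := hc.add_right h3 h1 h2
  add_right h1 h2 h3 := hc.add_left h2 h3 h1
  smul_left h1 h2 h3 := hc.smul_right h1 h3 h2
  smul_right h1 h2 h3 := hc.smul_left h1 h3 h2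

theorem sum_right (hc : IsTensor c) {k : ℕ} {e : Fin k → VField I M} (he : ∀ i, SmoothField I (e i))
    (a : Fin k → ℝ) (hZ : SmoothField I Z) (s : Finset (Fin k)) :
    c Z (∑ i ∈ s, a i • e i) = ∑ i ∈ s, fun y ↦ a i * c Z (e i) y :=
  hc.swap.sum_left he a hZ s

theorem congr [T2Space M] (hc : IsTensor c) {Y' Z' : VField I M} (hY : SmoothField I Y)
    (hZ : SmoothField I Z) (hY' : SmoothField I Y') (hZ' : SmoothField I Z') {p : M}
    (h1 : Y p = Y' p) (h2 : Z p = Z' p) : c Y Z p = c Y' Z' p := by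
  have e1 : c Y Z p = c Y' Z p :=
    congr_of_tensorial (Φ := fun Y ↦ c Y Z p)
      (fun f Y hf hY ↦ congrFun (hc.smul_left hf hY hZ) p)
      (fun Y Y' hY hY' ↦ congrFun (hc.add_left hY hY' hZ) p) hY hY' h1
  have e2 : c Y' Z p = c Y' Z' p :=
    congr_of_tensorial (Φ := fun Z ↦ c Y' Z p)
      (fun f Z hf hZ ↦ congrFun (hc.smul_right hf hY' hZ) p)
      (fun Z Z' hZ hZ' ↦ congrFun (hc.add_right hY' hZ hZ') p) hZ hZ' h2
  exact e1.trans e2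

end IsTensor

/-- The Gram matrix of the fields `e i`. -/
def gram {k : ℕ} (q : BilinField I M) (e : Fin k → VField I M) (y : M) : Matrix (Fin k) (Fin k) ℝ :=
  Matrix.of fun i j ↦ q y (e i y) (e j y)

theorem gram_apply {k : ℕ} (q : BilinField I M) (e : Fin k → VField I M) (y : M) (i j : Fin k) :
    gram q e y i j = q y (e i y) (e j y) := rfl

theorem OrthonormalAt.gram_eq_one {k : ℕ} {q : BilinField I M} {e : Fin k → VField I M} {y : M}
    (h : OrthonormalAt q e y) : gram q e y = 1 := by
  ext i j
  rw [gram_apply, h i j, Matrix.one_apply]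

theorem q_sum_sum {k : ℕ} (q : BilinField I M) (e : Fin k → VField I M) (y : M) (a b : Fin k → ℝ) :
    q y ((∑ j, a j • e j) y) ((∑ j, b j • e j) y) = a ⬝ᵥ (gram q e y).mulVec b := by
  simp only [Finset.sum_apply, Pi.smul_apply, map_sum, sum_apply, map_smul,
    smul_apply, dotProduct, Matrix.mulVec, gram_apply, smul_eq_mul, Finset.mul_sum]
  rw [Finset.sum_comm]
  exact Finset.sum_congr rfl fun i _ ↦ Finset.sum_congr rfl fun j _ ↦ by ring

open scoped MatrixOrder in
/-- Orthonormalization of a frame at a point. -/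
theorem exists_orthonormal_combination {k : ℕ} {q : BilinField I M} {e : Fin k → VField I M} {y : M}
    (hsymm : ∀ u w, q y u w = q y w u) (hnonneg : ∀ u, 0 ≤ q y u u)
    (hdet : (gram q e y).det ≠ 0) :
    0 < (gram q e y).det ∧ ∃ C : Matrix (Fin k) (Fin k) ℝ,
      OrthonormalAt q (fun i ↦ ∑ j, C i j • e j) y ∧
      (gram q e y).adjugate = (gram q e y).det • (C.transpose * C) := by
  set G := gram q e y with hG
  have hherm : G.IsHermitian := by
    ext i j
    simp only [Matrix.conjTranspose_apply, star_trivial, hG, gram_apply]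
    exact hsymm _ _
  have hpsd : G.PosSemidef := by
    rw [Matrix.posSemidef_iff_dotProduct_mulVec]
    refine ⟨hherm, fun x ↦ ?_⟩
    rw [star_trivial, hG, ← q_sum_sum]
    exact hnonneg _
  have hpos : 0 < G.det := lt_of_le_of_ne hpsd.det_nonneg (Ne.symm hdet)
  obtain ⟨P, hP⟩ := CStarAlgebra.nonneg_iff_eq_star_mul_self.mp hpsd.nonneg
  rw [Matrix.star_eq_conjTranspose, Matrix.conjTranspose_eq_transpose_of_trivial] at hP
  have hdetP : IsUnit P.det := by
    rw [isUnit_iff_ne_zero]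
    intro h0
    rw [hP, Matrix.det_mul, h0, mul_zero] at hdet
    exact hdet rfl
  have hPt : IsUnit P.transpose.det := by rwa [Matrix.det_transpose]
  refine ⟨hpos, P⁻¹.transpose, ?_, ?_⟩
  · intro i j
    rw [q_sum_sum, ← hG]
    have h1 : P⁻¹.transpose * G * P⁻¹ = 1 := by
      rw [hP, Matrix.transpose_nonsing_inv, ← Matrix.mul_assoc, Matrix.nonsing_inv_mul _ hPt,
        Matrix.one_mul, Matrix.mul_nonsing_inv _ hdetP]
    have h2 := congrFun (congrFun h1 i) j
    rw [Matrix.one_apply, Matrix.mul_assoc] at h2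
    rw [← h2]
    simp only [Matrix.mul_apply, dotProduct, Matrix.mulVec, Matrix.transpose_apply]
  · have h1 : G⁻¹ = P⁻¹ * P⁻¹.transpose := by
      rw [hP, Matrix.mul_inv_rev, Matrix.transpose_nonsing_inv]
    rw [Matrix.transpose_transpose, ← h1, Matrix.inv_def, smul_smul, Ring.inverse_eq_inv',
      mul_inv_cancel₀ hdet, one_smul]

/-- The trace of a tensor, up to the Gram determinant. -/
def gramTrace {k : ℕ} (q : BilinField I M) (e : Fin k → VField I M)
    (c : VField I M → VField I M → M → ℝ) : M → ℝ :=
  ∑ i, ∑ j, (fun y ↦ (gram q e y).adjugate i j) * c (e i) (e j)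

theorem smoothFn_gramTrace {k : ℕ} {q : BilinField I M} (hq : SmoothOnFields q)
    {e : Fin k → VField I M} (he : ∀ i, SmoothField I (e i))
    {c : VField I M → VField I M → M → ℝ} (hc : IsTensor c) : SmoothFn I (gramTrace q e c) :=
  SmoothFn.sum _ fun _ ↦ SmoothFn.sum _ fun _ ↦
    ContMDiff.mul (smoothFn_adjugate (fun _ _ ↦ hq.smoothFn (he _) (he _)) _ _)
      (hc.smoothFn (he _) (he _))

theorem gramTrace_apply_of_orthonormal {k : ℕ} {q : BilinField I M} {e : Fin k → VField I M}
    (c : VField I M → VField I M → M → ℝ) {y : M} (h : OrthonormalAt q e y) :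
    gramTrace q e c y = ∑ i, c (e i) (e i) y := by
  simp only [gramTrace, Finset.sum_apply, Pi.mul_apply, h.gram_eq_one, Matrix.adjugate_one,
    Matrix.one_apply, ite_mul, one_mul, zero_mul, Finset.sum_ite_eq, Finset.mem_univ, if_true]

/-- The trace of tensors in an arbitrary frame, in terms of an orthonormal one. -/
theorem exists_gramTrace_eq {k : ℕ} {q : BilinField I M} {e : Fin k → VField I M} {y : M}
    (he : ∀ i, SmoothField I (e i))
    (hsymm : ∀ u w, q y u w = q y w u) (hnonneg : ∀ u, 0 ≤ q y u u)
    (hdet : (gram q e y).det ≠ 0) :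
    ∃ ε : Fin k → VField I M, (∀ i, SmoothField I (ε i)) ∧ OrthonormalAt q ε y ∧
      0 < (gram q e y).det ∧ ∀ c, IsTensor c →
        gramTrace q e c y = (gram q e y).det * ∑ i, c (ε i) (ε i) y := by
  obtain ⟨hpos, C, hC, hadj⟩ := exists_orthonormal_combination hsymm hnonneg hdet
  have hs : ∀ i, SmoothField I (∑ j, C i j • e j) := fun i ↦
    SmoothField.sum _ fun j ↦ (he j).const_smul _
  refine ⟨_, hs, hC, hpos, fun c hc ↦ ?_⟩
  simp only [hc.sum_left he _ (hs _), hc.sum_right he _ (he _), gramTrace, Finset.sum_apply,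
    Pi.mul_apply, hadj, Matrix.smul_apply, Matrix.mul_apply, Matrix.transpose_apply, smul_eq_mul,
    Finset.mul_sum, Finset.sum_mul]
  rw [Finset.sum_comm' (t' := Finset.univ) (s' := fun _ ↦ Finset.univ) (by simp)]
  conv_rhs => rw [Finset.sum_comm]
  rw [Finset.sum_comm]
  refine Finset.sum_congr rfl fun i _ ↦ ?_
  rw [Finset.sum_comm]
  refine Finset.sum_congr rfl fun j _ ↦ Finset.sum_congr rfl fun l _ ↦ ?_
  ring

theorem IsTensor.gramTrace_eventuallyEq_zero {k : ℕ} {q : BilinField I M} (hq : SmoothOnFields q)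
    (hsymm : ∀ x u w, q x u w = q x w u) (hnonneg : ∀ x u, 0 ≤ q x u u)
    {c : VField I M → VField I M → M → ℝ} (hc : IsTensor c) {p : M} {S : Set M} (hS : Dense S)
    (htr : ∀ y ∈ S, ∀ ε : Fin k → VField I M, (∀ i, SmoothField I (ε i)) → OrthonormalAt q ε y →
      ∑ i, c (ε i) (ε i) y = 0)
    {e : Fin k → VField I M} (he : ∀ i, SmoothField I (e i)) (hep : OrthonormalAt q e p) :
    gramTrace q e c =ᶠ[𝓝 p] fun _ ↦ 0 := by
  have hds := smoothFn_det fun i j ↦ hq.smoothFn (he i) (he j)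
  have ho : IsOpen {y | (gram q e y).det ≠ 0} :=
    isOpen_ne_fun hds.continuous continuous_const
  have hp : p ∈ {y | (gram q e y).det ≠ 0} := by
    simp [hep.gram_eq_one]
  filter_upwards [ho.mem_nhds hp] with y hy
  have h1 : y ∈ closure ({y | (gram q e y).det ≠ 0} ∩ S) := hS.open_subset_closure_inter ho hy
  have h2 : IsClosed {y | gramTrace q e c y = 0} :=
    isClosed_eq (smoothFn_gramTrace hq he hc).continuous continuous_const
  refine h2.closure_subset_iff.2 ?_ h1
  rintro z ⟨hz1, hz2⟩
  obtain ⟨ε, hε, hε1, -, h3⟩ := exists_gramTrace_eq he (hsymm z) (hnonneg z) hz1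
  change gramTrace q e c z = 0
  rw [h3 c hc, htr z hz2 ε hε hε1, mul_zero]

/-- A smooth tensor which is trace free on a dense set is trace free. -/
theorem IsTensor.sum_eq_zero_of_dense {k : ℕ} {q : BilinField I M} (hq : SmoothOnFields q)
    (hsymm : ∀ x u w, q x u w = q x w u) (hnonneg : ∀ x u, 0 ≤ q x u u)
    {c : VField I M → VField I M → M → ℝ} (hc : IsTensor c) {p : M} {S : Set M} (hS : Dense S)
    (htr : ∀ y ∈ S, ∀ ε : Fin k → VField I M, (∀ i, SmoothField I (ε i)) → OrthonormalAt q ε y →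
      ∑ i, c (ε i) (ε i) y = 0)
    {e : Fin k → VField I M} (he : ∀ i, SmoothField I (e i)) (hep : OrthonormalAt q e p) :
    ∑ i, c (e i) (e i) p = 0 := by
  rw [← gramTrace_apply_of_orthonormal c hep]
  exact (hc.gramTrace_eventuallyEq_zero hq hsymm hnonneg hS htr he hep).eq_of_nhds

/-- If a field drags the metric, the trace of the Lie derivative of a trace free tensor vanishes. -/
theorem IsTensor.sum_lie_eq_zero {k : ℕ} {q : BilinField I M} (hq : SmoothOnFields q)
    (hsymm : ∀ x u w, q x u w = q x w u) (hnonneg : ∀ x u, 0 ≤ q x u u)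
    {c : VField I M → VField I M → M → ℝ} (hc : IsTensor c) {X : VField I M} (hX : SmoothField I X)
    {p : M} (hXq : ∀ Y Z, SmoothField I Y → SmoothField I Z → lieBilin I X q Y Z p = 0)
    {S : Set M} (hS : Dense S)
    (htr : ∀ y ∈ S, ∀ ε : Fin k → VField I M, (∀ i, SmoothField I (ε i)) → OrthonormalAt q ε y →
      ∑ i, c (ε i) (ε i) y = 0)
    {e : Fin k → VField I M} (he : ∀ i, SmoothField I (e i)) (hep : OrthonormalAt q e p)
    (hl : ∀ Y Z, SmoothField I Y → SmoothField I Z →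
      c Y Z p = ∑ j, q p (Y p) (e j p) * c (e j) Z p)
    (hr : ∀ Y Z, SmoothField I Y → SmoothField I Z →
      c Y Z p = ∑ j, q p (Z p) (e j p) * c Y (e j) p) :
    ∑ i, (along I X (c (e i) (e i)) p - c (bracket I X (e i)) (e i) p
      - c (e i) (bracket I X (e i)) p) = 0 := by
  have hGs : ∀ i j, SmoothFn I (fun y ↦ gram q e y i j) := fun i j ↦ hq.smoothFn (he i) (he j)
  have hAs := smoothFn_adjugate hGs
  have hds := smoothFn_det hGs
  have hG1 := hep.gram_eq_one
  have hT := hc.gramTrace_eventuallyEq_zero hq hsymm hnonneg hS htr he hep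
  have hT0 := (hc.sum_eq_zero_of_dense hq hsymm hnonneg hS htr he hep).symm
  have hdT : along I X (gramTrace q e c) p = 0 := by
    rw [along_congr hT, along_const]; rfl
  have hadjX : ∀ i j, along I X (fun y ↦ (gram q e y).adjugate i j) p =
      (if i = j then along I X (fun y ↦ (gram q e y).det) p else 0) -
        along I X (fun y ↦ gram q e y i j) p := by
    intro i j
    have h1 : (∑ l, (fun y ↦ (gram q e y).adjugate i l) * fun y ↦ gram q e y l j) =
        fun y ↦ (if i = j then 1 else 0) * (gram q e y).det := by
      funext y
      have := congrFun (congrFun (Matrix.adjugate_mul (gram q e y)) i) j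
      rw [Matrix.mul_apply, Matrix.smul_apply, Matrix.one_apply, smul_eq_mul, mul_comm] at this
      simpa [Finset.sum_apply] using this
    have h2 := congrFun (congrArg (along I X) h1) p
    rw [along_sum _ fun l ↦ (hAs i l).mul (hGs l j), along_const_mul _ hds] at h2
    simp only [Finset.sum_apply, along_mul (hAs _ _) (hGs _ _), Pi.add_apply, Pi.mul_apply, hG1,
      Matrix.adjugate_one, Finset.sum_add_distrib, Matrix.one_apply, ite_mul, one_mul,
      zero_mul, Finset.sum_ite_eq, Finset.sum_ite_eq', Finset.mem_univ, if_true] at h2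
    linarith
  rw [gramTrace, along_sum _ fun i ↦ SmoothFn.sum _ fun j ↦
    (hAs i j).mul (hc.smoothFn (he i) (he j))] at hdT
  simp only [Finset.sum_apply, along_sum _ fun j ↦ (hAs _ j).mul (hc.smoothFn (he _) (he j)),
    along_mul (hAs _ _) (hc.smoothFn (he _) (he _)), Pi.add_apply, Pi.mul_apply, hG1,
    Matrix.adjugate_one, Finset.sum_add_distrib, Matrix.one_apply, ite_mul, one_mul, zero_mul,
    Finset.sum_ite_eq, Finset.mem_univ, if_true, hadjX, mul_sub, Finset.sum_sub_distrib,
    mul_ite, mul_zero, ← Finset.sum_mul, ← hT0] at hdT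
  have hXG : ∀ i j, along I X (fun y ↦ gram q e y i j) p =
      q p (bracket I X (e i) p) (e j p) + q p (bracket I X (e j) p) (e i p) := by
    intro i j
    have h1 := hXq _ _ (he i) (he j)
    rw [lieBilin] at h1
    rw [hsymm p (bracket I X (e j) p)]
    change along I X (fun y ↦ q y (e i y) (e j y)) p = _
    linarith
  have hb := fun i ↦ hX.bracket (he i)
  have e1 : ∑ i, ∑ j, c (e i) (e j) p * along I X (fun y ↦ gram q e y i j) p =
      ∑ i, c (e i) (bracket I X (e i)) p + ∑ i, c (bracket I X (e i)) (e i) p := by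
    simp only [hXG, mul_add, Finset.sum_add_distrib]
    congr 1
    · exact Finset.sum_congr rfl fun i _ ↦ by
        rw [hr _ _ (he i) (hb i)]
        exact Finset.sum_congr rfl fun j _ ↦ mul_comm _ _
    · rw [Finset.sum_comm]
      exact Finset.sum_congr rfl fun i _ ↦ by
        rw [hl _ _ (hb i) (he i)]
        exact Finset.sum_congr rfl fun j _ ↦ mul_comm _ _
  simp only [Finset.sum_sub_distrib]
  linarith

end Tensors

section Hessian

variable {E : Type*} [NormedAddCommGroup E] [NormedSpace ℝ E] [FiniteDimensional ℝ E]
  {H : Type*} [TopologicalSpace H]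
  {I : ModelWithCorners ℝ E H} {M : Type*} [TopologicalSpace M] [ChartedSpace H M]
  [IsManifold I ∞ M]

/-- The covariant derivative `(∇_Y α)(Z) = Y(α(Z)) - α(∇_Y Z)` of a 1-form. -/
def covDer (D : Connection I M) (α : CovField I M) (Y Z : VField I M) : M → ℝ := fun x ↦
  along I Y (fun y ↦ α y (Z y)) x - α x (nabla D Y Z x)

theorem isTensor_covDer {D : Connection I M} (hD : SmoothConnection D) {α : CovField I M}
    (hα : ∀ Y, SmoothField I Y → SmoothFn I (fun x ↦ α x (Y x))) : IsTensor (covDer D α) where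
  smoothFn hY hZ := (smoothFn_along hY (hα _ hZ)).sub (hα _ (hY.nabla hD hZ))
  add_left {Y Y' Z} hY hY' hZ := by
    funext x
    simp only [covDer, along_add_left, nabla_add_left, Pi.add_apply, map_add]
    ring
  add_right {Y Z Z'} hY hZ hZ' := by
    funext x
    have : (fun y ↦ α y ((Z + Z') y)) = (fun y ↦ α y (Z y)) + fun y ↦ α y (Z' y) := by
      funext y; simp
    simp only [covDer]
    rw [this, along_add (hα _ hZ) (hα _ hZ'), nabla_add_right hZ hZ']
    simp only [Pi.add_apply, map_add, covDer]
    ring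
  smul_left {f Y Z} hf hY hZ := by
    funext x
    simp only [covDer, along_smul_left, nabla_smul_left, Pi.mul_apply, Pi.smul_apply', map_smul,
      smul_eq_mul]
    ring
  smul_right {f Y Z} hf hY hZ := by
    funext x
    have : (fun y ↦ α y ((f • Z) y)) = f * fun y ↦ α y (Z y) := by
      funext y; simp
    simp only [covDer]
    rw [this, along_mul hf (hα _ hZ), nabla_smul_right hf hZ]
    simp only [Pi.add_apply, Pi.mul_apply, Pi.smul_apply', map_add, map_smul, smul_eq_mul, covDer]
    ring

/-- The Hessian of a function. -/
def hess (D : Connection I M) (f : M → ℝ) (Y Z : VField I M) : M → ℝ :=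
  covDer D (fun x ↦ mvfderiv I f x) Y Z

variable {D : Connection I M} {f g : M → ℝ} {Y Z : VField I M}

theorem hess_apply (x : M) : hess D f Y Z x =
    along I Y (along I Z f) x - along I (nabla D Y Z) f x := rfl

theorem isTensor_hess (hD : SmoothConnection D) (hf : SmoothFn I f) : IsTensor (hess D f) :=
  isTensor_covDer hD fun _ hY ↦ smoothFn_along hY hf

theorem hess_add_const_mul (hf : SmoothFn I f) (hg : SmoothFn I g) (c : ℝ) (hZ : SmoothField I Z)
    (x : M) : hess D (fun y ↦ f y + c * g y) Y Z x = hess D f Y Z x + c * hess D g Y Z x := by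
  have hcg : SmoothFn I (fun y ↦ c * g y) := contMDiff_const.mul hg
  have h1 : ∀ {W : VField I M}, along I W (fun y ↦ f y + c * g y) =
      along I W f + fun y ↦ c * along I W g y := by
    intro W
    have := along_add (X := W) hf hcg
    rw [along_const_mul c hg] at this
    exact this
  have hZg := smoothFn_along hZ hg
  have hcZ : SmoothFn I (fun y ↦ c * along I Z g y) := contMDiff_const.mul hZg
  rw [hess_apply, hess_apply, hess_apply, h1, h1, along_add (smoothFn_along hZ hf) hcZ,
    along_const_mul c hZg]
  simp only [Pi.add_apply]
  ring

/-- First and second order conditions at a local maximum. -/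
theorem along_of_isLocalMax [BoundarylessManifold I M] [T2Space M] (hf : SmoothFn I f) {p : M}
    (hp : IsLocalMax f p) (hY : SmoothField I Y) :
    along I Y f p = 0 ∧ along I Y (along I Y f) p ≤ 0 := by
  have : CompleteSpace E := FiniteDimensional.complete ℝ E
  obtain ⟨γ, hγ0, hγ⟩ := exists_isMIntegralCurveAt_of_contMDiffAt_boundaryless (I := I) (t₀ := 0)
    (x₀ := p) (v := Y) ((hY p).of_le (by simp))
  have hd : ∀ {g : M → ℝ}, SmoothFn I g →
      ∀ᶠ t in 𝓝 (0 : ℝ), HasDerivAt (g ∘ γ) (along I Y g (γ t)) t := by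
    intro g hg
    filter_upwards [hγ] with t ht
    have h1 := (hg.mdiff (γ t)).hasMFDerivAt.comp t ht
    have h2 : HasFDerivAt (g ∘ γ) (show ℝ →L[ℝ] ℝ from (mfderiv I 𝓘(ℝ, ℝ) g (γ t)).comp
      ((1 : ℝ →L[ℝ] ℝ).smulRight (Y (γ t)))) t := h1.hasFDerivAt
    refine h2.hasDerivAt.congr_deriv ?_
    change mfderiv I 𝓘(ℝ, ℝ) g (γ t) ((1 : ℝ) • Y (γ t)) = _
    rw [one_smul]; rfl
  have hγc : ContinuousAt γ 0 := hγ.continuousAt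
  have hmax : IsLocalMax (f ∘ γ) 0 := by
    rw [← hγ0] at hp
    exact hγc.eventually hp
  have e1 : deriv (f ∘ γ) =ᶠ[𝓝 0] along I Y f ∘ γ := by
    filter_upwards [hd hf] with t ht using ht.deriv
  have e2 : deriv (deriv (f ∘ γ)) 0 = along I Y (along I Y f) p := by
    rw [e1.deriv_eq, (hd (smoothFn_along hY hf)).self_of_nhds.deriv, hγ0]
  have e3 : deriv (f ∘ γ) 0 = 0 := hmax.deriv_eq_zero
  constructor
  · rw [e1.eq_of_nhds, Function.comp_apply, hγ0] at e3
    exact e3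
  · by_contra hpos
    rw [← e2, not_le] at hpos
    have hmin := isLocalMin_of_deriv_deriv_pos hpos e3 (hd hf).self_of_nhds.continuousAt
    have h3 : f ∘ γ =ᶠ[𝓝 0] fun _ ↦ (f ∘ γ) 0 := by
      filter_upwards [hmin, hmax] with t h1 h2 using le_antisymm h2 h1
    have h4 : deriv (f ∘ γ) =ᶠ[𝓝 0] fun _ ↦ 0 := by
      have := h3.deriv
      simpa using! this
    rw [h4.deriv_eq] at hpos
    simp at hpos

/-- Expansion of a vector in an orthonormal basis. -/
theorem OrthonormalAt.sum_smul {k : ℕ} {q : BilinField I M} {e : Fin k → VField I M} {y : M}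
    (h : OrthonormalAt q e y) (hk : Module.finrank ℝ E = k) (u : TangentSpace I y) :
    u = ∑ j, q y u (e j y) • e j y := by
  have hq : ∀ (a : Fin k → ℝ) (i : Fin k), q y (∑ j, a j • e j y) (e i y) = a i := by
    intro a i
    simp [h _ _, sum_apply]
  have hli : LinearIndependent ℝ (fun j ↦ (e j y : TangentSpace I y)) := by
    rw [Fintype.linearIndependent_iff]
    intro a ha i
    rw [← hq a i, ha, map_zero]; rfl
  have hfd : FiniteDimensional ℝ (TangentSpace I y) := inferInstanceAs (FiniteDimensional ℝ E)
  have hspan : Submodule.span ℝ (Set.range fun j ↦ (e j y : TangentSpace I y)) = ⊤ :=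
    hli.span_eq_top_of_card_eq_finrank' (by
      rw [Fintype.card_fin]; exact hk.symm)
  have hu : u ∈ Submodule.span ℝ (Set.range fun j ↦ (e j y : TangentSpace I y)) := by
    rw [hspan]; trivial
  obtain ⟨a, rfl⟩ := (Submodule.mem_span_range_iff_exists_fun ℝ).1 hu
  exact Finset.sum_congr rfl fun j _ ↦ by rw [hq]

theorem exists_orthonormalAt [T2Space M] {k : ℕ} {q : BilinField I M} {y : M}
    (hk : Module.finrank ℝ E = k)
    (hsymm : ∀ u w, q y u w = q y w u) (hnonneg : ∀ u, 0 ≤ q y u u)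
    (hdef : ∀ u, q y u u = 0 → u = 0) :
    ∃ e : Fin k → VField I M, (∀ i, SmoothField I (e i)) ∧ OrthonormalAt q e y := by
  subst hk
  let b : Module.Basis (Fin (Module.finrank ℝ E)) ℝ (TangentSpace I y) := Module.finBasis ℝ E
  choose V hV hVb using fun i ↦ exists_smoothField_apply (I := I) y (b i)
  have hdet : (gram q V y).det ≠ 0 := by
    intro h0
    obtain ⟨a, ha0, ha⟩ := Matrix.exists_mulVec_eq_zero_iff.2 h0
    have h1 := q_sum_sum q V y a a
    rw [ha, dotProduct_zero] at h1
    have h2 := hdef _ h1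
    refine ha0 (funext fun i ↦ ?_)
    simp only [Finset.sum_apply, Pi.smul_apply, hVb] at h2
    exact Fintype.linearIndependent_iff.1 b.linearIndependent a h2 i
  obtain ⟨ε, hε, hε1, -⟩ := exists_gramTrace_eq hV hsymm hnonneg hdet
  exact ⟨ε, hε, hε1⟩

/-- `f` is harmonic: the trace of its Hessian vanishes. -/
def IsHarmonic (k : ℕ) (q : BilinField I M) (D : Connection I M) (f : M → ℝ) : Prop :=
  ∀ x, ∀ e : Fin k → VField I M, (∀ i, SmoothField I (e i)) → OrthonormalAt q e x →
    ∑ i, hess D f (e i) (e i) x = 0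

/-- A harmonic function cannot have a maximum at which it is touched from one side by a
hypersurface `ρ = const`. -/
theorem IsHarmonic.false_of_touching [BoundarylessManifold I M] [T2Space M] {k : ℕ}
    {q : BilinField I M} (hk : Module.finrank ℝ E = k) (hq : SmoothOnFields q)
    (hsymm : ∀ x u w, q x u w = q x w u) (hnonneg : ∀ x u, 0 ≤ q x u u)
    (hdef : ∀ x u, q x u u = 0 → u = 0) (hD : SmoothConnection D) {u : M → ℝ} (hu : SmoothFn I u)
    (huh : IsHarmonic k q D u) {ρ : M → ℝ} (hρ : SmoothFn I ρ) {z : M} (hρz : mvfderiv I ρ z ≠ 0)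
    (hle : ∀ᶠ x in 𝓝 z, u x ≤ u z)
    (hlt : ∀ᶠ x in 𝓝 z, ρ x ≤ ρ z → x ≠ z → u x < u z) : False := by
  obtain ⟨e, he, hez⟩ := exists_orthonormalAt hk (hsymm z) (hnonneg z) (hdef z)
  have hs : 0 < ∑ i, (along I (e i) ρ z) ^ 2 := by
    refine lt_of_le_of_ne (Finset.sum_nonneg fun i _ ↦ sq_nonneg _) fun h0 ↦ hρz ?_
    have h1 := (Finset.sum_eq_zero_iff_of_nonneg fun i _ ↦ sq_nonneg _).1 h0.symm
    ext w
    rw [hez.sum_smul hk w, map_sum]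
    refine Finset.sum_eq_zero fun i hi ↦ ?_
    have : along I (e i) ρ z = 0 := by simpa using h1 i hi
    rw [map_smul]
    change _ • along I (e i) ρ z = 0
    rw [this, smul_zero]
  set s := ∑ i, (along I (e i) ρ z) ^ 2
  obtain ⟨a, ha⟩ : ∃ a : ℝ, 0 < -∑ i, hess D ρ (e i) (e i) z + 2 * a * s :=
    ⟨(∑ i, hess D ρ (e i) (e i) z + 1) / (2 * s), by field_simp; linarith⟩
  let r : M → ℝ := fun x ↦ ρ x - ρ z
  have hr : SmoothFn I r := hρ.sub contMDiff_const
  have hrw : ∀ {W : VField I M}, along I W r = along I W ρ := by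
    intro W
    have := along_sub (X := W) hρ (contMDiff_const (c := ρ z))
    rw [along_const, sub_zero] at this
    exact this
  let w : M → ℝ := -r + (fun y ↦ a * (r * r) y)
  have hrr : SmoothFn I (r * r) := hr.mul hr
  have hw : SmoothFn I w := hr.neg.add (contMDiff_const.mul hrr)
  have haw : ∀ {W : VField I M}, along I W w = (-1 + fun y ↦ (2 * a) * r y) * along I W ρ := by
    intro W
    have h1 : SmoothFn I (fun y ↦ a * (r * r) y) := contMDiff_const.mul hrr
    simp only [w]
    have hnr : SmoothFn I (-r) := hr.neg
    rw [along_add hnr h1, along_neg, along_const_mul a hrr, along_mul hr hr, hrw]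
    funext y
    simp only [Pi.add_apply, Pi.neg_apply, Pi.mul_apply, Pi.one_apply]
    ring
  have hwz : ∀ i, hess D w (e i) (e i) z = -hess D ρ (e i) (e i) z + 2 * a * (along I (e i) ρ z) ^ 2 := by
    intro i
    have h2 : SmoothFn I (fun y ↦ (2 * a) * r y) := contMDiff_const.mul hr
    have h1 : SmoothFn I (-1 + fun y ↦ (2 * a) * r y) :=
      ContMDiff.add (contMDiff_const (c := (-1 : ℝ))) h2
    have h3 : along I (e i) (-1 + fun y ↦ (2 * a) * r y) = fun y ↦ (2 * a) * along I (e i) ρ y := by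
      have h4 := along_add (X := e i) (contMDiff_const (c := (-1 : ℝ))) h2
      rw [along_const, zero_add, along_const_mul _ hr, hrw] at h4
      exact h4
    have hrz : r z = 0 := sub_self _
    rw [hess_apply, hess_apply, haw, haw, along_mul h1 (smoothFn_along (he i) hρ), h3]
    simp only [Pi.add_apply, Pi.neg_apply, Pi.mul_apply, Pi.one_apply, hrz]
    ring
  have hTw : 0 < gramTrace q e (hess D w) z := by
    rw [gramTrace_apply_of_orthonormal _ hez]
    simp only [hwz, Finset.sum_add_distrib, Finset.sum_neg_distrib, ← Finset.mul_sum]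
    exact ha
  have hTs := smoothFn_gramTrace hq he (isTensor_hess hD hw)
  have hds : SmoothFn I (fun y ↦ (gram q e y).det) :=
    smoothFn_det fun i j ↦ hq.smoothFn (he i) (he j)
  have hdz : (gram q e z).det ≠ 0 := by rw [hez.gram_eq_one]; simp
  have hrz : r z = 0 := sub_self _
  have hwz0 : w z = 0 := by simp [w, hrz]
  have hnear := (hle.and hlt).and (((hTs.continuous.continuousAt.eventually (lt_mem_nhds hTw)).and
    (hds.continuous.continuousAt.eventually_ne hdz)).and
    ((hw.continuous.continuousAt.eventually (gt_mem_nhds (by rw [hwz0]; exact one_pos))).and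
    ((continuous_const.mul hr.continuous).continuousAt.eventually
      (gt_mem_nhds (show a * r z < 1 by rw [hrz]; simp)))))
  have : LocallyCompactSpace M := Manifold.locallyCompact_of_finiteDimensional I
  obtain ⟨N, hNz, hN, hNc⟩ := local_compact_nhds hnear
  have hzi : z ∈ interior N := mem_interior_iff_mem_nhds.2 hNz
  have hzN : z ∈ N := interior_subset hzi
  obtain ⟨ε, hε, hεu⟩ : ∃ ε : ℝ, 0 < ε ∧ ∀ x ∈ (N \ interior N) ∩ {x | ρ x ≤ ρ z}, u x + ε ≤ u z := by
    have hc : IsCompact ((N \ interior N) ∩ {x | ρ x ≤ ρ z}) :=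
      (hNc.diff isOpen_interior).inter_right (isClosed_le hρ.continuous continuous_const)
    rcases Set.eq_empty_or_nonempty ((N \ interior N) ∩ {x | ρ x ≤ ρ z}) with h0 | h0
    · exact ⟨1, one_pos, by rw [h0]; simp⟩
    · obtain ⟨x0, hx0, hmax⟩ := hc.exists_isMaxOn h0 hu.continuous.continuousOn
      have hlt0 : u x0 < u z := (hN hx0.1.1).1.2 hx0.2 (by rintro rfl; exact hx0.1.2 hzi)
      refine ⟨u z - u x0, sub_pos.2 hlt0, fun x hx ↦ ?_⟩
      have : u x ≤ u x0 := hmax hx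
      linarith
  let f : M → ℝ := fun x ↦ u x + ε * w x
  have hf : SmoothFn I f := hu.add (contMDiff_const.mul hw)
  have hfz : f z = u z := by simp [f, hwz0]
  have hbd : ∀ x ∈ N \ interior N, f x ≤ f z := by
    intro x hx
    obtain ⟨⟨h1, -⟩, ⟨-, -⟩, h4, h5⟩ := hN hx.1
    change a * r x < 1 at h5
    rw [hfz]
    rcases le_or_gt (ρ x) (ρ z) with h6 | h6
    · have := hεu x ⟨hx, h6⟩
      have h7 : ε * w x ≤ ε * 1 := mul_le_mul_of_nonneg_left h4.le hε.le
      simp only [f]; linarith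
    · have h7 : 0 < r x := sub_pos.2 h6
      have h8 : w x ≤ 0 := by
        have : w x = -(r x * (1 - a * r x)) := by
          simp only [w, Pi.add_apply, Pi.neg_apply, Pi.mul_apply]; ring
        rw [this]
        have : 0 ≤ r x * (1 - a * r x) := mul_nonneg h7.le (by linarith)
        linarith
      have h9 : ε * w x ≤ 0 := mul_nonpos_of_nonneg_of_nonpos hε.le h8
      simp only [f]; linarith
  obtain ⟨y, hyi, hy⟩ : ∃ y ∈ interior N, ∀ x ∈ N, f x ≤ f y := by
    obtain ⟨x0, hx0, hmax⟩ := hNc.exists_isMaxOn ⟨z, hzN⟩ hf.continuous.continuousOn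
    by_cases hx : x0 ∈ interior N
    · exact ⟨x0, hx, hmax⟩
    · exact ⟨z, hzi, fun x hx' ↦ (hmax hx').trans (hbd x0 ⟨hx0, hx⟩)⟩
  have hmax : IsLocalMax f y := by
    filter_upwards [mem_interior_iff_mem_nhds.1 hyi] with x hx using hy x hx
  obtain ⟨-, ⟨h2, h3⟩, -⟩ := hN (interior_subset hyi)
  obtain ⟨η, hη, hη1, hpos, hη2⟩ := exists_gramTrace_eq he (hsymm y) (hnonneg y) h3
  rw [hη2 _ (isTensor_hess hD hw)] at h2
  have h4 : 0 < ∑ i, hess D w (η i) (η i) y := pos_of_mul_pos_right h2 hpos.le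
  have h5 : ∑ i, hess D f (η i) (η i) y ≤ 0 := by
    refine Finset.sum_nonpos fun i _ ↦ ?_
    rw [hess_apply, (along_of_isLocalMax hf hmax ((hη i).nabla hD (hη i))).1, sub_zero]
    exact (along_of_isLocalMax hf hmax (hη i)).2
  simp only [f, hess_add_const_mul hu hw ε (hη _), Finset.sum_add_distrib, huh y η hη hη1,
    ← Finset.mul_sum, zero_add] at h5
  exact absurd h5 (not_le.2 (mul_pos hε h4))

end Hessian

section MaximumPrinciple

/-- A ball around the midpoint of `y` and `z` whose boundary passes through `z` lies, apart from
`z`, in the open ball around `y`. -/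
theorem norm_sub_lt_of_midpoint {V : Type*} [NormedAddCommGroup V] [InnerProductSpace ℝ V]
    {x y z : V} (h : ‖x - (1 / 2 : ℝ) • (y + z)‖ ^ 2 ≤ ‖z - (1 / 2 : ℝ) • (y + z)‖ ^ 2) (hx : x ≠ z) :
    ‖x - y‖ < ‖z - y‖ := by
  have h1 := parallelogram_law_with_norm ℝ (x - (1 / 2 : ℝ) • (y + z)) ((1 / 2 : ℝ) • (z - y))
  have e1 : x - (1 / 2 : ℝ) • (y + z) + (1 / 2 : ℝ) • (z - y) = x - y := by module
  have e2 : x - (1 / 2 : ℝ) • (y + z) - (1 / 2 : ℝ) • (z - y) = x - z := by module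
  have e3 : z - (1 / 2 : ℝ) • (y + z) = (1 / 2 : ℝ) • (z - y) := by module
  have e4 : ‖(1 / 2 : ℝ) • (z - y)‖ = 1 / 2 * ‖z - y‖ := by rw [norm_smul]; norm_num
  rw [e1, e2, e4] at h1
  rw [e3, e4] at h
  have h2 : 0 < ‖x - z‖ := norm_pos_iff.2 (sub_ne_zero.2 hx)
  have h3 := norm_nonneg (z - y)
  have h4 := norm_nonneg (x - y)
  nlinarith

variable {m : ℕ} {B : Type*} [TopologicalSpace B] [T2Space B]
  [ChartedSpace (EuclideanSpace ℝ (Fin m)) B] [IsManifold (𝓡 m) ∞ B]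

/-- The set where a function attains its maximum is open, or is touched by a level set. -/
theorem exists_touching {u : B → ℝ} (hu : SmoothFn (𝓡 m) u) {p : B} (hmax : ∀ x, u x ≤ u p)
    (hp : {x | u x = u p} ∉ 𝓝 p) :
    ∃ (ρ : B → ℝ) (z : B), SmoothFn (𝓡 m) ρ ∧ mvfderiv (𝓡 m) ρ z ≠ 0 ∧ u z = u p ∧
      ∀ᶠ x in 𝓝 z, ρ x ≤ ρ z → x ≠ z → u x < u z := by
  set φ := extChartAt (𝓡 m) p with hφ
  have hto : IsOpen φ.target := isOpen_extChartAt_target p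
  have hso : IsOpen φ.source := isOpen_extChartAt_source p
  have hφc : ContinuousOn φ φ.source := continuousOn_extChartAt p
  have hφs : ContinuousOn φ.symm φ.target := continuousOn_extChartAt_symm p
  have hps : p ∈ φ.source := mem_extChartAt_source p
  have hpt : φ p ∈ φ.target := φ.map_source hps
  obtain ⟨R0, hR0, hR0t⟩ := Metric.isOpen_iff.1 hto _ hpt
  set R := R0 / 4 with hR
  have hRpos : 0 < R := by positivity
  have hRt : Metric.closedBall (φ p) (2 * R) ⊆ φ.target :=
    (Metric.closedBall_subset_ball (by linarith)).trans hR0t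
  have hW : φ.source ∩ φ ⁻¹' Metric.ball (φ p) R ∈ 𝓝 p :=
    (hφc.isOpen_inter_preimage hso Metric.isOpen_ball).mem_nhds ⟨hps, Metric.mem_ball_self hRpos⟩
  obtain ⟨x1, ⟨hx1s, hx1b⟩, hx1⟩ : ∃ x ∈ φ.source ∩ φ ⁻¹' Metric.ball (φ p) R, u x ≠ u p := by
    by_contra! hcon
    exact hp (Filter.mem_of_superset hW hcon)
  set y := φ x1 with hy
  have hyb : dist (φ p) y < R := by rw [dist_comm]; exact hx1b
  let K : Set (EuclideanSpace ℝ (Fin m)) :=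
    Metric.closedBall (φ p) (2 * R) ∩ (u ∘ φ.symm) ⁻¹' {u p}
  have huc : ContinuousOn (u ∘ φ.symm) (Metric.closedBall (φ p) (2 * R)) :=
    hu.continuous.comp_continuousOn (hφs.mono hRt)
  have hKc : IsCompact K := (isCompact_closedBall _ _).of_isClosed_subset
    (huc.preimage_isClosed_of_isClosed Metric.isClosed_closedBall isClosed_singleton)
    Set.inter_subset_left
  have hpK : φ p ∈ K := ⟨Metric.mem_closedBall_self (by linarith), by simp [φ.left_inv hps]⟩
  obtain ⟨ξ, hξK, hξ⟩ := hKc.exists_isMinOn ⟨_, hpK⟩ (f := fun x ↦ dist x y)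
    (continuous_id.dist continuous_const).continuousOn
  have hξle : ∀ x ∈ K, ‖ξ - y‖ ≤ ‖x - y‖ := fun x hx ↦ by
    rw [← dist_eq_norm, ← dist_eq_norm]; exact hξ hx
  have hξR : ‖ξ - y‖ < R := (hξle _ hpK).trans_lt (by rwa [← dist_eq_norm])
  have hξb : ξ ∈ Metric.ball (φ p) (2 * R) := by
    rw [Metric.mem_ball]
    calc dist ξ (φ p) ≤ dist ξ y + dist y (φ p) := dist_triangle _ _ _
      _ < R + R := add_lt_add (by rwa [dist_eq_norm]) (by rwa [dist_comm])
      _ = 2 * R := by ring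
  have hξt : ξ ∈ φ.target := hRt (Metric.ball_subset_closedBall hξb)
  have hξy : ξ ≠ y := by
    rintro h0
    have h1 : u (φ.symm ξ) = u p := hξK.2
    rw [h0, hy, φ.left_inv hx1s] at h1
    exact hx1 h1
  set z := φ.symm ξ with hz
  have hzs : z ∈ φ.source := φ.map_target hξt
  have hφz : φ z = ξ := φ.right_inv hξt
  have huz : u z = u p := hξK.2
  set c := (1 / 2 : ℝ) • (y + ξ) with hc
  let ρ0 : EuclideanSpace ℝ (Fin m) → ℝ := fun x ↦ ‖x - c‖ ^ 2
  have hρ0 : ContDiff ℝ ∞ ρ0 := (contDiff_id.sub contDiff_const).norm_sq ℝ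
  obtain ⟨ρ, hρ, hρe⟩ := exists_smoothFn_eventuallyEq (I := 𝓡 m) hso hzs (f := ρ0 ∘ φ)
    (hρ0.contMDiff.comp_contMDiffOn (by rw [hφ, extChartAt_source]; exact contMDiffOn_extChartAt))
  refine ⟨ρ, z, hρ, fun h0 ↦ ?_, huz, ?_⟩
  · have hsd : MDifferentiableAt (𝓡 m) (𝓡 m) φ.symm ξ :=
      ((contMDiffOn_extChartAt_symm (n := ∞) p).contMDiffAt (hto.mem_nhds hξt)).mdifferentiableAt
        (by simp)
    have h1 : ρ ∘ φ.symm =ᶠ[𝓝 ξ] ρ0 := by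
      have hcont : ContinuousAt φ.symm ξ := hφs.continuousAt (hto.mem_nhds hξt)
      filter_upwards [hcont.eventually hρe, hto.mem_nhds hξt] with x hx hxt
      rw [Function.comp_apply, hx, Function.comp_apply, φ.right_inv hxt]
    have h2 : mvfderiv (𝓡 m) (ρ ∘ φ.symm) ξ (ξ - c) =
        mvfderiv (𝓡 m) ρ z (mfderiv (𝓡 m) (𝓡 m) φ.symm ξ (ξ - c)) :=
      mvfderiv_comp_apply (f := φ.symm) ξ (hρ.mdiff z) hsd (ξ - c)
    rw [h0] at h2
    have h3 : mfderiv (𝓡 m) 𝓘(ℝ, ℝ) (ρ ∘ φ.symm) ξ (ξ - c) = 0 := h2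
    rw [h1.mfderiv_eq, mfderiv_eq_fderiv] at h3
    have h4 : HasFDerivAt ρ0 _ ξ := ((hasFDerivAt_id ξ).sub_const c).norm_sq
    have h5 : fderiv ℝ ρ0 ξ (ξ - c) = 0 := h3
    rw [h4.fderiv] at h5
    have h6 : ξ - c = 0 := by
      have h8 : inner ℝ (ξ - c) (ξ - c) = 0 := by
        rw [inner_sub_left]; simpa using h5
      exact inner_self_eq_zero.1 h8
    have h7 : ξ - c = (1 / 2 : ℝ) • (ξ - y) := by rw [hc]; module
    rw [h7] at h6
    exact hξy (sub_eq_zero.1 ((smul_eq_zero.1 h6).resolve_left (by norm_num)))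
  · have h1 : ∀ᶠ x in 𝓝 z, x ∈ φ.source ∩ φ ⁻¹' Metric.ball (φ p) (2 * R) :=
      (hφc.isOpen_inter_preimage hso Metric.isOpen_ball).mem_nhds ⟨hzs, by rw [Set.mem_preimage, hφz]; exact hξb⟩
    filter_upwards [h1, hρe] with x ⟨hxs, hxb⟩ hx hle hne
    rw [hx, hρe.self_of_nhds, Function.comp_apply, Function.comp_apply, hφz] at hle
    have hne' : φ x ≠ ξ := fun h ↦ hne (φ.injOn hxs hzs (h.trans hφz.symm))
    have h2 := norm_sub_lt_of_midpoint hle hne'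
    rw [huz]
    refine lt_of_le_of_ne (hmax x) fun heq ↦ ?_
    refine absurd (hξle (φ x) ⟨Metric.ball_subset_closedBall hxb, ?_⟩) (not_le.2 h2)
    simp [φ.left_inv hxs, heq]

/-- Harmonic functions on a compact connected Riemannian manifold are constant. -/
theorem IsHarmonic.const [CompactSpace B] [ConnectedSpace B] {q : BilinField (𝓡 m) B}
    {D : Connection (𝓡 m) B} (hq : SmoothOnFields q)
    (hsymm : ∀ x u w, q x u w = q x w u) (hnonneg : ∀ x u, 0 ≤ q x u u)
    (hdef : ∀ x u, q x u u = 0 → u = 0) (hD : SmoothConnection D) {u : B → ℝ}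
    (hu : SmoothFn (𝓡 m) u) (huh : IsHarmonic m q D u) : ∃ c, ∀ x, u x = c := by
  obtain ⟨p, -, hp⟩ := isCompact_univ.exists_isMaxOn Set.univ_nonempty hu.continuous.continuousOn
  have hmax : ∀ x, u x ≤ u p := fun x ↦ hp (Set.mem_univ x)
  have hcl : IsClosed {x | u x = u p} := isClosed_eq hu.continuous continuous_const
  have hop : IsOpen {x | u x = u p} := by
    rw [isOpen_iff_mem_nhds]
    intro x hx
    by_contra h0
    have hx' : u x = u p := hx
    rw [← hx'] at h0
    obtain ⟨ρ, z, hρ, hρz, huz, hlt⟩ := exists_touching hu (fun y ↦ (hmax y).trans hx'.ge) h0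
    exact huh.false_of_touching (by simp) hq hsymm hnonneg hdef hD hu hρ hρz
      (Filter.Eventually.of_forall fun y ↦ by rw [huz, hx']; exact hmax y) hlt
  have huniv : {x | u x = u p} = Set.univ := IsClopen.eq_univ ⟨hcl, hop⟩ ⟨p, rfl⟩
  exact ⟨u p, fun x ↦ by
    have : x ∈ {x | u x = u p} := by rw [huniv]; trivial
    exact this⟩

end MaximumPrinciple

section Projectable

variable {m : ℕ} {B : Type*} [TopologicalSpace B] [T2Space B]
  [ChartedSpace (EuclideanSpace ℝ (Fin m)) B] [IsManifold (𝓡 m) ∞ B]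

/-- If `X` projects to `K`, then `[X, Y]` projects to `[K, Y]` for every field `Y` of the base. -/
theorem hor_bracket_liftField {X : VField (model m) (B × ℝ)} (hX : SmoothField (model m) X)
    {K Y : VField (𝓡 m) B} (hK : SmoothField (𝓡 m) K) (hXK : ∀ p, hor (X p) = K p.1)
    (hY : SmoothField (𝓡 m) Y) (p : B × ℝ) :
    hor (bracket (model m) X (liftField Y) p) = bracket (𝓡 m) K Y p.1 := by
  have hXf : ∀ {f : B → ℝ}, SmoothFn (𝓡 m) f →
      along (model m) X (fun p ↦ f p.1) = fun p ↦ along (𝓡 m) K f p.1 := by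
    intro f hf
    rw [along_comp_fst _ hf]
    funext p
    rw [hXK]; rfl
  refine tangent_ext (I := 𝓡 m) fun f hf ↦ ?_
  rw [hor_bracket_apply hX hY.liftField p hf, hXf hf, along_liftField_comp_fst _ hf,
    along_liftField_comp_fst _ (smoothFn_along hK hf), hXf (smoothFn_along hY hf)]
  exact (congrFun (along_bracket hK hY hf) p.1).symm

/-- The vector field with components `K` along `B` and `a v + b` along `ℝ`. -/
def affineField (K : VField (𝓡 m) B) (a b : B → ℝ) : VField (model m) (B × ℝ) :=
  liftField K + (fun p : B × ℝ ↦ a p.1 * p.2 + b p.1) • vertical m B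

variable {K : VField (𝓡 m) B} {a b : B → ℝ}

@[simp] theorem hor_affineField (p : B × ℝ) : hor (affineField K a b p) = K p.1 := by
  simp [affineField]

@[simp] theorem ver_affineField (p : B × ℝ) : ver (affineField K a b p) = a p.1 * p.2 + b p.1 := by
  simp [affineField]

theorem smoothFn_affine (ha : SmoothFn (𝓡 m) a) (hb : SmoothFn (𝓡 m) b) :
    SmoothFn (model m) (fun p : B × ℝ ↦ a p.1 * p.2 + b p.1) :=
  ((smoothFn_comp_fst ha).mul smoothFn_snd).add (smoothFn_comp_fst hb)

theorem SmoothField.affineField (hK : SmoothField (𝓡 m) K) (ha : SmoothFn (𝓡 m) a)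
    (hb : SmoothFn (𝓡 m) b) : SmoothField (model m) (affineField K a b) :=
  hK.liftField.add (smoothField_vertical.smul (smoothFn_affine ha hb))

end Projectable

namespace MaximalAnalyticExtension

variable {m : ℕ} {B : Type*} [TopologicalSpace B] [T2Space B]
  [ChartedSpace (EuclideanSpace ℝ (Fin m)) B] [IsManifold (𝓡 m) ∞ B]
  {M : Type*} [TopologicalSpace M] [T2Space M]
  [ChartedSpace (EuclideanSpace ℝ (Fin (m + 2))) M] [IsManifold (𝓡 (m + 2)) ∞ M]
  {S : Spacetime m M} {h : NonExpandingHorizon S B} (A : MaximalAnalyticExtension h.q h.D)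

theorem smoothFn_snd_incl : SmoothFn (model m) (fun p ↦ (A.incl p).2) :=
  smoothFn_snd.comp A.contMDiff_incl

theorem along_snd_incl (W : VField (model m) (B × ℝ)) (p : B × ℝ) :
    along (model m) W (fun p ↦ (A.incl p).2) p =
      ver (mfderiv (model m) (model m) A.incl p (W p)) := by
  have h1 := mvfderiv_comp_apply (I := model m) (I' := model m) p (smoothFn_snd.mdiff (A.incl p))
    ((A.contMDiff_incl p).mdifferentiableAt (by simp)) (W p)
  rw [mvfderiv_snd] at h1
  exact h1

theorem along_pull_vertical_snd_incl (p : B × ℝ) :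
    along (model m) (A.pull (vertical m B)) (fun p ↦ (A.incl p).2) p = 1 := by
  rw [A.along_snd_incl, A.mfderiv_pull]; rfl

theorem hor_pull_vertical (p : B × ℝ) : hor (A.pull (vertical m B) p) = 0 := A.hor_pull _ p

theorem eq_of_along_pull_vertical_eq_zero {f : B × ℝ → ℝ} (hf : SmoothFn (model m) f)
    (h0 : ∀ p, along (model m) (A.pull (vertical m B)) f p = 0) (p : B × ℝ) :
    f p = f (p.1, 0) := by
  refine eq_of_along_vertical_eq_zero hf (fun r ↦ ?_) p.1 p.2 0
  obtain ⟨c, -, hc⟩ := A.mfderiv_vertical r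
  have h1 : vertical m B r = c • A.pull (vertical m B) r :=
    A.mfderiv_injective r (by rw [hc, map_smul, A.mfderiv_pull])
  have h2 := h0 r
  simp only [along] at h2 ⊢
  rw [h1, map_smul, h2, smul_zero]

theorem nabla_pull_vertical :
    nabla h.D (A.pull (vertical m B)) (A.pull (vertical m B)) = 0 := by
  funext p
  refine A.mfderiv_injective p ?_
  rw [← A.mfderiv_nabla_pull smoothField_vertical, A.affine]
  exact (map_zero _).symm

variable {X : VField (model m) (B × ℝ)}

theorem hor_bracket_pull_vertical (hX : SmoothField (model m) X)
    (hXq : LieDragged (model m) X h.q) (p : B × ℝ) :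
    hor (bracket (model m) X (A.pull (vertical m B)) p) = 0 := by
  have hξ := A.smooth_pull (smoothField_vertical (m := m) (B := B))
  have hb := hX.bracket hξ
  have h1 := hXq _ _ hξ hb p
  have h2 : (fun y ↦ h.q y (A.pull (vertical m B) y)
      (bracket (model m) X (A.pull (vertical m B)) y)) = fun _ ↦ 0 :=
    funext fun y ↦ A.q_pull_vertical y _
  rw [lieBilin, h2, along_const, A.q_pull_vertical, A.q_apply, ← A.baseMetric_eq] at h1
  exact A.baseMetric_definite _ _ (by simpa using h1)

/-- A symmetry of the horizon extends to the field `K + (a v + b) ∂_v` of the extension, where `K`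
is a vector field and `a`, `b` are functions on the base. -/
theorem exists_affineField (hX : IsInfinitesimalSymmetry h.q h.D X) :
    ∃ (K : VField (𝓡 m) B) (a b : B → ℝ), SmoothField (𝓡 m) K ∧ SmoothFn (𝓡 m) a ∧
      SmoothFn (𝓡 m) b ∧ (∀ p, hor (X p) = K p.1) ∧
      ∀ p, mfderiv (model m) (model m) A.incl p (X p) = affineField K a b (A.incl p) := by
  obtain ⟨hXs, -, hXq, hXD⟩ := hX
  set ξ := A.pull (vertical m B) with hξdef
  set F : B × ℝ → ℝ := fun p ↦ (A.incl p).2 with hF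
  have hFs : SmoothFn (model m) F := A.smoothFn_snd_incl
  have hξ : SmoothField (model m) ξ := A.smooth_pull (smoothField_vertical (m := m) (B := B))
  have hξF : along (model m) ξ F = fun _ ↦ 1 := funext A.along_pull_vertical_snd_incl
  have hbr := hXs.bracket hξ
  let a' : B × ℝ → ℝ := -along (model m) (bracket (model m) X ξ) F
  have ha' : SmoothFn (model m) a' := (smoothFn_along hbr hFs).neg
  have hbr_eq : bracket (model m) X ξ = -(a' • ξ) := by
    funext p
    refine A.mfderiv_injective p ?_
    have h1 : hor (mfderiv (model m) (model m) A.incl p (bracket (model m) X ξ p)) = 0 := by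
      rw [A.hor_mfderiv]; exact A.hor_bracket_pull_vertical hXs hXq p
    rw [eq_smul_vertical_of_hor_eq_zero h1, ← A.along_snd_incl, Pi.neg_apply, Pi.smul_apply',
      map_neg, map_smul, A.mfderiv_pull]
    simp [a', hF]
  have hξa : ∀ p, along (model m) ξ a' p = 0 := by
    intro p
    have h1 := hXD ξ ξ hξ hξ p
    have h2 : nabla h.D ξ ξ = 0 := A.nabla_pull_vertical
    have h3 : bracket (model m) X (0 : VField (model m) (B × ℝ)) = 0 := by
      have := bracket_const_smul_right (X := X) 0 hξ
      simpa only [zero_smul] using this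
    simp only [lieConn] at h1
    rw [h2, h3, hbr_eq, nabla_neg_left, nabla_smul_left, h2, nabla_neg_right (hξ.smul ha'),
      nabla_smul_right ha' hξ, h2] at h1
    have h4 : along (model m) ξ a' p • ξ p = 0 := by simpa using h1
    refine (smul_eq_zero.1 h4).resolve_right fun h0 ↦ ?_
    have h5 := A.mfderiv_pull (vertical m B) p
    rw [← hξdef, h0, map_zero] at h5
    exact NonExpandingHorizon.vertical_ne_zero _ h5.symm
  have hbrX : ∀ {f : B × ℝ → ℝ}, SmoothFn (model m) f → ∀ p,
      along (model m) ξ (along (model m) X f) p =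
        along (model m) X (along (model m) ξ f) p + a' p * along (model m) ξ f p := by
    intro f hf p
    have h1 := congrFun (along_bracket hXs hξ hf) p
    rw [hbr_eq] at h1
    have h2 : along (model m) (-(a' • ξ)) f p = -(a' p * along (model m) ξ f p) := by
      simp [along]
    rw [h2, Pi.sub_apply] at h1
    linarith
  let b' : B × ℝ → ℝ := along (model m) X F - a' * F
  have hXF := smoothFn_along hXs hFs
  have hb' : SmoothFn (model m) b' := hXF.sub (ha'.mul hFs)
  have hξb : ∀ p, along (model m) ξ b' p = 0 := by
    intro p
    have h1 := hbrX hFs p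
    rw [hξF, along_const] at h1
    have haF : SmoothFn (model m) (a' * F) := ha'.mul hFs
    simp only [b', along_sub hXF haF, along_mul ha' hFs, hξF, Pi.sub_apply, Pi.add_apply,
      Pi.mul_apply, hξa, h1, Pi.zero_apply]
    ring
  have hK : ∀ p, hor (X p) = (hor (X (p.1, 0)) : EuclideanSpace ℝ (Fin m)) := by
    intro p
    refine tangent_ext (I := 𝓡 m) (p := p.1) fun f hf ↦ ?_
    have hξf : along (model m) ξ (fun p ↦ f p.1) = fun _ ↦ 0 := by
      rw [along_comp_fst _ hf]
      funext p
      rw [A.hor_pull_vertical, map_zero]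
    have h1 := A.eq_of_along_pull_vertical_eq_zero (smoothFn_along hXs (smoothFn_comp_fst hf))
      (fun p ↦ by
        have := hbrX (smoothFn_comp_fst hf) p
        rw [hξf, along_const] at this
        simpa using this) p
    rw [along_comp_fst _ hf] at h1
    exact h1
  refine ⟨fun x ↦ hor (X (x, 0)), fun x ↦ a' (x, 0), fun x ↦ b' (x, 0), hXs.hor_slice 0,
    smoothFn_slice ha' 0, smoothFn_slice hb' 0, hK, fun p ↦ tangent_prod_ext ?_ ?_⟩
  · rw [A.hor_mfderiv, hK p]
    have h1 := A.incl_fst p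
    generalize A.incl p = r at h1
    obtain ⟨x, v⟩ := p
    obtain ⟨y, s⟩ := r
    obtain rfl : y = x := h1
    simp
  · rw [← A.along_snd_incl, ver_affineField, A.incl_fst, ← A.eq_of_along_pull_vertical_eq_zero ha' hξa,
      ← A.eq_of_along_pull_vertical_eq_zero hb' hξb]
    simp only [b', Pi.sub_apply, Pi.mul_apply, hF]
    ring

/-- The projection of a symmetry to the base is a Killing field. -/
theorem isKilling_of_symmetry (A : MaximalAnalyticExtension h.q h.D)
    (hX : SmoothField (model m) X) (hXq : LieDragged (model m) X h.q)
    {K : VField (𝓡 m) B} (hK : SmoothField (𝓡 m) K) (hXK : ∀ p, hor (X p) = K p.1) :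
    IsKilling (baseMetric h.q) K := by
  refine ⟨hK, fun Y Z hY hZ x ↦ ?_⟩
  have h1 := hXq _ _ hY.liftField hZ.liftField (x, 0)
  have hg := A.smoothOnFields_baseMetric.smoothFn hY hZ
  have h2 : (fun y ↦ h.q y (liftField Y y) (liftField Z y)) =
      fun p ↦ baseMetric h.q p.1 (Y p.1) (Z p.1) := by
    funext p
    rw [A.q_apply, ← A.baseMetric_eq]; rfl
  rw [lieBilin, h2, along_comp_fst _ hg, A.q_apply, A.q_apply, ← A.baseMetric_eq,
    hor_bracket_liftField hX hK hXK hY, hor_bracket_liftField hX hK hXK hZ] at h1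
  simp only at h1
  rw [hXK] at h1
  exact h1

theorem relatedNear_of_eq {W : VField (model m) (B × ℝ)}
    (hXW : ∀ p, mfderiv (model m) (model m) A.incl p (X p) = W (A.incl p)) (p : B × ℝ) :
    RelatedNear A.incl p X W := Filter.Eventually.of_forall fun r ↦ (hXW r).symm

theorem lieConn_eq_zero_of_symmetry (hX : IsInfinitesimalSymmetry h.q h.D X)
    {W : VField (model m) (B × ℝ)} (hW : SmoothField (model m) W)
    (hXW : ∀ p, mfderiv (model m) (model m) A.incl p (X p) = W (A.incl p))
    {Y Z : VField (model m) (B × ℝ)} (hY : SmoothField (model m) Y) (hZ : SmoothField (model m) Z)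
    (p : B × ℝ) : lieConn W A.DExt Y Z (A.incl p) = 0 := by
  have h1 := (RelatedNear.lieConn A.contMDiff_incl A.restrict_D h.smooth_D A.smooth_DExt hX.1
    (A.smooth_pull hY) (A.smooth_pull hZ) hW hY hZ (A.relatedNear_of_eq hXW p) (A.related_pull Y p)
    (A.related_pull Z p)).self_of_nhds
  rw [h1, hX.2.2.2 _ _ (A.smooth_pull hY) (A.smooth_pull hZ), map_zero]

end MaximalAnalyticExtension

section NullTensors

variable {m : ℕ} {B : Type*} [TopologicalSpace B] [T2Space B]
  [ChartedSpace (EuclideanSpace ℝ (Fin m)) B] [IsManifold (𝓡 m) ∞ B]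
  {g : BilinField (𝓡 m) B} {r : CovField (𝓡 m) B} {q : BilinField (model m) (B × ℝ)}
  {D : Connection (model m) (B × ℝ)}

/-- A tensor which annihilates the vertical vectors only depends on horizontal components. -/
theorem IsTensor.congr_of_hor_eq {c : VField (model m) (B × ℝ) → VField (model m) (B × ℝ) → B × ℝ → ℝ}
    (hc : IsTensor c) {p : B × ℝ}
    (hv : ∀ Z, SmoothField (model m) Z → c (vertical m B) Z p = 0)
    {Y Y' Z : VField (model m) (B × ℝ)} (hY : SmoothField (model m) Y)
    (hY' : SmoothField (model m) Y') (hZ : SmoothField (model m) Z) (h : hor (Y p) = hor (Y' p)) :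
    c Y Z p = c Y' Z p := by
  have hs := smoothField_vertical (m := m) (B := B)
  have h1 : Y p = (Y' + (fun _ : B × ℝ ↦ ver (Y p) - ver (Y' p)) • vertical m B) p :=
    tangent_prod_ext (by simp [h]) (by simp)
  have hs' := hs.smul (f := fun _ : B × ℝ ↦ ver (Y p) - ver (Y' p)) contMDiff_const
  rw [hc.congr hY hZ (hY'.add hs') hZ h1 rfl, hc.add_left hY' hs' hZ,
    hc.smul_left contMDiff_const hs hZ]
  simp [hv Z hZ]

namespace IsStationaryGeometry

theorem apply_vertical (G : IsStationaryGeometry g r q D) (p : B × ℝ) (u : TangentSpace (model m) p) :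
    q p (vertical m B p) u = 0 := by
  rw [G.q_apply, hor_vertical]; simp

theorem symm' (G : IsStationaryGeometry g r q D) (p : B × ℝ) (u w : TangentSpace (model m) p) :
    q p u w = q p w u := by rw [G.q_apply, G.q_apply, G.symm]

theorem nonneg' (G : IsStationaryGeometry g r q D) (p : B × ℝ) (u : TangentSpace (model m) p) :
    0 ≤ q p u u := by rw [G.q_apply]; exact G.nonneg _ _

theorem orthonormalAt_slice (G : IsStationaryGeometry g r q D) {k : ℕ}
    {e : Fin k → VField (model m) (B × ℝ)} {p : B × ℝ} (he : OrthonormalAt q e p) :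
    OrthonormalAt g (fun i x ↦ hor (e i (x, p.2))) p.1 := fun i j ↦ by
  rw [← he i j, G.q_apply]

theorem orthonormalAt_liftField (G : IsStationaryGeometry g r q D) {k : ℕ}
    {e : Fin k → VField (𝓡 m) B} {p : B × ℝ} (he : OrthonormalAt g e p.1) :
    OrthonormalAt q (fun i ↦ liftField (e i)) p := fun i j ↦ by
  rw [← he i j, G.q_apply]; rfl

/-- Expansion of the first argument of a tensor which annihilates the vertical vectors. -/
theorem eq_sum (G : IsStationaryGeometry g r q D)
    {c : VField (model m) (B × ℝ) → VField (model m) (B × ℝ) → B × ℝ → ℝ}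
    (hc : IsTensor c) {p : B × ℝ} (hv : ∀ Z, SmoothField (model m) Z → c (vertical m B) Z p = 0)
    {e : Fin m → VField (model m) (B × ℝ)} (he : ∀ i, SmoothField (model m) (e i))
    (hep : OrthonormalAt q e p) {Y Z : VField (model m) (B × ℝ)} (hY : SmoothField (model m) Y)
    (hZ : SmoothField (model m) Z) : c Y Z p = ∑ j, q p (Y p) (e j p) * c (e j) Z p := by
  have h1 := (G.orthonormalAt_slice hep).sum_smul finrank_euclideanSpace_fin (hor (Y p))
  have hs : SmoothField (model m) (∑ j, q p (Y p) (e j p) • e j) :=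
    SmoothField.sum _ fun j ↦ (he j).const_smul _
  rw [hc.congr_of_hor_eq hv hY hs hZ, hc.sum_left he _ hZ]
  · simp
  · rw [h1, Finset.sum_apply, hor_sum]
    simp [G.q_apply]

/-- The part along `ℝ` of `[𝓛_W, D]`. -/
def _root_.Horizon.verLieConn (D : Connection (model m) (B × ℝ)) (W Y Z : VField (model m) (B × ℝ))
    (p : B × ℝ) : ℝ := ver (lieConn W D Y Z p)

theorem _root_.Horizon.isTensor_verLieConn (hD : SmoothConnection D) {W : VField (model m) (B × ℝ)}
    (hW : SmoothField (model m) W) : IsTensor (verLieConn D W) where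
  smoothFn hY hZ := (hW.lieConn hD hY hZ).smoothFn_ver
  add_left hY hY' hZ := by
    funext p; simp [verLieConn, lieConn_add_left hD hY hY' hZ]
  add_right hY hZ hZ' := by
    funext p; simp [verLieConn, lieConn_add_right hD hW hZ hZ' hY]
  smul_left hf hY hZ := by
    funext p; simp [verLieConn, lieConn_smul_left hD hf hY hZ]
  smul_right hf hY hZ := by
    funext p; simp [verLieConn, lieConn_smul_right hD hf hW hY hZ]

theorem nabla_vertical_left (G : IsStationaryGeometry g r q D) {Z : VField (𝓡 m) B}
    (hZ : SmoothField (𝓡 m) Z) (p : B × ℝ) :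
    nabla D (vertical m B) (liftField Z) p = r p.1 (Z p.1) • vertical m B p := by
  have h1 := congrFun (G.leviCivita.torsion smoothField_vertical hZ.liftField) p
  rw [bracket_vertical_liftField hZ] at h1
  have h2 := sub_eq_zero.1 (h1.trans rfl)
  rw [h2]; exact G.nabla_vertical p _

theorem smoothFn_rotation (G : IsStationaryGeometry g r q D) {Z : VField (𝓡 m) B}
    (hZ : SmoothField (𝓡 m) Z) : SmoothFn (𝓡 m) (fun x ↦ r x (Z x)) := by
  have h1 := smoothFn_slice ((hZ.liftField.nabla G.leviCivita.1 smoothField_vertical).smoothFn_ver) 0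
  have h2 : (fun x ↦ ver (nabla D (liftField Z) (vertical m B) (x, (0 : ℝ)))) =
      fun x ↦ r x (Z x) := by
    funext x
    rw [nabla, G.nabla_vertical]; simp
  rwa [h2] at h1

variable {f : B × ℝ → ℝ}

theorem nabla_smul_vertical (G : IsStationaryGeometry g r q D) (hf : SmoothFn (model m) f)
    (Y : VField (model m) (B × ℝ)) :
    nabla D Y (f • vertical m B) =
      (along (model m) Y f + f * fun p ↦ r p.1 (hor (Y p))) • vertical m B := by
  rw [nabla_smul_right hf smoothField_vertical]
  funext p
  simp only [Pi.add_apply, Pi.smul_apply', Pi.mul_apply, add_smul, mul_smul]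
  congr 2
  exact G.nabla_vertical p _

theorem lieDragged_smul_vertical (G : IsStationaryGeometry g r q D) (hf : SmoothFn (model m) f) :
    LieDragged (model m) (f • vertical m B) q := by
  have hW := (smoothField_vertical (m := m) (B := B)).smul hf
  have key : ∀ {Y Z : VField (model m) (B × ℝ)}, SmoothField (model m) Y → ∀ p,
      q p (bracket (model m) (f • vertical m B) Y p) (Z p) =
        q p (nabla D (f • vertical m B) Y p) (Z p) := by
    intro Y Z hY p
    rw [← G.leviCivita.torsion hW hY, G.nabla_smul_vertical hf, Pi.sub_apply, Pi.smul_apply',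
      map_sub, map_smul, sub_apply, smul_apply, G.apply_vertical, smul_zero, sub_zero]
  intro Y Z hY hZ p
  rw [lieBilin, key hY, G.symm' p (Y p), key hZ, G.leviCivita.metric hW hY hZ, G.symm' p (Y p)]
  ring

theorem hor_lieConn_smul_vertical (G : IsStationaryGeometry g r q D) (hf : SmoothFn (model m) f)
    {Y Z : VField (model m) (B × ℝ)} (hY : SmoothField (model m) Y) (hZ : SmoothField (model m) Z)
    (p : B × ℝ) : hor (lieConn (f • vertical m B) D Y Z p) = 0 := by
  have hW := (smoothField_vertical (m := m) (B := B)).smul hf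
  have h1 := G.leviCivita.lieConn_orthogonal G.smooth_q G.symm' hW
    (G.lieDragged_smul_vertical hf) hY hZ (hW.lieConn G.leviCivita.1 hY hZ) p
  rw [G.q_apply] at h1
  exact G.definite _ _ h1

theorem lieConn_smul_vertical (G : IsStationaryGeometry g r q D) (hf : SmoothFn (model m) f)
    {Y Z : VField (model m) (B × ℝ)} (hY : SmoothField (model m) Y) (hZ : SmoothField (model m) Z) :
    lieConn (f • vertical m B) D Y Z = verLieConn D (f • vertical m B) Y Z • vertical m B :=
  funext fun p ↦ eq_smul_vertical_of_hor_eq_zero (G.hor_lieConn_smul_vertical hf hY hZ p)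

theorem verLieConn_vertical_right (G : IsStationaryGeometry g r q D) (hf : SmoothFn (model m) f)
    {b : ℝ} (hfb : along (model m) (vertical m B) f = fun _ ↦ b)
    {Z : VField (model m) (B × ℝ)} (hZ : SmoothField (model m) Z) (p : B × ℝ) :
    verLieConn D (f • vertical m B) Z (vertical m B) p = 0 := by
  have hv := smoothField_vertical (m := m) (B := B)
  have hW := hv.smul hf
  have hD := G.leviCivita.1
  have hc := isTensor_verLieConn hD hW
  have hbr : bracket (model m) (f • vertical m B) (vertical m B) = (fun _ : B × ℝ ↦ -b) • vertical m B := by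
    rw [bracket_smul_left hf hv, bracket_self, hfb]
    funext p; simp
  have hvv : nabla D (vertical m B) (vertical m B) = 0 := by
    funext p
    have := G.nabla_vertical p (vertical m B p)
    simpa using! this
  have hconst : ∀ {Y : VField (model m) (B × ℝ)}, nabla D Y ((fun _ : B × ℝ ↦ -b) • vertical m B) =
      (fun _ : B × ℝ ↦ -b) • nabla D Y (vertical m B) := by
    intro Y
    rw [nabla_smul_right contMDiff_const hv, along_const]; simp
  have h0 : ∀ X : VField (model m) (B × ℝ), bracket (model m) X (0 : VField (model m) (B × ℝ)) = 0 := by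
    intro X; simp
  have h1 : verLieConn D (f • vertical m B) (vertical m B) (vertical m B) p = 0 := by
    rw [verLieConn, lieConn_eq, hbr, hconst, hvv, h0, nabla_smul_left, hvv]
    simp
  obtain ⟨Y, hY, hYp⟩ := exists_basicField_apply p (Z p)
  rw [hc.congr hZ hv (hY.basicField _) hv hYp.symm rfl, basicField,
    hc.add_left hY.liftField (hv.const_smul _) hv]
  have h2 : (ver (Z p)) • vertical m B = (fun _ : B × ℝ ↦ ver (Z p)) • vertical m B := rfl
  rw [h2, hc.smul_left contMDiff_const hv hv]
  simp only [Pi.add_apply, Pi.mul_apply, h1, mul_zero, add_zero]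
  have hr := smoothFn_comp_fst (G.smoothFn_rotation hY)
  have h3 : nabla D (liftField Y) (vertical m B) = (fun p : B × ℝ ↦ r p.1 (Y p.1)) • vertical m B :=
    funext fun p ↦ G.nabla_vertical p _
  have h4 : bracket (model m) (f • vertical m B) (liftField Y) =
      -(along (model m) (liftField Y) f • vertical m B) := by
    rw [bracket_smul_left hf hv, bracket_vertical_liftField hY]; simp
  rw [verLieConn, lieConn_eq, h3, hbr, hconst, h3, h4, nabla_neg_left, nabla_smul_left, hvv,
    bracket_smul_right hr hv, hbr, along_smul_left, along_vertical_comp_fst (G.smoothFn_rotation hY)]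
  simp
  ring

theorem verLieConn_vertical_left (G : IsStationaryGeometry g r q D) (hf : SmoothFn (model m) f)
    {b : ℝ} (hfb : along (model m) (vertical m B) f = fun _ ↦ b)
    {Z : VField (model m) (B × ℝ)} (hZ : SmoothField (model m) Z) (p : B × ℝ) :
    verLieConn D (f • vertical m B) (vertical m B) Z p = 0 := by
  have hv := smoothField_vertical (m := m) (B := B)
  rw [← G.verLieConn_vertical_right hf hfb hZ p, verLieConn, verLieConn,
    G.leviCivita.lieConn_symm (hv.smul hf) hv hZ]

theorem verLieConn_base (G : IsStationaryGeometry g r q D) {φ : B → ℝ} (hφ : SmoothFn (𝓡 m) φ)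
    {Y Z : VField (𝓡 m) B} (hY : SmoothField (𝓡 m) Y) (hZ : SmoothField (𝓡 m) Z) (p : B × ℝ) :
    verLieConn D ((fun p : B × ℝ ↦ φ p.1) • vertical m B) (liftField Y) (liftField Z) p =
      φ p.1 * along (model m) (vertical m B)
        (fun p ↦ ver (nabla D (liftField Y) (liftField Z) p)) p
      - mvfderiv (𝓡 m) φ p.1 (hor (nabla D (liftField Y) (liftField Z) p))
      + along (𝓡 m) Y φ p.1 * r p.1 (Z p.1) + along (𝓡 m) Y (along (𝓡 m) Z φ) p.1
      + along (𝓡 m) Z φ p.1 * r p.1 (Y p.1) := by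
  have hv := smoothField_vertical (m := m) (B := B)
  have hf := smoothFn_comp_fst hφ
  have hT := hY.liftField.nabla G.leviCivita.1 hZ.liftField
  have hbr : ∀ {Z : VField (𝓡 m) B}, SmoothField (𝓡 m) Z →
      bracket (model m) ((fun p : B × ℝ ↦ φ p.1) • vertical m B) (liftField Z) =
      -((fun p : B × ℝ ↦ along (𝓡 m) Z φ p.1) • vertical m B) := by
    intro Z hZ
    rw [bracket_smul_left hf hv, bracket_vertical_liftField hZ, along_liftField_comp_fst _ hφ]
    simp
  have h2 := smoothFn_comp_fst (smoothFn_along hZ hφ)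
  rw [verLieConn, lieConn_eq, hbr hY, hbr hZ, nabla_neg_left, nabla_neg_right (hv.smul h2),
    G.nabla_smul_vertical h2, nabla_smul_left, bracket_smul_left hf hv,
    along_liftField_comp_fst _ (smoothFn_along hZ hφ), along_comp_fst _ hφ]
  have h3 := ver_bracket hv hT p
  simp only [ver_vertical, along_const] at h3
  simp only [Pi.sub_apply, Pi.neg_apply, Pi.add_apply, Pi.smul_apply', Pi.mul_apply, ver_sub, ver_neg,
    ver_smul, ver_vertical, h3, G.nabla_vertical_left hZ, hor_liftField, Pi.zero_apply]
  ring

theorem analytic_verLieConn_base (G : IsStationaryGeometry g r q D) {φ : B → ℝ}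
    (hφ : SmoothFn (𝓡 m) φ) {Y Z : VField (𝓡 m) B} (hY : SmoothField (𝓡 m) Y)
    (hZ : SmoothField (𝓡 m) Z) (x : B) : AnalyticOnNhd ℝ (fun v ↦
      verLieConn D ((fun p : B × ℝ ↦ φ p.1) • vertical m B) (liftField Y) (liftField Z) (x, v)) Set.univ := by
  simp only [G.verLieConn_base hφ hY hZ]
  have h1 := G.analytic Y Z hY hZ x
  have h2 : AnalyticOnNhd ℝ (fun v ↦ ver (nabla D (liftField Y) (liftField Z) (x, v))) Set.univ :=
    (ContinuousLinearMap.snd ℝ (EuclideanSpace ℝ (Fin m)) ℝ).comp_analyticOnNhd h1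
  have h3 : AnalyticOnNhd ℝ (fun v ↦ mvfderiv (𝓡 m) φ x
      (hor (nabla D (liftField Y) (liftField Z) (x, v)))) Set.univ :=
    ((show EuclideanSpace ℝ (Fin m) →L[ℝ] ℝ from mvfderiv (𝓡 m) φ x).comp
      (ContinuousLinearMap.fst ℝ (EuclideanSpace ℝ (Fin m)) ℝ)).comp_analyticOnNhd h1
  have h4 : (fun v ↦ along (model m) (vertical m B)
      (fun p ↦ ver (nabla D (liftField Y) (liftField Z) p)) (x, v)) =
      deriv (fun v ↦ ver (nabla D (liftField Y) (liftField Z) (x, v))) := by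
    funext v
    exact ((hasDerivAt_along_vertical (hY.liftField.nabla G.leviCivita.1 hZ.liftField).smoothFn_ver
      x v).deriv).symm
  have h5 : AnalyticOnNhd ℝ (fun v ↦ along (model m) (vertical m B)
      (fun p ↦ ver (nabla D (liftField Y) (liftField Z) p)) (x, v)) Set.univ := h4 ▸ h2.deriv
  exact (((((analyticOnNhd_const (v := φ x)).mul h5).sub h3).add
    (analyticOnNhd_const (v := along (𝓡 m) Y φ x * r x (Z x)))).add
    (analyticOnNhd_const (v := along (𝓡 m) Y (along (𝓡 m) Z φ) x))).add
    (analyticOnNhd_const (v := along (𝓡 m) Z φ x * r x (Y x)))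

end IsStationaryGeometry

end NullTensors

section NaturalFields

variable {m : ℕ} {B : Type*} [TopologicalSpace B] [T2Space B]
  [ChartedSpace (EuclideanSpace ℝ (Fin m)) B] [IsManifold (𝓡 m) ∞ B]
  {g : BilinField (𝓡 m) B} {r : CovField (𝓡 m) B} {q : BilinField (model m) (B × ℝ)}
  {D : Connection (model m) (B × ℝ)}

/-- A natural field is `(v - v₀) ∂_v`, for a function `v₀` on the base. -/
theorem IsStationaryGeometry.exists_of_isNatural (G : IsStationaryGeometry g r q D)
    {ℓ : VField (model m) (B × ℝ)} (hn : IsNatural q D ℓ) :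
    ∃ v₀ : B → ℝ, SmoothFn (𝓡 m) v₀ ∧ ℓ = (fun p : B × ℝ ↦ p.2 - v₀ p.1) • vertical m B := by
  obtain ⟨hℓ, hnull⟩ := hn.null
  set f : B × ℝ → ℝ := fun p ↦ ver (ℓ p) with hf
  have hfs : SmoothFn (model m) f := hℓ.smoothFn_ver
  have hv := smoothField_vertical (m := m) (B := B)
  have hℓf : ℓ = f • vertical m B := funext fun p ↦
    eq_smul_vertical_of_hor_eq_zero (G.definite _ _ (by rw [← G.q_apply]; exact hnull p))
  have h1 : ∀ p, f p * (along (model m) (vertical m B) f p - 1) = 0 := by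
    intro p
    have h2 := congrArg (fun u ↦ ver u) (hn.surface_gravity p)
    rw [hℓf, G.nabla_smul_vertical hfs, along_smul_left] at h2
    simp at h2
    linarith
  have h2 : ∀ p, along (model m) (vertical m B) f p = 1 := by
    have hc : IsClosed {p | along (model m) (vertical m B) f p = 1} :=
      isClosed_eq (smoothFn_along hv hfs).continuous continuous_const
    intro p
    refine hc.closure_subset_iff.2 (fun y hy ↦ ?_) (hn.dense p)
    refine sub_eq_zero.1 ((mul_eq_zero.1 (h1 y)).resolve_left fun h0 ↦ hy ?_)
    rw [hℓf, Pi.smul_apply', h0, zero_smul]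
  have h3 : ∀ p, along (model m) (vertical m B) (f - Prod.snd) p = 0 := fun p ↦ by
    rw [along_sub hfs smoothFn_snd, along_snd, Pi.sub_apply, h2]; simp
  refine ⟨fun x ↦ -f (x, 0), (smoothFn_slice hfs 0).neg, hℓf.trans ?_⟩
  congr 1
  funext p
  have := eq_of_along_vertical_eq_zero (hfs.sub smoothFn_snd) h3 p.1 p.2 0
  simp only at this
  linarith

theorem smoothFn_snd_sub {v₀ : B → ℝ} (hv₀ : SmoothFn (𝓡 m) v₀) :
    SmoothFn (model m) (fun p : B × ℝ ↦ p.2 - v₀ p.1) := smoothFn_snd.sub (smoothFn_comp_fst hv₀)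

theorem along_snd_sub (W : VField (model m) (B × ℝ)) {v₀ : B → ℝ} (hv₀ : SmoothFn (𝓡 m) v₀)
    (p : B × ℝ) : along (model m) W (fun p : B × ℝ ↦ p.2 - v₀ p.1) p =
      ver (W p) - mvfderiv (𝓡 m) v₀ p.1 (hor (W p)) := by
  have := congrFun (along_sub (X := W) smoothFn_snd (smoothFn_comp_fst hv₀)) p
  rw [along_snd, along_comp_fst _ hv₀] at this
  exact this

theorem along_vertical_snd_sub {v₀ : B → ℝ} (hv₀ : SmoothFn (𝓡 m) v₀) :
    along (model m) (vertical m B) (fun p : B × ℝ ↦ p.2 - v₀ p.1) = fun _ ↦ 1 := by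
  funext p
  rw [along_snd_sub _ hv₀]; simp

theorem dense_setOf_snd_ne (w : B → ℝ) : Dense {p : B × ℝ | p.2 ≠ w p.1} := fun p ↦
  map_mem_closure (f := fun v : ℝ ↦ (p.1, v)) (by fun_prop) (dense_compl_singleton (w p.1) p.2)
    fun _ hv ↦ hv

theorem IsNatural.sum_verLieConn (G : IsStationaryGeometry g r q D) {f : B × ℝ → ℝ}
    (hf : SmoothFn (model m) f) (hn : IsNatural q D (f • vertical m B)) {p : B × ℝ}
    {e : Fin m → VField (model m) (B × ℝ)} (he : ∀ i, SmoothField (model m) (e i))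
    (hep : OrthonormalAt q e p) : ∑ i, verLieConn D (f • vertical m B) (e i) (e i) p = 0 := by
  refine (isTensor_verLieConn G.leviCivita.1 (smoothField_vertical.smul hf)).sum_eq_zero_of_dense
    G.smooth_q G.symm' G.nonneg' hn.dense (fun y hy ε hε hεy ↦ ?_) he hep
  have h1 := hn.trace_zero y hy ε hε hεy
  simp only [tensorN, nullFactor] at h1
  rw [← Finset.sum_div, div_eq_zero_iff] at h1
  refine h1.resolve_right fun h0 ↦ hy ?_
  have h2 : f y = 0 := by simpa using h0
  rw [Pi.smul_apply', h2, zero_smul]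

variable {K : VField (𝓡 m) B} {a b : B → ℝ}

theorem bracket_affineField_vertical (hK : SmoothField (𝓡 m) K) (ha : SmoothFn (𝓡 m) a)
    (hb : SmoothFn (𝓡 m) b) :
    bracket (model m) (affineField K a b) (vertical m B) =
      -((fun p : B × ℝ ↦ a p.1) • vertical m B) := by
  have hv := smoothField_vertical (m := m) (B := B)
  have hs := smoothFn_affine ha hb
  have h1 : along (model m) (vertical m B) (fun p : B × ℝ ↦ a p.1 * p.2 + b p.1) =
      fun p ↦ a p.1 := by
    have h2 := along_add (X := vertical m B) ((smoothFn_comp_fst ha).mul smoothFn_snd)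
      (smoothFn_comp_fst hb)
    rw [along_mul (smoothFn_comp_fst ha) smoothFn_snd, along_vertical_comp_fst ha,
      along_vertical_comp_fst hb, along_snd] at h2
    refine Eq.trans h2 ?_
    funext p; simp
  rw [bracket_swap, affineField, bracket_add_right hK.liftField (hv.smul hs),
    bracket_vertical_liftField hK, bracket_smul_right hs hv, bracket_self, h1]
  simp

theorem bracket_affineField_smul_vertical (hK : SmoothField (𝓡 m) K) (ha : SmoothFn (𝓡 m) a)
    (hb : SmoothFn (𝓡 m) b) {f : B × ℝ → ℝ} (hf : SmoothFn (model m) f) :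
    bracket (model m) (affineField K a b) (f • vertical m B) =
      (fun p ↦ along (model m) (affineField K a b) f p - a p.1 * f p) • vertical m B := by
  rw [bracket_smul_right hf smoothField_vertical, bracket_affineField_vertical hK ha hb]
  funext p
  simp only [Pi.add_apply, Pi.smul_apply', Pi.neg_apply]
  module

end NaturalFields

namespace MaximalAnalyticExtension

variable {m : ℕ} {B : Type*} [TopologicalSpace B] [T2Space B]
  [ChartedSpace (EuclideanSpace ℝ (Fin m)) B] [IsManifold (𝓡 m) ∞ B]
  {M : Type*} [TopologicalSpace M] [T2Space M]
  [ChartedSpace (EuclideanSpace ℝ (Fin (m + 2))) M] [IsManifold (𝓡 (m + 2)) ∞ M]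
  {S : Spacetime m M} {h : NonExpandingHorizon S B} (A : MaximalAnalyticExtension h.q h.D)
  {X W : VField (model m) (B × ℝ)}

theorem lieBilin_eq_zero_of_symmetry (hX : SmoothField (model m) X)
    (hXq : LieDragged (model m) X h.q) (hW : SmoothField (model m) W)
    (hXW : ∀ p, mfderiv (model m) (model m) A.incl p (X p) = W (A.incl p))
    {Y Z : VField (model m) (B × ℝ)} (hY : SmoothField (model m) Y) (hZ : SmoothField (model m) Z)
    (p : B × ℝ) : lieBilin (model m) W A.qExt Y Z (A.incl p) = 0 := by
  have hb : ∀ {Y : VField (model m) (B × ℝ)}, SmoothField (model m) Y →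
      bracket (model m) W Y (A.incl p) =
        mfderiv (model m) (model m) A.incl p (bracket (model m) X (A.pull Y) p) := fun hY ↦
    ((A.relatedNear_of_eq hXW p).bracket A.contMDiff_incl hX (A.smooth_pull hY) hW hY
      (A.related_pull _ p)).self_of_nhds
  have h1 := hXq _ _ (A.smooth_pull hY) (A.smooth_pull hZ) p
  have h2 : (fun y ↦ h.q y (A.pull Y y) (A.pull Z y)) =
      (fun y ↦ A.qExt y (Y y) (Z y)) ∘ A.incl := by
    funext y
    rw [← A.restrict_q_apply, A.mfderiv_pull, A.mfderiv_pull]; rfl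
  have h3 := ((A.relatedNear_of_eq hXW p).along A.contMDiff_incl
    (A.smooth_qExt.smoothFn hY hZ)).self_of_nhds
  rw [lieBilin, h2, ← h3, ← A.restrict_q_apply, ← A.restrict_q_apply, A.mfderiv_pull,
    A.mfderiv_pull, ← hb hY, ← hb hZ] at h1
  exact h1

theorem eventually_lieConn_eq_zero (hX : IsInfinitesimalSymmetry h.q h.D X)
    (hW : SmoothField (model m) W)
    (hXW : ∀ p, mfderiv (model m) (model m) A.incl p (X p) = W (A.incl p))
    {Y Z : VField (model m) (B × ℝ)} (hY : SmoothField (model m) Y) (hZ : SmoothField (model m) Z)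
    (p : B × ℝ) : ∀ᶠ y in 𝓝 (A.incl p), lieConn W A.DExt Y Z y = 0 := by
  filter_upwards [A.isOpen_range.mem_nhds (Set.mem_range_self p)]
  rintro _ ⟨p', rfl⟩
  exact A.lieConn_eq_zero_of_symmetry hX hW hXW hY hZ p'

variable {K : VField (𝓡 m) B} {a b v₀ : B → ℝ}

/-- The bracket of a symmetry with a natural field is trace free, like the natural field. -/
theorem sum_verLieConn_bracket (hX : IsInfinitesimalSymmetry h.q h.D X)
    (hK : SmoothField (𝓡 m) K) (ha : SmoothFn (𝓡 m) a) (hb : SmoothFn (𝓡 m) b)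
    (hXK : ∀ p, mfderiv (model m) (model m) A.incl p (X p) = affineField K a b (A.incl p))
    (hv₀ : SmoothFn (𝓡 m) v₀)
    (hn : IsNatural A.qExt A.DExt ((fun p : B × ℝ ↦ p.2 - v₀ p.1) • vertical m B)) (p : B × ℝ)
    {e : Fin m → VField (model m) (B × ℝ)} (he : ∀ i, SmoothField (model m) (e i))
    (hep : OrthonormalAt A.qExt e (A.incl p)) :
    ∑ i, verLieConn A.DExt (bracket (model m) (affineField K a b)
      ((fun p : B × ℝ ↦ p.2 - v₀ p.1) • vertical m B)) (e i) (e i) (A.incl p) = 0 := by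
  have G := A.isStationaryGeometry
  set f : B × ℝ → ℝ := fun p ↦ p.2 - v₀ p.1 with hf
  have hfs : SmoothFn (model m) f := smoothFn_snd_sub hv₀
  have hfv : along (model m) (vertical m B) f = fun _ ↦ 1 := along_vertical_snd_sub hv₀
  have hD := A.smooth_DExt
  have hW := hK.affineField ha hb
  have hℓ := (smoothField_vertical (m := m) (B := B)).smul hfs
  have hc := isTensor_verLieConn hD hℓ
  have h1 := hc.sum_lie_eq_zero G.smooth_q G.symm' G.nonneg' hW
    (fun Y Z hY hZ ↦ A.lieBilin_eq_zero_of_symmetry hX.1 hX.2.2.1 hW hXK hY hZ p) dense_univ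
    (fun y _ ε hε hεy ↦ hn.sum_verLieConn G hfs hε hεy) he
    hep (fun Y Z hY hZ ↦ G.eq_sum hc (fun Z hZ ↦ G.verLieConn_vertical_left hfs hfv hZ _) he hep
      hY hZ) (fun Y Z hY hZ ↦ G.eq_sum hc.swap
        (fun Z hZ ↦ G.verLieConn_vertical_right hfs hfv hZ _) he hep hZ hY)
  have h2 := hn.sum_verLieConn G hfs he hep
  have h3 : ∀ i, verLieConn A.DExt (bracket (model m) (affineField K a b) (f • vertical m B))
      (e i) (e i) (A.incl p) =
      (along (model m) (affineField K a b) (verLieConn A.DExt (f • vertical m B) (e i) (e i))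
        (A.incl p) - verLieConn A.DExt (f • vertical m B)
          (bracket (model m) (affineField K a b) (e i)) (e i) (A.incl p)
        - verLieConn A.DExt (f • vertical m B) (e i)
          (bracket (model m) (affineField K a b) (e i)) (A.incl p))
        - a (A.incl p).1 * verLieConn A.DExt (f • vertical m B) (e i) (e i) (A.incl p) := by
    intro i
    have h4 := lieConn_bracket hD hW hℓ
      (fun Y Z hY hZ ↦ A.eventually_lieConn_eq_zero hX hW hXK hY hZ p) (he i) (he i)
    rw [verLieConn, h4, G.lieConn_smul_vertical hfs (he i) (he i),
      bracket_affineField_smul_vertical hK ha hb (hc.smoothFn (he i) (he i))]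
    simp only [ver_sub, Pi.smul_apply', ver_smul, ver_vertical, verLieConn]
    ring
  rw [Finset.sum_congr rfl fun i _ ↦ h3 i, Finset.sum_sub_distrib, h1, ← Finset.mul_sum, h2]
  simp

/-- The bracket of a symmetry with the invariant vector field vanishes. -/
theorem bracket_invariant_eq_zero (hX : IsInfinitesimalSymmetry h.q h.D X)
    (hK : SmoothField (𝓡 m) K) (ha : SmoothFn (𝓡 m) a) (hb : SmoothFn (𝓡 m) b)
    (hXK : ∀ p, mfderiv (model m) (model m) A.incl p (X p) = affineField K a b (A.incl p))
    (hv₀ : SmoothFn (𝓡 m) v₀)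
    (hn : A.IsInvariantVector ((fun p : B × ℝ ↦ p.2 - v₀ p.1) • vertical m B)) (x : B) :
    b x + a x * v₀ x - along (𝓡 m) K v₀ x = 0 := by
  have G := A.isStationaryGeometry
  have hD := A.smooth_DExt
  have hv := smoothField_vertical (m := m) (B := B)
  let φ : B → ℝ := fun x ↦ b x + a x * v₀ x - along (𝓡 m) K v₀ x
  have hφ : SmoothFn (𝓡 m) φ := (hb.add (ha.mul hv₀)).sub (smoothFn_along hK hv₀)
  have hφs := smoothFn_comp_fst hφ
  have hφv := along_vertical_comp_fst hφ
  have hbr : bracket (model m) (affineField K a b) ((fun p : B × ℝ ↦ p.2 - v₀ p.1) • vertical m B) =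
      (fun p : B × ℝ ↦ φ p.1) • vertical m B := by
    rw [bracket_affineField_smul_vertical hK ha hb (smoothFn_snd_sub hv₀)]
    congr 1
    funext p
    rw [along_snd_sub _ hv₀, ver_affineField, hor_affineField]
    simp only [φ, along]
    ring
  have hlift : ∀ (e : Fin m → VField (𝓡 m) B), (∀ i, SmoothField (𝓡 m) (e i)) → ∀ x,
      OrthonormalAt (baseMetric h.q) e x → ∀ v, ∑ i, verLieConn A.DExt
        ((fun p : B × ℝ ↦ φ p.1) • vertical m B) (liftField (e i)) (liftField (e i)) (x, v) = 0 := by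
    intro e he x hex v
    refine congrFun (A.eq_of_analytic (f := fun v ↦ ∑ i, verLieConn A.DExt
        ((fun p : B × ℝ ↦ φ p.1) • vertical m B) (liftField (e i)) (liftField (e i)) (x, v))
      (g := fun _ ↦ 0) ?_ analyticOnNhd_const x fun v p hp ↦ ?_) v
    · exact Finset.analyticOnNhd_fun_sum _ fun i _ ↦
        G.analytic_verLieConn_base hφ (he i) (he i) x
    · rw [← hp, ← hbr]
      refine A.sum_verLieConn_bracket hX hK ha hb hXK hv₀ hn.1 p (fun i ↦ (he i).liftField) ?_
      exact G.orthonormalAt_liftField (by rw [hp]; exact hex)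
  have hall : ∀ (p : B × ℝ) (e : Fin m → VField (model m) (B × ℝ)),
      (∀ i, SmoothField (model m) (e i)) → OrthonormalAt A.qExt e p → ∑ i, verLieConn A.DExt
        ((fun p : B × ℝ ↦ φ p.1) • vertical m B) (e i) (e i) p = 0 := by
    intro p e he hep
    have hs := fun i ↦ (he i).hor_slice p.2
    rw [← hlift _ hs p.1 (G.orthonormalAt_slice hep) p.2]
    have hc := isTensor_verLieConn hD (hv.smul hφs)
    refine Finset.sum_congr rfl fun i _ ↦ ?_
    rw [hc.congr_of_hor_eq (Y := e i) (Y' := liftField fun x ↦ hor (e i (x, p.2)))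
        (fun Z hZ ↦ G.verLieConn_vertical_left hφs hφv hZ p) (he i) (hs i).liftField (he i) rfl,
      hc.swap.congr_of_hor_eq (Y := e i) (Y' := liftField fun x ↦ hor (e i (x, p.2)))
        (fun Z hZ ↦ G.verLieConn_vertical_right hφs hφv hZ p) (he i) (hs i).liftField
        (hs i).liftField rfl]
  have hw₀ : SmoothFn (𝓡 m) (fun x ↦ v₀ x - φ x) := hv₀.sub hφ
  have hfs := smoothFn_snd_sub hw₀
  have hfv := along_vertical_snd_sub hw₀
  have hsum : (fun p : B × ℝ ↦ p.2 - (v₀ p.1 - φ p.1)) • vertical m B =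
      (fun p : B × ℝ ↦ p.2 - v₀ p.1) • vertical m B + (fun p : B × ℝ ↦ φ p.1) • vertical m B := by
    funext p
    simp only [Pi.add_apply, Pi.smul_apply']
    module
  have hnat : IsNatural A.qExt A.DExt ((fun p : B × ℝ ↦ p.2 - (v₀ p.1 - φ p.1)) • vertical m B) := by
    refine ⟨⟨hv.smul hfs, fun p ↦ ?_⟩, ?_, fun p ↦ ?_, fun p hp e he hep ↦ ?_⟩
    · simp [G.apply_vertical]
    · refine Dense.mono (fun p (hp : p.2 ≠ v₀ p.1 - φ p.1) h0 ↦ hp (sub_eq_zero.1 ?_))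
        (dense_setOf_snd_ne fun x ↦ v₀ x - φ x)
      simpa using congrArg (fun u ↦ ver u) h0
    · rw [G.nabla_smul_vertical hfs, along_smul_left, hfv]
      simp
    · simp only [tensorN, nullFactor]
      rw [← Finset.sum_div, div_eq_zero_iff]
      left
      have h1 : ∀ i, ver (lieConn ((fun p : B × ℝ ↦ p.2 - (v₀ p.1 - φ p.1)) • vertical m B) A.DExt
          (e i) (e i) p) = verLieConn A.DExt
          ((fun p : B × ℝ ↦ p.2 - v₀ p.1) • vertical m B) (e i) (e i) p + verLieConn A.DExt
            ((fun p : B × ℝ ↦ φ p.1) • vertical m B) (e i) (e i) p := fun i ↦ by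
        rw [hsum, lieConn_add_field (hv.smul (smoothFn_snd_sub hv₀)) (hv.smul hφs) (he i)]; rfl
      rw [Finset.sum_congr rfl fun i _ ↦ h1 i, Finset.sum_add_distrib, hall p e he hep,
        hn.1.sum_verLieConn G (smoothFn_snd_sub hv₀) he hep, add_zero]
  have h1 := congrFun (hn.2 _ hnat) (x, 0)
  have h2 := congrArg (fun u ↦ ver u) h1
  simp only [Pi.smul_apply', ver_smul, ver_vertical] at h2
  change φ x = 0
  linarith

end MaximalAnalyticExtension

section Riemannian

variable {E : Type*} [NormedAddCommGroup E] [NormedSpace ℝ E] [FiniteDimensional ℝ E]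
  {H : Type*} [TopologicalSpace H] {I : ModelWithCorners ℝ E H} {M : Type*} [TopologicalSpace M]
  [T2Space M] [ChartedSpace H M] [IsManifold I ∞ M]
  {q : BilinField I M} {D : Connection I M} {K : VField I M}

theorem mvfderiv_log {u : M → ℝ} {x : M} (hu : MDifferentiableAt I 𝓘(ℝ, ℝ) u x) (hx : u x ≠ 0)
    (w : TangentSpace I x) :
    mvfderiv I (fun y ↦ Real.log (u y)) x w = mvfderiv I u x w / u x := by
  have h1 : MDifferentiableAt 𝓘(ℝ, ℝ) 𝓘(ℝ, ℝ) Real.log (u x) :=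
    (Real.differentiableAt_log hx).mdifferentiableAt
  have h2 := mfderiv_comp_apply x h1 hu w
  rw [mfderiv_eq_fderiv] at h2
  have h3 : ∀ s : ℝ, fderiv ℝ Real.log (u x) s = s / u x := fun s ↦ by
    rw [fderiv_eq_smul_deriv, Real.deriv_log, smul_eq_mul, div_eq_mul_inv]
  exact h2.trans (h3 _)

theorem smoothFn_log {u : M → ℝ} (hu : SmoothFn I u) (h0 : ∀ x, u x ≠ 0) :
    SmoothFn I (fun y ↦ Real.log (u y)) := fun x ↦
  ContMDiffAt.comp x (Real.contDiffAt_log.2 (h0 x)).contMDiffAt (hu x)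

theorem IsKilling.lieConn_eq_zero (hK : IsKilling q K) (hD : IsLeviCivita q D)
    (hq : SmoothOnFields q) (hsymm : ∀ x u w, q x u w = q x w u)
    (hdef : ∀ x u, q x u u = 0 → u = 0) {Y Z : VField I M} (hY : SmoothField I Y)
    (hZ : SmoothField I Z) : lieConn K D Y Z = 0 := funext fun x ↦
  hdef x _ (hD.lieConn_orthogonal hq hsymm hK.1 hK.2 hY hZ (hK.1.lieConn hD.1 hY hZ) x)

theorem IsLeviCivita.nabla_eq {D' : Connection I M} (hD : IsLeviCivita q D)
    (hD' : IsLeviCivita q D') (hsymm : ∀ x u w, q x u w = q x w u)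
    (hdef : ∀ x u, q x u u = 0 → u = 0) {Y Z : VField I M} (hY : SmoothField I Y)
    (hZ : SmoothField I Z) : nabla D Y Z = nabla D' Y Z := funext fun x ↦
  sub_eq_zero.1 (hdef x _ (hD.unique hD' hsymm hY hZ
    ((hY.nabla hD.1 hZ).sub (hY.nabla hD'.1 hZ)) x))

/-- If a Killing field drags a divergence free 1-form up to `du`, then `u` is harmonic. -/
theorem IsKilling.isHarmonic {k : ℕ} (hk : Module.finrank ℝ E = k) (hK : IsKilling q K)
    (hD : IsLeviCivita q D) (hq : SmoothOnFields q) (hsymm : ∀ x u w, q x u w = q x w u)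
    (hnonneg : ∀ x u, 0 ≤ q x u u) (hdef : ∀ x u, q x u u = 0 → u = 0) {α : CovField I M}
    (hα : ∀ Y, SmoothField I Y → SmoothFn I (fun x ↦ α x (Y x)))
    (hdiv : ∀ e : Fin k → VField I M, (∀ i, SmoothField I (e i)) → ∀ x, OrthonormalAt q e x →
      ∑ i, covDer D α (e i) (e i) x = 0) {u : M → ℝ}
    (hu : ∀ Y, SmoothField I Y → lieCov I K α Y = along I Y u) : IsHarmonic k q D u := by
  intro x e he hex
  have hc := isTensor_covDer hD.1 hα
  have hl : ∀ {c : VField I M → VField I M → M → ℝ}, IsTensor c → ∀ Y Z, SmoothField I Y →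
      SmoothField I Z → c Y Z x = ∑ j, q x (Y x) (e j x) * c (e j) Z x := by
    intro c hc Y Z hY hZ
    rw [hc.congr hY hZ (SmoothField.sum _ fun j ↦ (he j).const_smul (q x (Y x) (e j x))) hZ
      (by rw [Finset.sum_apply]; exact hex.sum_smul hk (Y x)) rfl, hc.sum_left he _ hZ]
    simp
  have h1 := hc.sum_lie_eq_zero hq hsymm hnonneg hK.1 (fun Y Z hY hZ ↦ hK.2 Y Z hY hZ x) dense_univ
    (fun y _ ε hε hεy ↦ hdiv ε hε y hεy) he hex (hl hc) (fun Y Z hY hZ ↦ hl hc.swap Z Y hZ hY)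
  rw [← h1]
  refine Finset.sum_congr rfl fun i _ ↦ ?_
  have hi := he i
  have hb := hK.1.bracket hi
  have hn := hi.nabla hD.1 hi
  have e1 := congrFun (hK.lieConn_eq_zero hD hq hsymm hdef hi hi) x
  have e2 := congrArg (α x) e1
  simp only [lieConn, map_sub, Pi.zero_apply, map_zero] at e2
  have e3 := congrFun (hu _ hn) x
  have e4 : along I (e i) (along I (e i) u) x = along I (e i) (along I K (fun y ↦ α y (e i y))) x -
      along I (e i) (fun y ↦ α y (bracket I K (e i) y)) x := by
    rw [← hu _ hi, ← Pi.sub_apply, ← along_sub (smoothFn_along hK.1 (hα _ hi)) (hα _ hb)]; rfl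
  have e5 : along I K (covDer D α (e i) (e i)) x = along I K (along I (e i) (fun y ↦ α y (e i y))) x -
      along I K (fun y ↦ α y (nabla D (e i) (e i) y)) x := by
    rw [← Pi.sub_apply, ← along_sub (smoothFn_along hi (hα _ hi)) (hα _ hn)]; rfl
  have e6 := congrFun (along_bracket hK.1 hi (hα _ hi)) x
  rw [hess_apply, e4, ← e3, e5, lieCov, covDer, covDer, e6, Pi.sub_apply]
  linarith

/-- Functions whose differentials differ by divergence free 1-forms differ by harmonic functions. -/
theorem isHarmonic_sub {k : ℕ} {D' : Connection I M} (hD : IsLeviCivita q D)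
    (hD' : IsLeviCivita q D') (hsymm : ∀ x u w, q x u w = q x w u)
    (hdef : ∀ x u, q x u u = 0 → u = 0) {α α' : CovField I M}
    (hα : ∀ Y, SmoothField I Y → SmoothFn I (fun x ↦ α x (Y x)))
    (hα' : ∀ Y, SmoothField I Y → SmoothFn I (fun x ↦ α' x (Y x)))
    (hdiv : ∀ e : Fin k → VField I M, (∀ i, SmoothField I (e i)) → ∀ x, OrthonormalAt q e x →
      ∑ i, covDer D α (e i) (e i) x = 0)
    (hdiv' : ∀ e : Fin k → VField I M, (∀ i, SmoothField I (e i)) → ∀ x, OrthonormalAt q e x →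
      ∑ i, covDer D' α' (e i) (e i) x = 0) {u : M → ℝ}
    (hu : ∀ x w, α x w - α' x w = mvfderiv I u x w) : IsHarmonic k q D u := by
  intro x e he hex
  have h1 := hdiv e he x hex
  have h2 := hdiv' e he x hex
  rw [← sub_self (0 : ℝ)]
  nth_rw 1 [← h1]
  rw [← h2, ← Finset.sum_sub_distrib]
  refine Finset.sum_congr rfl fun i _ ↦ ?_
  have e1 : along I (e i) u = (fun y ↦ α y (e i y)) - fun y ↦ α' y (e i y) :=
    funext fun y ↦ (hu y _).symm
  have e2 := hu x (nabla D (e i) (e i) x)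
  rw [hess_apply, e1, along_sub (hα _ (he i)) (hα' _ (he i)), covDer, covDer,
    ← hD.nabla_eq hD' hsymm hdef (he i) (he i), along, ← e2]
  simp only [Pi.sub_apply]
  ring

end Riemannian

section GoodCuts

variable {m : ℕ} {B : Type*} [TopologicalSpace B] [T2Space B]
  [ChartedSpace (EuclideanSpace ℝ (Fin m)) B] [IsManifold (𝓡 m) ∞ B]
  {g : BilinField (𝓡 m) B} {r : CovField (𝓡 m) B} {q : BilinField (model m) (B × ℝ)}
  {D : Connection (model m) (B × ℝ)} {σ v₀ : B → ℝ}

theorem IsGoodCut.ne (hσ : IsGoodCut q D ((fun p : B × ℝ ↦ p.2 - v₀ p.1) • vertical m B) σ)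
    (x : B) : σ x - v₀ x ≠ 0 := fun h0 ↦ hσ.2.1 x (by simp [h0])

theorem IsGoodCut.smoothFn_log (hv₀ : SmoothFn (𝓡 m) v₀)
    (hσ : IsGoodCut q D ((fun p : B × ℝ ↦ p.2 - v₀ p.1) • vertical m B) σ) :
    SmoothFn (𝓡 m) (fun x ↦ Real.log (σ x - v₀ x)) :=
  Horizon.smoothFn_log (ContMDiff.sub hσ.1 hv₀) hσ.ne

theorem IsGoodCut.mvfderiv_eq (hv₀ : SmoothFn (𝓡 m) v₀)
    (hσ : IsGoodCut q D ((fun p : B × ℝ ↦ p.2 - v₀ p.1) • vertical m B) σ) (x : B)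
    (w : TangentSpace (𝓡 m) x) : mvfderiv (𝓡 m) σ x w = mvfderiv (𝓡 m) v₀ x w +
      (σ x - v₀ x) * mvfderiv (𝓡 m) (fun x ↦ Real.log (σ x - v₀ x)) x w := by
  have hs : SmoothFn (𝓡 m) σ := hσ.1
  have hs' : SmoothFn (𝓡 m) (fun x ↦ σ x - v₀ x) := hs.sub hv₀
  have h2 : mvfderiv (𝓡 m) (fun x ↦ σ x - v₀ x) x w =
      mvfderiv (𝓡 m) σ x w - mvfderiv (𝓡 m) v₀ x w :=
    congrArg (fun L ↦ L w) (mvfderiv_sub (hs.mdiff x) (hv₀.mdiff x))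
  rw [mvfderiv_log (hs'.mdiff x) (hσ.ne x) w, h2, mul_div_cancel₀ _ (hσ.ne x)]
  ring

theorem IsGoodCut.exists_divergenceFree (G : IsStationaryGeometry g r q D)
    (hg : baseMetric q = g) (hv₀ : SmoothFn (𝓡 m) v₀)
    (hσ : IsGoodCut q D ((fun p : B × ℝ ↦ p.2 - v₀ p.1) • vertical m B) σ) :
    ∃ (α : CovField (𝓡 m) B) (D' : Connection (𝓡 m) B), IsLeviCivita g D' ∧
      (∀ x w, α x w = r x w + mvfderiv (𝓡 m) (fun x ↦ Real.log (σ x - v₀ x)) x w) ∧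
      ∀ e : Fin m → VField (𝓡 m) B, (∀ i, SmoothField (𝓡 m) (e i)) → ∀ x, OrthonormalAt g e x →
        ∑ i, covDer D' α (e i) (e i) x = 0 := by
  subst hg
  obtain ⟨α, hα, D', hD', hdiv⟩ := hσ.2.2
  refine ⟨α, D', hD', fun x w ↦ ?_, hdiv⟩
  obtain ⟨Y, hY, hYp⟩ := exists_smoothField_apply (I := model m) (x, σ x) (graphLift σ (x, σ x) w)
  have h1 : D ((fun p : B × ℝ ↦ p.2 - v₀ p.1) • vertical m B) (x, σ x) (graphLift σ (x, σ x) w) =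
      nabla D Y ((fun p : B × ℝ ↦ p.2 - v₀ p.1) • vertical m B) (x, σ x) := by
    rw [nabla, hYp]
  have h2 := hσ.ne x
  have h3 := hσ.mvfderiv_eq hv₀ x w
  rw [hα, rotation, nullFactor, h1, G.nabla_smul_vertical (smoothFn_snd_sub hv₀)]
  simp only [Pi.smul_apply', ver_smul, ver_vertical, mul_one, Pi.add_apply, Pi.mul_apply,
    along_snd_sub _ hv₀, hYp]
  simp only [graphLift, ver_tvec, hor_tvec, h3]
  field_simp
  ring

theorem IsStationaryGeometry.smoothFn_rotation_add (G : IsStationaryGeometry g r q D) {φ : B → ℝ}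
    (hφ : SmoothFn (𝓡 m) φ) {α : CovField (𝓡 m) B}
    (hα : ∀ x w, α x w = r x w + mvfderiv (𝓡 m) φ x w) (Y : VField (𝓡 m) B)
    (hY : SmoothField (𝓡 m) Y) : SmoothFn (𝓡 m) (fun x ↦ α x (Y x)) := by
  simp only [hα]
  exact (G.smoothFn_rotation hY).add (smoothFn_along hY hφ)

variable [CompactSpace B] [ConnectedSpace B]

/-- The function `log |v - v₀|` on a good cut is unique up to a constant. -/
theorem IsGoodCut.mvfderiv_log_eq (G : IsStationaryGeometry g r q D)
    (hg : baseMetric q = g) (hv₀ : SmoothFn (𝓡 m) v₀) {σ' : B → ℝ}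
    (hσ : IsGoodCut q D ((fun p : B × ℝ ↦ p.2 - v₀ p.1) • vertical m B) σ)
    (hσ' : IsGoodCut q D ((fun p : B × ℝ ↦ p.2 - v₀ p.1) • vertical m B) σ') (x : B)
    (w : TangentSpace (𝓡 m) x) : mvfderiv (𝓡 m) (fun x ↦ Real.log (σ x - v₀ x)) x w =
      mvfderiv (𝓡 m) (fun x ↦ Real.log (σ' x - v₀ x)) x w := by
  obtain ⟨α, D₁, hD₁, hα, hdiv⟩ := hσ.exists_divergenceFree G hg hv₀
  obtain ⟨α', D₂, hD₂, hα', hdiv'⟩ := hσ'.exists_divergenceFree G hg hv₀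
  have hφ := hσ.smoothFn_log hv₀
  have hφ' := hσ'.smoothFn_log hv₀
  have hsub : ∀ x w, mvfderiv (𝓡 m) ((fun x ↦ Real.log (σ x - v₀ x)) -
      fun x ↦ Real.log (σ' x - v₀ x)) x w = mvfderiv (𝓡 m) (fun x ↦ Real.log (σ x - v₀ x)) x w -
      mvfderiv (𝓡 m) (fun x ↦ Real.log (σ' x - v₀ x)) x w := fun x w ↦ by
    rw [mvfderiv_sub (hφ.mdiff x) (hφ'.mdiff x)]; simp
  have hh := isHarmonic_sub hD₁ hD₂ G.symm G.definite (G.smoothFn_rotation_add hφ hα)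
    (G.smoothFn_rotation_add hφ' hα') hdiv hdiv'
    (u := (fun x ↦ Real.log (σ x - v₀ x)) - fun x ↦ Real.log (σ' x - v₀ x))
    (fun x w ↦ by rw [hα, hα', hsub]; ring)
  obtain ⟨c, hc⟩ := hh.const G.smooth_g G.symm G.nonneg G.definite hD₁.1 (hφ.sub hφ')
  have h1 := hsub x w
  rw [show ((fun x ↦ Real.log (σ x - v₀ x)) - fun x ↦ Real.log (σ' x - v₀ x)) = fun _ ↦ c from
    funext hc, mvfderiv_const] at h1
  exact (sub_eq_zero.1 (h1.symm.trans rfl))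

end GoodCuts

namespace MaximalAnalyticExtension

variable {m : ℕ} {B : Type*} [TopologicalSpace B] [T2Space B]
  [ChartedSpace (EuclideanSpace ℝ (Fin m)) B] [IsManifold (𝓡 m) ∞ B]
  {M : Type*} [TopologicalSpace M] [T2Space M]
  [ChartedSpace (EuclideanSpace ℝ (Fin (m + 2))) M] [IsManifold (𝓡 (m + 2)) ∞ M]
  {S : Spacetime m M} {h : NonExpandingHorizon S B} (A : MaximalAnalyticExtension h.q h.D)
  {X : VField (model m) (B × ℝ)} {K : VField (𝓡 m) B} {a b v₀ : B → ℝ}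

/-- The Lie derivative of the rotation 1-form potential of the vertical field along a symmetry. -/
theorem lieCov_omega (hX : IsInfinitesimalSymmetry h.q h.D X)
    (hK : SmoothField (𝓡 m) K) (ha : SmoothFn (𝓡 m) a) (hb : SmoothFn (𝓡 m) b)
    (hXK : ∀ p, mfderiv (model m) (model m) A.incl p (X p) = affineField K a b (A.incl p))
    {Y : VField (𝓡 m) B} (hY : SmoothField (𝓡 m) Y) (x : B) :
    lieCov (𝓡 m) K A.omega Y x = -along (𝓡 m) Y a x := by
  have G := A.isStationaryGeometry
  have hv := smoothField_vertical (m := m) (B := B)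
  have hW := hK.affineField ha hb
  have hr := G.smoothFn_rotation hY
  have h3 : nabla A.DExt (liftField Y) (vertical m B) =
      (fun p : B × ℝ ↦ A.omega p.1 (Y p.1)) • vertical m B :=
    funext fun p ↦ G.nabla_vertical p _
  have has := smoothFn_comp_fst ha
  have h1 := A.lieConn_eq_zero_of_symmetry hX hW hXK hY.liftField hv (x, 0)
  have hp := A.incl_fst (x, 0)
  rw [lieConn, h3, bracket_affineField_smul_vertical hK ha hb (smoothFn_comp_fst hr),
    bracket_affineField_vertical hK ha hb, nabla_neg_right (hv.smul has),
    G.nabla_smul_vertical has, along_comp_fst _ hr, along_liftField_comp_fst _ ha, nabla,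
    G.nabla_vertical, hor_bracket_liftField hW hK (fun p ↦ hor_affineField p) hY] at h1
  have h2 := congrArg (fun u ↦ ver u) h1
  simp only [ver_sub, Pi.smul_apply', Pi.neg_apply, ver_neg, ver_smul, ver_vertical, ver_zero,
    hor_affineField, hor_liftField, Pi.add_apply, Pi.mul_apply] at h2
  generalize A.incl (x, 0) = y at hp h2
  obtain ⟨z, s⟩ := y
  obtain rfl : z = x := hp
  simp only [lieCov, along] at h2 ⊢
  linarith

variable [CompactSpace B] [ConnectedSpace B]

/-- On a good cut, the derivative of `log |v - v₀|` along a symmetry differs from `a` by a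
constant. -/
theorem exists_along_log_eq (hX : IsInfinitesimalSymmetry h.q h.D X)
    (hK : IsKilling (baseMetric h.q) K) (ha : SmoothFn (𝓡 m) a) (hb : SmoothFn (𝓡 m) b)
    (hXK : ∀ p, mfderiv (model m) (model m) A.incl p (X p) = affineField K a b (A.incl p))
    (hv₀ : SmoothFn (𝓡 m) v₀) {σ : B → ℝ}
    (hσ : IsGoodCut A.qExt A.DExt ((fun p : B × ℝ ↦ p.2 - v₀ p.1) • vertical m B) σ) :
    ∃ c : ℝ, ∀ x, along (𝓡 m) K (fun x ↦ Real.log (σ x - v₀ x)) x = a x - c := by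
  have G := A.isStationaryGeometry
  have hφ := hσ.smoothFn_log hv₀
  obtain ⟨α, D', hD', hα, hdiv⟩ := hσ.exists_divergenceFree G A.baseMetric_eq.symm hv₀
  have hαs := G.smoothFn_rotation_add hφ hα
  have hKφ := smoothFn_along hK.1 hφ
  have hh := hK.isHarmonic finrank_euclideanSpace_fin hD' G.smooth_g G.symm G.nonneg G.definite
    hαs hdiv (u := along (𝓡 m) K (fun x ↦ Real.log (σ x - v₀ x)) - a) (fun Y hY ↦ by
      funext x
      have e1 := A.lieCov_omega hX hK.1 ha hb hXK hY x
      have e2 : (fun y ↦ α y (Y y)) = (fun y ↦ A.omega y (Y y)) +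
          along (𝓡 m) Y (fun x ↦ Real.log (σ x - v₀ x)) := funext fun y ↦ hα y _
      have e3 := congrFun (along_bracket hK.1 hY hφ) x
      rw [along_sub hKφ ha, lieCov, e2, along_add (G.smoothFn_rotation hY) (smoothFn_along hY hφ),
        hα]
      simp only [Pi.sub_apply, Pi.add_apply, lieCov] at e1 e3 ⊢
      simp only [along] at e1 e3 ⊢
      linarith)
  obtain ⟨c, hc⟩ := hh.const G.smooth_g G.symm G.nonneg G.definite hD'.1 (hKφ.sub ha)
  exact ⟨-c, fun x ↦ by linarith [hc x]⟩

end MaximalAnalyticExtension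

section Foliation

variable {m : ℕ} {B : Type*} [TopologicalSpace B] [T2Space B]
  [ChartedSpace (EuclideanSpace ℝ (Fin m)) B] [IsManifold (𝓡 m) ∞ B]
  {g : BilinField (𝓡 m) B} {r : CovField (𝓡 m) B} {q : BilinField (model m) (B × ℝ)}
  {D : Connection (model m) (B × ℝ)} {σ v₀ : B → ℝ}

theorem isOpen_setOf_snd_sub_ne (hv₀ : SmoothFn (𝓡 m) v₀) :
    IsOpen {p : B × ℝ | p.2 - v₀ p.1 ≠ 0} :=
  isOpen_ne_fun (smoothFn_snd_sub hv₀).continuous continuous_const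

/-- The foliation covector is locally the differential of `φ - log |v - v₀|`, where
`φ = log |σ - v₀|` for any good cut `σ`. -/
theorem IsFoliationCovector.exists_eventually_eq [CompactSpace B] [ConnectedSpace B]
    (G : IsStationaryGeometry g r q D) (hg : baseMetric q = g) (hv₀ : SmoothFn (𝓡 m) v₀)
    {n : CovField (model m) (B × ℝ)}
    (hn : IsFoliationCovector q D ((fun p : B × ℝ ↦ p.2 - v₀ p.1) • vertical m B) n)
    (hσ : IsGoodCut q D ((fun p : B × ℝ ↦ p.2 - v₀ p.1) • vertical m B) σ) {p : B × ℝ}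
    (hp : p.2 - v₀ p.1 ≠ 0) :
    ∃ ψ : B × ℝ → ℝ, SmoothFn (model m) ψ ∧ ∀ᶠ y in 𝓝 p, y.2 - v₀ y.1 ≠ 0 ∧
      (∀ u, n y u = mvfderiv (model m) ψ y u) ∧
      ∀ u, mvfderiv (model m) ψ y u =
        mvfderiv (𝓡 m) (fun x ↦ Real.log (σ x - v₀ x)) y.1 (hor u) -
          (ver u - mvfderiv (𝓡 m) v₀ y.1 (hor u)) / (y.2 - v₀ y.1) := by
  have ho := isOpen_setOf_snd_sub_ne hv₀
  have hfs := smoothFn_snd_sub hv₀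
  have hφ := hσ.smoothFn_log hv₀
  have hφs := smoothFn_comp_fst hφ
  have hlog : ∀ y : B × ℝ, y.2 - v₀ y.1 ≠ 0 → ContMDiffAt (model m) 𝓘(ℝ, ℝ) ∞
      (fun y : B × ℝ ↦ Real.log (y.2 - v₀ y.1)) y := fun y hy ↦
    ContMDiffAt.comp y (Real.contDiffAt_log.2 hy).contMDiffAt (hfs y)
  obtain ⟨ψ, hψ, hψe⟩ := exists_smoothFn_eventuallyEq ho hp
    (f := fun y : B × ℝ ↦ Real.log (σ y.1 - v₀ y.1) - Real.log (y.2 - v₀ y.1))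
    (fun y hy ↦ ((hφs y).sub (hlog y hy)).contMDiffWithinAt)
  have hder : ∀ᶠ y in 𝓝 p, ∀ u, mvfderiv (model m) ψ y u =
      mvfderiv (𝓡 m) (fun x ↦ Real.log (σ x - v₀ x)) y.1 (hor u) -
          (ver u - mvfderiv (𝓡 m) v₀ y.1 (hor u)) / (y.2 - v₀ y.1) := by
    filter_upwards [hψe.eventually_nhds, ho.mem_nhds hp] with y hy hy0 u
    obtain ⟨U, hU, hUu⟩ := exists_smoothField_apply (I := model m) y u
    have h1 : mvfderiv (model m) ψ y u = along (model m) U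
        (fun y : B × ℝ ↦ Real.log (σ y.1 - v₀ y.1) - Real.log (y.2 - v₀ y.1)) y := by
      rw [← along_congr hy, along, hUu]
    have h2 : mvfderiv (model m)
        (fun y : B × ℝ ↦ Real.log (σ y.1 - v₀ y.1) - Real.log (y.2 - v₀ y.1)) y u =
        mvfderiv (model m) (fun y : B × ℝ ↦ Real.log (σ y.1 - v₀ y.1)) y u -
        mvfderiv (model m) (fun y : B × ℝ ↦ Real.log (y.2 - v₀ y.1)) y u :=
      congrArg (fun L ↦ L u) (mvfderiv_sub (hφs.mdiff y)
        ((hlog y hy0).mdifferentiableAt (by simp)))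
    have h3 := along_snd_sub U hv₀ y
    rw [along, hUu] at h3
    rw [h1, along, hUu, h2, mvfderiv_log (hfs.mdiff y) hy0, h3, mvfderiv_comp_fst u hφ]
  refine ⟨ψ, hψ, ?_⟩
  filter_upwards [hder, ho.mem_nhds hp] with y hy hy0
  refine ⟨hy0, fun u ↦ ?_, hy⟩
  have hy0' : ((fun p : B × ℝ ↦ p.2 - v₀ p.1) • vertical m B) y ≠ 0 := fun h0 ↦
    hy0 (by simpa using congrArg (fun u ↦ ver u) h0)
  obtain ⟨τ, hτ, hτy, hτn⟩ := hn.orthogonal y hy0'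
  have h1 := hn.normalized y hy0'
  rw [Pi.smul_apply', map_smul, smul_eq_mul] at h1
  have h2 : u = graphLift τ y (hor u) +
      (ver u - mvfderiv (𝓡 m) τ y.1 (hor u)) • vertical m B y :=
    tangent_prod_ext (by simp [graphLift]) (by simp [graphLift])
  have h3 := hτ.mvfderiv_eq hv₀ y.1 (hor u)
  rw [hτy, hτ.mvfderiv_log_eq G hg hv₀ hσ] at h3
  have h4 : n y (vertical m B y) = -1 / (y.2 - v₀ y.1) := by
    rw [eq_div_iff hy0, mul_comm]; exact h1
  rw [hy]
  conv_lhs => rw [h2, map_add, map_smul, hτn, h4, h3]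
  rw [smul_eq_mul]
  field_simp
  ring

end Foliation

namespace MaximalAnalyticExtension

variable {m : ℕ} {B : Type*} [TopologicalSpace B] [T2Space B]
  [ChartedSpace (EuclideanSpace ℝ (Fin m)) B] [IsManifold (𝓡 m) ∞ B]
  {M : Type*} [TopologicalSpace M] [T2Space M]
  [ChartedSpace (EuclideanSpace ℝ (Fin (m + 2))) M] [IsManifold (𝓡 (m + 2)) ∞ M]
  {S : Spacetime m M} {h : NonExpandingHorizon S B} (A : MaximalAnalyticExtension h.q h.D)
  {X W : VField (model m) (B × ℝ)} {K : VField (𝓡 m) B} {a b v₀ : B → ℝ}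

/-- A 1-form on the extension which is locally the differential of a function that changes at a
constant rate along a field is dragged by that field. -/
theorem lieCov_restrictCovector_eq_zero {n : CovField (model m) (B × ℝ)} {p : B × ℝ} {c : ℝ}
    (hX : SmoothField (model m) X)
    (hXW : ∀ p, mfderiv (model m) (model m) A.incl p (X p) = W (A.incl p))
    {ψ : B × ℝ → ℝ} (hψ : SmoothFn (model m) ψ)
    (hn : ∀ᶠ y in 𝓝 (A.incl p), (∀ u, n y u = mvfderiv (model m) ψ y u) ∧
      mvfderiv (model m) ψ y (W y) = c)
    {Y : VField (model m) (B × ℝ)} (hY : SmoothField (model m) Y) :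
    lieCov (model m) X (A.restrictCovector n) Y p = 0 := by
  have hΨ : SmoothFn (model m) (ψ ∘ A.incl) := hψ.comp A.contMDiff_incl
  have hn' := A.contMDiff_incl.continuous.continuousAt.eventually hn
  have hder : ∀ (y : B × ℝ) (u : TangentSpace (model m) y),
      mvfderiv (model m) (ψ ∘ A.incl) y u =
        mvfderiv (model m) ψ (A.incl y) (mfderiv (model m) (model m) A.incl y u) := fun y u ↦
    mvfderiv_comp_apply y (hψ.mdiff _) ((A.contMDiff_incl y).mdifferentiableAt (by simp)) u
  have h1 : (fun y ↦ A.restrictCovector n y (Y y)) =ᶠ[𝓝 p] along (model m) Y (ψ ∘ A.incl) := by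
    filter_upwards [hn'] with y hy
    rw [along, hder, ← hy.1]; rfl
  have h2 : along (model m) X (ψ ∘ A.incl) =ᶠ[𝓝 p] fun _ ↦ c := by
    filter_upwards [hn'] with y hy
    rw [along, hder, hXW, hy.2]
  have h3 : A.restrictCovector n p (bracket (model m) X Y p) =
      along (model m) (bracket (model m) X Y) (ψ ∘ A.incl) p := by
    rw [along, hder, ← hn'.self_of_nhds.1]; rfl
  rw [lieCov, h3, along_congr h1, along_bracket hX hY hΨ, Pi.sub_apply, along_congr h2, along_const]
  simp

theorem bracket_restrictVector (hX : SmoothField (model m) X) (hW : SmoothField (model m) W)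
    (hXW : ∀ p, mfderiv (model m) (model m) A.incl p (X p) = W (A.incl p))
    {V : VField (model m) (B × ℝ)} (hV : SmoothField (model m) V)
    (h0 : bracket (model m) W V = 0) (p : B × ℝ) :
    bracket (model m) X (A.restrictVector V) p = 0 := by
  refine A.mfderiv_injective p ?_
  have h1 := ((A.relatedNear_of_eq hXW p).bracket A.contMDiff_incl hX (A.smooth_pull hV) hW hV
    (A.related_pull V p)).self_of_nhds
  rw [h0] at h1
  exact h1.symm.trans (map_zero _).symm

end MaximalAnalyticExtension

end Horizon

end

open Horizon in
theorem mainTheorem5 {m : ℕ}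
    {M : Type*} [TopologicalSpace M] [T2Space M]
    [ChartedSpace (EuclideanSpace ℝ (Fin (m + 2))) M] [IsManifold (𝓡 (m + 2)) ∞ M]
    {B : Type*} [TopologicalSpace B] [T2Space B] [CompactSpace B] [ConnectedSpace B]
    [ChartedSpace (EuclideanSpace ℝ (Fin m)) B] [IsManifold (𝓡 m) ∞ B]
    (S : Spacetime m M) (h : NonExpandingHorizon S B)
    (A : MaximalAnalyticExtension h.q h.D) (hgen : A.InvariantGeneric)
    (ℓ' ℓ : VField (model m) (B × ℝ)) (hℓ' : A.IsInvariantVector ℓ')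
    (hℓ : ℓ = A.restrictVector ℓ')
    (n' n : CovField (model m) (B × ℝ)) (hn' : IsFoliationCovector A.qExt A.DExt ℓ' n')
    (hn : n = A.restrictCovector n')
    (X : VField (model m) (B × ℝ)) (hX : IsInfinitesimalSymmetry h.q h.D X) :
    (∀ p, bracket (model m) X ℓ p = 0) ∧
    (∀ p, ℓ p ≠ 0 → ∀ Y, SmoothField (model m) Y → lieCov (model m) X n Y p = 0) ∧
    ∃ (a : ℝ) (X' : VField (model m) (B × ℝ)) (K : VField (𝓡 m) B),
      SmoothField (model m) X' ∧
      IsKilling (baseMetric h.q) K ∧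
      (∀ p, X p = a • ℓ p + X' p) ∧
      A.TangentToGoodCuts ℓ' X' ∧
      (∀ p, hor (X' p) = K p.1) := by
  subst hℓ hn
  have G := A.isStationaryGeometry
  have hv := smoothField_vertical (m := m) (B := B)
  obtain ⟨v₀, hv₀, rfl⟩ := G.exists_of_isNatural hℓ'.1
  obtain ⟨K, a, b, hK, ha, hb, hXK, hXW⟩ := A.exists_affineField hX
  have hKill := A.isKilling_of_symmetry hX.1 hX.2.2.1 hK hXK
  have hW := hK.affineField ha hb
  have hfs := smoothFn_snd_sub hv₀
  have hb' : ∀ x, b x = along (𝓡 m) K v₀ x - a x * v₀ x := fun x ↦ by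
    linarith [A.bracket_invariant_eq_zero hX hK ha hb hXW hv₀ hℓ' x]
  have hWf : ∀ y : B × ℝ, along (model m) (affineField K a b)
      (fun p : B × ℝ ↦ p.2 - v₀ p.1) y = a y.1 * (y.2 - v₀ y.1) := fun y ↦ by
    rw [along_snd_sub _ hv₀, ver_affineField, hor_affineField, hb', along]
    ring
  obtain ⟨p₀, hp₀⟩ := hℓ'.1.dense.nonempty_iff.2 (inferInstance : Nonempty (B × ℝ))
  obtain ⟨σ₀, hσ₀, -, -⟩ := hn'.orthogonal p₀ hp₀
  obtain ⟨c, hc⟩ := A.exists_along_log_eq hX hKill ha hb hXW hv₀ hσ₀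
  have hℓs : SmoothField (model m)
      (A.restrictVector ((fun p : B × ℝ ↦ p.2 - v₀ p.1) • vertical m B)) :=
    A.smooth_pull (hv.smul hfs)
  have hℓ : ∀ p, mfderiv (model m) (model m) A.incl p
      (A.restrictVector ((fun p : B × ℝ ↦ p.2 - v₀ p.1) • vertical m B) p) =
      ((A.incl p).2 - v₀ (A.incl p).1) • vertical m B (A.incl p) := fun p ↦ A.mfderiv_pull _ p
  refine ⟨A.bracket_restrictVector hX.1 hW hXW (hv.smul hfs) ?_, fun p hp Y hY ↦ ?_, c,
    X - c • A.restrictVector ((fun p : B × ℝ ↦ p.2 - v₀ p.1) • vertical m B), K,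
    hX.1.sub (hℓs.const_smul c), hKill, fun p ↦ by simp, fun σ hσ p hp ↦
      ⟨K (A.incl p).1, ?_⟩, fun p ↦ ?_⟩
  · rw [bracket_affineField_smul_vertical hK ha hb hfs]
    funext p
    rw [Pi.smul_apply', hWf]
    simp
  · have hp' : (A.incl p).2 - v₀ (A.incl p).1 ≠ 0 := fun h0 ↦ hp (A.mfderiv_injective p (by
      rw [hℓ, h0, zero_smul]; exact (map_zero _).symm))
    obtain ⟨ψ, hψ, hψn⟩ := hn'.exists_eventually_eq G A.baseMetric_eq.symm hv₀ hσ₀ hp'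
    refine A.lieCov_restrictCovector_eq_zero (c := -c) hX.1 hXW hψ ?_ hY
    filter_upwards [hψn] with y ⟨hy0, hy1, hy2⟩
    refine ⟨hy1, ?_⟩
    have h1 := hc y.1
    have h2 := hWf y
    rw [along_snd_sub _ hv₀] at h2
    rw [hy2, h2, hor_affineField, mul_div_cancel_right₀ _ hy0]
    rw [along] at h1
    rw [h1]
    ring
  · have h1 := hσ.mvfderiv_eq hv₀ (A.incl p).1 (K (A.incl p).1)
    rw [hσ.mvfderiv_log_eq G A.baseMetric_eq.symm hv₀ hσ₀, hp] at h1
    have h2 := hc (A.incl p).1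
    rw [along] at h2
    rw [h2] at h1
    rw [Pi.sub_apply, Pi.smul_apply, map_sub, map_smul, hXW, hℓ]
    refine tangent_prod_ext (by simp [graphLift]) ?_
    simp only [graphLift, ver_sub, ver_smul, ver_affineField, ver_vertical, ver_tvec, h1, hb', along]
    ring
  · have h1 : hor (A.restrictVector ((fun p : B × ℝ ↦ p.2 - v₀ p.1) • vertical m B) p) = 0 :=
      (A.hor_pull ((fun p : B × ℝ ↦ p.2 - v₀ p.1) • vertical m B) p).trans (by simp; rfl)
    rw [Pi.sub_apply, Pi.smul_apply, hor_sub, hor_smul, h1, hXK]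
    simp
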